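/- Let $N,\beta\ge 0$ be integers and let $\gamma>-\tfrac12$ be real. On polynomials in $N$ variables over $\mathbb C$ let $s_{jk}$ exchange the $j$-th and $k$-th variables, let $t_j$ change the sign of the $j$-th variable, and put $$D^A_j=\partial_{x_j}+\beta\sum_{k\ne j}\frac{1-s_{jk}}{x_j-x_k},\qquad D^B_j=\partial_{z_j}+\beta\sum_{k\neq j}\Big(\frac{1-s_{jk}}{z_j-z_k}+\frac{1-t_jt_ks_{jk}}{z_j+z_k}\Big)+\gamma\,\frac{1-t_j}{z_j},$$ $$\hat D^A_j=x_jD^A_j+\beta\sum_{k<j}s_{jk},\qquad \tilde a_j=\tfrac1{\sqrt2}D_j^A,\quad \tilde a_j^\dagger=\tfrac1{\sqrt2}(2x_j-D^A_j),\qquad \tilde b_j=\tfrac1{\sqrt2}D_j^B,\quad \tilde b_j^\dagger=\tfrac1{\sqrt2}(2z_j-D^B_j),$$ $$\tilde h^A_j=\tilde a_j^\dagger\tilde a_j+\beta\sum_{k<j}s_{jk},\qquad \tilde h^B_j=\tilde b_j^\dagger\tilde b_j+\beta\sum_{k<j}(s_{jk}+t_jt_ks_{jk}).$$ Let $\sigma^A(f)=f(\tilde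 a_1^\dagger,\dots,\tilde a_N^\dagger)\cdot1$ and $\sigma^B(f)=f\big((\tilde b_1^\dagger)^2/2,\dots,(\tilde b_N^\dagger)^2/2\big)\cdot 1$ for $f\in\mathbb C[x_1,\dots,x_N]$. For $0\le m\le N$ let $$B^J_m=\sum_{k_1<\dots<k_m}x_{k_1}\cdots x_{k_m}\big(\hat D^A_{k_1}+\beta(2-k_1)\big)\big(\hat D^A_{k_2}+\beta(3-k_2)\big)\cdots\big(\hat D^A_{k_m}+\beta(m-k_m+1)\big)$$ (the Kirillov–Noumi raising operator), let $B^H_m$ be the same expression with $x_j,\hat D^A_j$ replaced by $\tilde a_j^\dagger,\tilde h^A_j$, and let $B^L_m$ be the same expression with $x_j,\hat D^A_j$ replaced by $\tfrac12(\tilde b_j^\dagger)^2,\tfrac12\tilde h^B_j$. For partitions $\lambda=(\lambda_1\ge\dots\ge\lambda_N\ge0)$ and $\mu$ write $\mu<\lambda$ if $\mu\ne\lambda$ and $\mu_1+\dots+\mu_k\le\lambda_1+\dots+\lambda_k$ for all $1\le k\le N$ (the sizes of $\mu$ and $\lambda$ may differ), and let $m_\lambda$ be the monomial symmetric polynomial.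 The multivariable Hermite polynomial $H_\lambda(x)$ is the polynomial such that $H_\lambda-m_\lambda$ lies in the span of the $m_\mu$ with $\mu<\lambda$ and $\int_{\mathbb R^N}H_\lambda\, m_\mu\prod_{j<k}|x_j-x_k|^{2\beta}\prod_je^{-x_j^2}\,dx=0$ for all $\mu<\lambda$. The multivariable Laguerre polynomial $L_\lambda(z)$ is the polynomial such that $L_\lambda-m_\lambda(z_1^2,\dots,z_N^2)$ lies in the span of the $m_\mu(z_1^2,\dots,z_N^2)$ with $\mu<\lambda$ and $\int_{\mathbb R^N}L_\lambda\, m_\mu(z_1^2,\dots,z_N^2)\prod_{j<k}|z_j^2-z_k^2|^{2\beta}\prod_j|z_j|^{2\gamma}e^{-z_j^2}\,dz=0$ for all $\mu<\lambda$. **Proposition (raising operators).** For every partition $\lambda$ with at most $N$ parts the polynomials $H_\lambda$ and $L_\lambda$ exist and are unique. For $0\le m\le N$ the operators $B^H_m$, $B^L_m$ are the transports of $B^J_m$: $\sigma^A B^J_m=B^H_m\sigma^A$ and $\sigma^BB^J_m=B^L_m\sigma^B$ on $\mathbb C[x_1,\dots,x_N]$. If $\lambda$ has at most $m$ non-zero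 parts, then, with $\lambda+(1^m)=(\lambda_1+1,\dots,\lambda_m+1,\lambda_{m+1},\dots,\lambda_N)$, $$B^H_mH_\lambda=2^{m/2}\prod_{j=1}^m\big(\lambda_j+\beta(m-j+1)\big)H_{\lambda+(1^m)},\qquad B^L_mL_\lambda=\prod_{j=1}^m\big(\lambda_j+\beta(m-j+1)\big)L_{\lambda+(1^m)}.$$ Consequently, if $\beta\ge1$, then for every partition $\lambda$ with at most $N$ parts, with conjugate partition $\lambda'$ and $|\lambda|=\sum_i\lambda_i$, $$H_\lambda=2^{-|\lambda|/2}\prod_{(i,j)\in\lambda}\big(\lambda_i-j+\beta(\lambda'_j-i+1)\big)^{-1}(B^H_N)^{\lambda_N}(B^H_{N-1})^{\lambda_{N-1}-\lambda_N}\cdots(B^H_1)^{\lambda_1-\lambda_2}\cdot1,$$ $$L_\lambda=\prod_{(i,j)\in\lambda}\big(\lambda_i-j+\beta(\lambda'_j-i+1)\big)^{-1}(B^L_N)^{\lambda_N}(B^L_{N-1})^{\lambda_{N-1}-\lambda_N}\cdots(B^L_1)^{\lambda_1-\lambda_2}\cdot1.$$ -/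

import Mathlib

open scoped BigOperators

noncomputable section

namespace CalogeroPoly

open MvPolynomial

/-- The polynomial ring `ℂ[x₁, …, x_N]` (variables indexed by `Fin N`, so `x_j` is `X (j - 1)`). -/
abbrev Poly (N : ℕ) : Type := MvPolynomial (Fin N) ℂ

/-- Linear operators on `ℂ[x₁, …, x_N]`; the product is composition. -/
abbrev Op (N : ℕ) : Type := Module.End ℂ (Poly N)

/-! ### Divided differences -/

/-- If `r` is an algebra endomorphism of the polynomial ring with `l ∣ x_i - r x_i` for all `i`,
then `l ∣ f - r f` for all polynomials `f`. -/
theorem dvd_sub_of_gen {N : ℕ} (l : Poly N) (r : Poly N →ₐ[ℂ] Poly N)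
    (h : ∀ i, l ∣ X i - r (X i)) (f : Poly N) : l ∣ f - r f := by
  induction f using MvPolynomial.induction_on with
  | C a =>
    have : r (C a) = C a := r.commutes a
    simp [this]
  | add p q hp hq =>
    have : p + q - r (p + q) = (p - r p) + (q - r q) := by rw [map_add]; ring
    rw [this]
    exact dvd_add hp hq
  | mul_X p i hp =>
    have : p * X i - r (p * X i) = (p - r p) * X i + r p * (X i - r (X i)) := by
      rw [map_mul]; ring
    rw [this]
    exact dvd_add (hp.mul_right _) ((h i).mul_left _)

open scoped Classical in
/-- The operator `l⁻¹ (1 - r)` on polynomials: the value at `f` is the unique polynomial `q` with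
`l * q = f - r f` (see `mul_divDiff`).  The convention is `0` for `l = 0`, which is never used. -/
def divDiff {N : ℕ} (l : Poly N) (r : Poly N →ₐ[ℂ] Poly N)
    (h : ∀ f, l ∣ f - r f) : Op N where
  toFun f := if l = 0 then 0 else (h f).choose
  map_add' f g := by
    by_cases hl : l = 0
    · simp [hl]
    · simp only [hl, if_false]
      apply mul_left_cancel₀ hl
      rw [mul_add, ← (h (f + g)).choose_spec, ← (h f).choose_spec, ← (h g).choose_spec, map_add]
      ring
  map_smul' c f := by
    by_cases hl : l = 0
    · simp [hl]
    · simp only [hl, if_false, RingHom.id_apply]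
      apply mul_left_cancel₀ hl
      rw [mul_smul_comm, ← (h (c • f)).choose_spec, ← (h f).choose_spec, map_smul, smul_sub]

/-- The characterization of the divided difference. -/
theorem mul_divDiff {N : ℕ} (l : Poly N) (r : Poly N →ₐ[ℂ] Poly N)
    (h : ∀ f, l ∣ f - r f) (hl : l ≠ 0) (f : Poly N) : l * divDiff l r h f = f - r f := by
  simp only [divDiff, LinearMap.coe_mk, AddHom.coe_mk, hl, if_false]
  exact (h f).choose_spec.symm

/-! ### Reflections -/

/-- `s_{jk}`: exchange of the variables `x_j` and `x_k`. -/
def sRefl {N : ℕ} (j k : Fin N) : Poly N →ₐ[ℂ] Poly N := rename (Equiv.swap j k)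

/-- `t_j`: replaces `z_j` by `-z_j`. -/
def tRefl {N : ℕ} (j : Fin N) : Poly N →ₐ[ℂ] Poly N :=
  aeval fun i => if i = j then -X i else X i

/-- `t_j t_k s_{jk}`: for `j ≠ k`, exchanges `z_j` and `-z_k`. -/
def ttsRefl {N : ℕ} (j k : Fin N) : Poly N →ₐ[ℂ] Poly N :=
  ((tRefl j).comp (tRefl k)).comp (sRefl j k)

theorem sRefl_dvd {N : ℕ} (j k : Fin N) (f : Poly N) : X j - X k ∣ f - sRefl j k f := by
  refine dvd_sub_of_gen _ _ (fun i => ?_) f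
  simp only [sRefl, rename_X]
  by_cases hj : i = j
  · subst hj; simp
  · by_cases hk : i = k
    · subst hk
      rw [Equiv.swap_apply_right]
      exact ⟨-1, by ring⟩
    · rw [Equiv.swap_apply_of_ne_of_ne hj hk]; simp

theorem tRefl_dvd {N : ℕ} (j : Fin N) (f : Poly N) : X j ∣ f - tRefl j f := by
  refine dvd_sub_of_gen _ _ (fun i => ?_) f
  simp only [tRefl, aeval_X]
  by_cases hj : i = j
  · subst hj
    exact ⟨2, by simp; ring⟩
  · simp [hj]

theorem ttsRefl_dvd {N : ℕ} (j k : Fin N) (hjk : k ≠ j) (f : Poly N) :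
    X j + X k ∣ f - ttsRefl j k f := by
  refine dvd_sub_of_gen _ _ (fun i => ?_) f
  simp only [ttsRefl, sRefl, AlgHom.comp_apply, rename_X]
  by_cases hj : i = j
  · subst hj
    simp [tRefl, hjk]
  · by_cases hk : i = k
    · subst hk
      rw [Equiv.swap_apply_right]
      simp [tRefl, Ne.symm hjk, add_comm]
    · rw [Equiv.swap_apply_of_ne_of_ne hj hk]
      simp [tRefl, hj, hk]

/-! ### Dunkl operators and the operators attached to them -/

/-- Multiplication by the variable `x_j`. -/
def mulX {N : ℕ} (j : Fin N) : Op N := LinearMap.mulLeft ℂ (X j)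

/-- The partial derivative `∂/∂x_j`. -/
def ddx {N : ℕ} (j : Fin N) : Op N := (pderiv j : Derivation ℂ (Poly N) (Poly N)).toLinearMap

/-- Dunkl operator of type `A_{N-1}`:
`D^A_j = ∂_j + β ∑_{k ≠ j} (1 - s_{jk}) / (x_j - x_k)`. -/
def dunklA {N : ℕ} (β : ℕ) (j : Fin N) : Op N :=
  ddx j + (β : ℂ) • ∑ k ∈ Finset.univ.filter (fun k => k ≠ j),
    divDiff (X j - X k) (sRefl j k) (sRefl_dvd j k)

/-- Cherednik operator `D̂^A_j = x_j D^A_j + β ∑_{k < j} s_{jk}`. -/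
def cherednikA {N : ℕ} (β : ℕ) (j : Fin N) : Op N :=
  mulX j * dunklA β j + (β : ℂ) • ∑ k ∈ Finset.univ.filter (fun k => k < j),
    (sRefl j k).toLinearMap

/-- Dunkl operator of type `B_N`:
`D^B_j = ∂_j + β ∑_{k ≠ j} ((1 - s_{jk}) / (z_j - z_k) + (1 - t_j t_k s_{jk}) / (z_j + z_k))
  + γ (1 - t_j) / z_j`. -/
def dunklB {N : ℕ} (β : ℕ) (γ : ℝ) (j : Fin N) : Op N :=
  ddx j
    + (β : ℂ) • (∑ k : {k : Fin N // k ≠ j},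
        (divDiff (X j - X k.1) (sRefl j k.1) (sRefl_dvd j k.1)
          + divDiff (X j + X k.1) (ttsRefl j k.1) (ttsRefl_dvd j k.1 k.2)))
    + (γ : ℂ) • divDiff (X j) (tRefl j) (tRefl_dvd j)

/-- The complex number `√2`. -/
def sqrtTwo : ℂ := ((√2 : ℝ) : ℂ)

/-- Gauge-transformed annihilation operator of type `A`: `ã_j = D^A_j / √2`. -/
def annA {N : ℕ} (β : ℕ) (j : Fin N) : Op N := sqrtTwo⁻¹ • dunklA β j

/-- Gauge-transformed creation operator of type `A`: `ã†_j = (2 x_j - D^A_j) / √2`. -/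
def creA {N : ℕ} (β : ℕ) (j : Fin N) : Op N :=
  sqrtTwo⁻¹ • ((2 : ℂ) • mulX j - dunklA β j)

/-- `h̃^A_j = ã†_j ã_j + β ∑_{k < j} s_{jk}`. -/
def hA {N : ℕ} (β : ℕ) (j : Fin N) : Op N :=
  creA β j * annA β j + (β : ℂ) • ∑ k ∈ Finset.univ.filter (fun k => k < j),
    (sRefl j k).toLinearMap

/-- Gauge-transformed annihilation operator of type `B`: `b̃_j = D^B_j / √2`. -/
def annB {N : ℕ} (β : ℕ) (γ : ℝ) (j : Fin N) : Op N := sqrtTwo⁻¹ • dunklB β γ j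

/-- Gauge-transformed creation operator of type `B`: `b̃†_j = (2 z_j - D^B_j) / √2`. -/
def creB {N : ℕ} (β : ℕ) (γ : ℝ) (j : Fin N) : Op N :=
  sqrtTwo⁻¹ • ((2 : ℂ) • mulX j - dunklB β γ j)

/-- `h̃^B_j = b̃†_j b̃_j + β ∑_{k < j} (s_{jk} + t_j t_k s_{jk})`. -/
def hB {N : ℕ} (β : ℕ) (γ : ℝ) (j : Fin N) : Op N :=
  creB β γ j * annB β γ j + (β : ℂ) • ∑ k ∈ Finset.univ.filter (fun k => k < j),
    ((sRefl j k).toLinearMap + (ttsRefl j k).toLinearMap)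

/-! ### The maps `σ^A`, `σ^B` -/

/-- For operators `a_1, …, a_N`, the linear map `f(x_1, …, x_N) ↦ f(a_1, …, a_N) · 1`,
which sends the monomial `x_1^{n_1} ⋯ x_N^{n_N}` to `a_1^{n_1} ⋯ a_N^{n_N} · 1`. -/
def substOne {N : ℕ} (a : Fin N → Op N) : Op N :=
  (basisMonomials (Fin N) ℂ).constr ℂ
    fun n : Fin N →₀ ℕ => (List.ofFn fun j => a j ^ n j).prod 1

/-- `σ^A(f) = f(ã†_1, …, ã†_N) · 1`. -/
def sigmaA (N β : ℕ) : Op N := substOne fun j => creA β j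

/-- `σ^B(f) = f((b̃†_1)²/2, …, (b̃†_N)²/2) · 1`. -/
def sigmaB (N β : ℕ) (γ : ℝ) : Op N := substOne fun j => (2 : ℂ)⁻¹ • creB β γ j ^ 2

/-! ### Raising operators -/

open scoped Classical in
/-- The Kirillov–Noumi expression
`∑_{k_1 < ⋯ < k_m} x_{k_1} ⋯ x_{k_m} (D_{k_1} + β (2 - k_1)) ⋯ (D_{k_m} + β (m - k_m + 1))`
in given operators `x_1, …, x_N`, `D_1, …, D_N`.  With indices counted from zero the number
`β (i + 1 - k_i)` keeps its form, since both `i` and `k_i` are shifted by one. -/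
def raising {N : ℕ} (β : ℕ) (m : ℕ) (x D : Fin N → Op N) : Op N :=
  ∑ k : Fin m → Fin N with StrictMono k,
    (List.ofFn fun i => x (k i)).prod *
      (List.ofFn fun i : Fin m =>
        D (k i) + ((β : ℂ) * (((i : ℕ) : ℂ) + 1 - ((k i : ℕ) : ℂ))) • (1 : Op N)).prod

/-- `B^J_m`, built from `x_j` and `D̂^A_j`. -/
def raisingJ (N β m : ℕ) : Op N := raising β m (fun j => mulX j) (fun j => cherednikA β j)

/-- `B^H_m`, with `x_j` replaced by `ã†_j` and `D̂^A_j` by `h̃^A_j`. -/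
def raisingH (N β m : ℕ) : Op N := raising β m (fun j => creA β j) (fun j => hA β j)

/-- `B^L_m`, with `x_j` replaced by `(b̃†_j)²/2` and `D̂^A_j` by `h̃^B_j/2`. -/
def raisingL (N β : ℕ) (γ : ℝ) (m : ℕ) : Op N :=
  raising β m (fun j => (2 : ℂ)⁻¹ • creB β γ j ^ 2) (fun j => (2 : ℂ)⁻¹ • hB β γ j)

/-! ### Partitions and monomial symmetric polynomials -/

/-- Strict dominance ordering for partitions with at most `N` parts, comparing all partial sums
(the sizes of the two partitions may differ). -/
def DomLT {N : ℕ} (μ lam : Fin N → ℕ) : Prop :=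
  (∀ k : Fin N, ∑ i ∈ Finset.Iic k, μ i ≤ ∑ i ∈ Finset.Iic k, lam i) ∧ μ ≠ lam

/-- The monomial symmetric polynomial `m_μ`: the sum of all distinct monomials obtained from
`x^μ` by permuting the exponents. -/
def mSym {N : ℕ} (μ : Fin N → ℕ) : Poly N :=
  ∑ a ∈ Finset.univ.image (fun w : Equiv.Perm (Fin N) => μ ∘ w), ∏ i, X i ^ a i

/-- `m_μ(z²) = m_μ(z_1², …, z_N²)`. -/
def mSymSq {N : ℕ} (μ : Fin N → ℕ) : Poly N := expand 2 (mSym μ)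

/-- The partition `λ + (1^m)`. -/
def addOnes {N : ℕ} (m : ℕ) (lam : Fin N → ℕ) : Fin N → ℕ :=
  fun i => lam i + if (i : ℕ) < m then 1 else 0

/-- `λ_j` for a natural number index `j` counted from `1`, with `λ_j = 0` for `j > N`. -/
def part {N : ℕ} (lam : Fin N → ℕ) (j : ℕ) : ℕ :=
  if h : j - 1 < N then lam ⟨j - 1, h⟩ else 0

/-- `λ'_j`, the length of the `j`-th column, `j` counted from `1`. -/
def conjPart {N : ℕ} (lam : Fin N → ℕ) (j : ℕ) : ℕ :=
  (Finset.univ.filter fun i : Fin N => j ≤ lam i).card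

/-! ### Scalar products -/

/-- The ground state `φ_A = ∏_{j<k} |x_j - x_k|^β ∏_j exp(-x_j²/2)`. -/
def phiA {N : ℕ} (β : ℕ) (x : Fin N → ℝ) : ℝ :=
  (∏ j, ∏ k ∈ Finset.Ioi j, |x j - x k| ^ β) * ∏ j, Real.exp (-(x j) ^ 2 / 2)

/-- The ground state `φ_B = ∏_{j<k} |z_j² - z_k²|^β ∏_j |z_j|^γ exp(-z_j²/2)`. -/
def phiB {N : ℕ} (β : ℕ) (γ : ℝ) (z : Fin N → ℝ) : ℝ :=
  (∏ j, ∏ k ∈ Finset.Ioi j, |z j ^ 2 - z k ^ 2| ^ β) *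
    ∏ j, (|z j| ^ γ * Real.exp (-(z j) ^ 2 / 2))

/-- The value of a polynomial at a real point. -/
def evalReal {N : ℕ} (x : Fin N → ℝ) (f : Poly N) : ℂ := eval (fun i => (x i : ℂ)) f

/-- `⟨f, g⟩_H = ∫ f g φ_A² dx`. -/
def innerH {N : ℕ} (β : ℕ) (f g : Poly N) : ℂ :=
  ∫ x : Fin N → ℝ, evalReal x f * evalReal x g * ((phiA β x ^ 2 : ℝ) : ℂ)

/-- `⟨f, g⟩_L = ∫ f g φ_B² dz`. -/
def innerL {N : ℕ} (β : ℕ) (γ : ℝ) (f g : Poly N) : ℂ :=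
  ∫ z : Fin N → ℝ, evalReal z f * evalReal z g * ((phiB β γ z ^ 2 : ℝ) : ℂ)

/-! ### Multivariable Hermite and Laguerre polynomials -/

/-- The defining properties of the multivariable Hermite polynomial `H_λ`: it is `m_λ` plus a
combination of `m_μ` with `μ < λ`, and is orthogonal to all `m_μ` with `μ < λ`. -/
def IsHermite {N : ℕ} (β : ℕ) (lam : Fin N → ℕ) (p : Poly N) : Prop :=
  p - mSym lam ∈
      Submodule.span ℂ {q | ∃ μ : Fin N → ℕ, Antitone μ ∧ DomLT μ lam ∧ q = mSym μ} ∧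
    ∀ μ : Fin N → ℕ, Antitone μ → DomLT μ lam → innerH β p (mSym μ) = 0

/-- The defining properties of the multivariable Laguerre polynomial `L_λ`. -/
def IsLaguerre {N : ℕ} (β : ℕ) (γ : ℝ) (lam : Fin N → ℕ) (p : Poly N) : Prop :=
  p - mSymSq lam ∈
      Submodule.span ℂ {q | ∃ μ : Fin N → ℕ, Antitone μ ∧ DomLT μ lam ∧ q = mSymSq μ} ∧
    ∀ μ : Fin N → ℕ, Antitone μ → DomLT μ lam → innerL β γ p (mSymSq μ) = 0

/-- The multivariable Hermite polynomial `H_λ`: the polynomial with the properties `IsHermite`. -/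
def hermite {N : ℕ} (β : ℕ) (lam : Fin N → ℕ) : Poly N := Classical.epsilon (IsHermite β lam)

/-- The multivariable Laguerre polynomial `L_λ`: the polynomial with the properties
`IsLaguerre`. -/
def laguerre {N : ℕ} (β : ℕ) (γ : ℝ) (lam : Fin N → ℕ) : Poly N :=
  Classical.epsilon (IsLaguerre β γ lam)

/-! ### Ingredients of the formulas -/

/-- `∏_{j=1}^m (λ_j + β (m - j + 1))`. -/
def raisingCoeff {N : ℕ} (β m : ℕ) (lam : Fin N → ℕ) : ℂ :=
  ∏ j ∈ Finset.Icc 1 m, ((part lam j : ℂ) + (β : ℂ) * ((m : ℂ) - (j : ℂ) + 1))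

/-- `∏_{(i,j) ∈ λ} (λ_i - j + β (λ'_j - i + 1))⁻¹`. -/
def hookProdInv {N : ℕ} (β : ℕ) (lam : Fin N → ℕ) : ℂ :=
  ∏ i ∈ Finset.Icc 1 N, ∏ j ∈ Finset.Icc 1 (part lam i),
    ((part lam i : ℂ) - (j : ℂ) + (β : ℂ) * ((conjPart lam j : ℂ) - (i : ℂ) + 1))⁻¹

/-- `B_N^{λ_N} B_{N-1}^{λ_{N-1} - λ_N} ⋯ B_1^{λ_1 - λ_2}` (recall `λ_{N+1} = 0`). -/
def iterated {N : ℕ} (B : ℕ → Op N) (lam : Fin N → ℕ) : Op N :=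
  (((List.range N).map fun i =>
    B (i + 1) ^ (part lam (i + 1) - part lam (i + 2))).reverse).prod

end CalogeroPoly

end

/-! Everything rests on one operator, `casimir`, the sum of the squares of the Cherednik operators.
It commutes with the permutations and with every x_j D_j, so it can be computed with the indices
ordered in any way (`casimir_eq_of_key`). It is triangular on monomials, and its diagonal entries
strictly below λ are strictly smaller than the entry attached to λ (`casimir_diag_lt`), even for β =
0 and for different sizes. So `casimir` minus this number is bijective on the symmetric polynomials
strictly below λ. This yields the Jack polynomial of λ, and every symmetric eigenvector dominated by
λ with the same eigenvalue is a multiple of it (`exists_isJack`, `IsJack.eq_smul`).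

On a symmetric f the Kirillov–Noumi operator is the sum over m-element sets J of X_J g_J, where X_J
is the product of the variables in J and g_J arises from f by a product of shifted operators x_j
D_j, j ∈ J. If f is the Jack polynomial of a λ with at most m parts, the analogous product over m +
1 indices vanishes (`dunklProd_succ_eq_zero`), so D_j g_J = 0 for j outside J. Computing the Casimir
of X_J g_J with J ordered first, and that of g_J with J ordered last, shows that X_J g_J is an
eigenvector with the eigenvalue of λ + (1^m) (`casimir_prodX_mul`). A single coefficient then
determines the factor (`coeff_raisingJ`).

Transport is algebra: `substOne` intertwines x_j and x_j D_j with any operators Y_j, T_j obeying the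
same commutation relations (`DunklLike`). In type A these are ã†_j and ã†_j ã_j. In type B one
restricts to polynomials in the squares z_j², where (b̃†_j)²/2 and b̃†_j b̃_j/2 become operators
built from type A Dunkl operators (`dunklLike_L`).

Both pairs deform α x_j, x_j D_j by terms of lower order (`Deformed`), so `substOne` is triangular
and bijective on the symmetric polynomials strictly below λ. The scalar products make T_j and the
transpositions, hence the transported Casimir C', symmetric (`GoodForm`). Every polynomial strictly
below λ has the form (C' - E) q with q also below λ and E the eigenvalue of λ, so the image of the
Jack polynomial is orthogonal to all of them: after rescaling it is the Hermite or Laguerre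
polynomial (`Deformed.isOrth`). The raising formulas follow by applying `substOne`, and the
Rodrigues formulas by removing the columns of λ one at a time. -/

noncomputable section

namespace CalogeroPoly

open MvPolynomial

/-! ### The type `A` Dunkl operators -/

section DunklAlgebra

variable {N : ℕ}

/-- The action of a permutation of the variables. -/
def permOp (w : Equiv.Perm (Fin N)) : Op N := (rename w).toLinearMap

/-- The divided difference `(1 - s_{jk}) / (x_j - x_k)`. -/
def divA (j k : Fin N) : Op N := divDiff (X j - X k) (sRefl j k) (sRefl_dvd j k)

theorem X_sub_X_ne_zero {j k : Fin N} (h : j ≠ k) : (X j - X k : Poly N) ≠ 0 :=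
  sub_ne_zero.2 fun e => h (X_injective e)

theorem mul_divA {j k : Fin N} (h : j ≠ k) (f : Poly N) :
    (X j - X k) * divA j k f = f - permOp (Equiv.swap j k) f :=
  mul_divDiff _ _ _ (X_sub_X_ne_zero h) f

theorem divA_eq_of_mul_eq {j k : Fin N} (h : j ≠ k) {f q : Poly N}
    (e : (X j - X k) * q = f - permOp (Equiv.swap j k) f) : divA j k f = q :=
  mul_left_cancel₀ (X_sub_X_ne_zero h) (by rw [mul_divA h, e])

theorem permOp_apply (w : Equiv.Perm (Fin N)) (f : Poly N) : permOp w f = rename w f := rfl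

theorem permOp_mul_apply (w : Equiv.Perm (Fin N)) (f g : Poly N) :
    permOp w (f * g) = permOp w f * permOp w g := map_mul (rename w) f g

@[simp] theorem permOp_X (w : Equiv.Perm (Fin N)) (i : Fin N) : permOp w (X i) = X (w i) :=
  rename_X _ _

@[simp] theorem permOp_one_apply (w : Equiv.Perm (Fin N)) : permOp w (1 : Poly N) = 1 :=
  map_one (rename w)

theorem permOp_permOp (w v : Equiv.Perm (Fin N)) (f : Poly N) :
    permOp w (permOp v f) = permOp (w * v) f := by
  simp [permOp_apply, rename_rename]

theorem permOp_one (f : Poly N) : permOp 1 f = f := by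
  simp [permOp_apply]

theorem permOp_inv_apply (w : Equiv.Perm (Fin N)) (f : Poly N) :
    permOp w⁻¹ (permOp w f) = f := by
  rw [permOp_permOp, inv_mul_cancel, permOp_one]

theorem permOp_swap_swap (i j : Fin N) (f : Poly N) :
    permOp (Equiv.swap i j) (permOp (Equiv.swap i j) f) = f := by
  rw [permOp_permOp, Equiv.swap_mul_self, permOp_one]

theorem permOp_divA (w : Equiv.Perm (Fin N)) {j k : Fin N} (h : j ≠ k) (f : Poly N) :
    permOp w (divA j k f) = divA (w j) (w k) (permOp w f) := by
  symm
  apply divA_eq_of_mul_eq (by simpa using h)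
  have := congrArg (permOp w) (mul_divA h f)
  rw [permOp_mul_apply, map_sub, map_sub, permOp_X, permOp_X] at this
  rw [this, permOp_permOp, permOp_permOp, Equiv.swap_apply_apply]
  simp

/-- The twisted Leibniz rule of a divided difference, from pf - s(p)s(f) = p(f - s(f)) + (p -
s(p))s(f). -/
theorem divA_mul {j k : Fin N} (h : j ≠ k) (p f : Poly N) :
    divA j k (p * f) = p * divA j k f + divA j k p * permOp (Equiv.swap j k) f := by
  apply divA_eq_of_mul_eq h
  rw [permOp_mul_apply]
  linear_combination p * mul_divA h f + permOp (Equiv.swap j k) f * mul_divA h p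

theorem divA_of_swap_eq {j k : Fin N} (h : j ≠ k) {p : Poly N}
    (e : permOp (Equiv.swap j k) p = p) : divA j k p = 0 :=
  divA_eq_of_mul_eq h (by rw [e]; ring)

theorem dunklA_apply (β : ℕ) (j : Fin N) (f : Poly N) :
    dunklA β j f = pderiv j f + (β : ℂ) • ∑ k with k ≠ j, divA j k f := by
  simp [dunklA, ddx, divA]

theorem permOp_pderiv (w : Equiv.Perm (Fin N)) (j : Fin N) (f : Poly N) :
    permOp w (pderiv j f) = pderiv (w j) (permOp w f) := by
  simp only [permOp_apply]
  exact (pderiv_rename w.injective j f).symm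

theorem sum_ne_comp_perm {M : Type*} [AddCommMonoid M] (w : Equiv.Perm (Fin N)) (j : Fin N)
    (F : Fin N → M) : ∑ k with k ≠ w j, F k = ∑ k with k ≠ j, F (w k) := by
  rw [Finset.sum_filter, Finset.sum_filter, ← Equiv.sum_comp w]
  simp

theorem permOp_dunklA (β : ℕ) (w : Equiv.Perm (Fin N)) (j : Fin N) (f : Poly N) :
    permOp w (dunklA β j f) = dunklA β (w j) (permOp w f) := by
  rw [dunklA_apply, dunklA_apply, map_add, permOp_pderiv, map_smul, map_sum, sum_ne_comp_perm]
  congr 2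
  refine Finset.sum_congr rfl fun k hk => ?_
  exact permOp_divA w (Ne.symm (Finset.mem_filter.1 hk).2) f

theorem dunklA_mul (β : ℕ) (j : Fin N) (p f : Poly N) :
    dunklA β j (p * f) = p * dunklA β j f + pderiv j p * f
      + (β : ℂ) • ∑ k with k ≠ j, divA j k p * permOp (Equiv.swap j k) f := by
  have : ∑ k with k ≠ j, divA j k (p * f) = p * (∑ k with k ≠ j, divA j k f)
      + ∑ k with k ≠ j, divA j k p * permOp (Equiv.swap j k) f := by
    rw [Finset.mul_sum, ← Finset.sum_add_distrib]
    exact Finset.sum_congr rfl fun k hk => divA_mul (Ne.symm (Finset.mem_filter.1 hk).2) p f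
  rw [dunklA_apply, dunklA_apply, this, Derivation.leibniz]
  simp only [smul_eq_mul, smul_add, mul_add, mul_smul_comm]
  ring

theorem divA_X_left {j k : Fin N} (h : j ≠ k) : divA j k (X j : Poly N) = 1 :=
  divA_eq_of_mul_eq h (by simp)

theorem divA_X_right {j k : Fin N} (h : j ≠ k) : divA j k (X k : Poly N) = -1 :=
  divA_eq_of_mul_eq h (by simp)

theorem divA_X_of_ne {i j k : Fin N} (h : j ≠ k) (hj : i ≠ j) (hk : i ≠ k) :
    divA j k (X i : Poly N) = 0 :=
  divA_of_swap_eq h (by simp [Equiv.swap_apply_of_ne_of_ne hj hk])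

theorem dunklA_X_mul_of_ne (β : ℕ) {j k : Fin N} (h : k ≠ j) (f : Poly N) :
    dunklA β j (X k * f) = X k * dunklA β j f - (β : ℂ) • permOp (Equiv.swap j k) f := by
  rw [dunklA_mul, pderiv_X_of_ne h, Finset.sum_eq_single k]
  · rw [divA_X_right h.symm]; simp [sub_eq_add_neg]
  · intro b hb hbk
    rw [divA_X_of_ne (Ne.symm (Finset.mem_filter.1 hb).2) h (Ne.symm hbk), zero_mul]
  · simp [h]

theorem dunklA_X_mul_self (β : ℕ) (j : Fin N) (f : Poly N) :
    dunklA β j (X j * f) = X j * dunklA β j f + f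
      + (β : ℂ) • ∑ k with k ≠ j, permOp (Equiv.swap j k) f := by
  rw [dunklA_mul, pderiv_X_self, one_mul]
  congr 2
  refine Finset.sum_congr rfl fun k hk => ?_
  rw [divA_X_left (Ne.symm (Finset.mem_filter.1 hk).2), one_mul]

theorem dunklA_one (β : ℕ) (j : Fin N) : dunklA β j (1 : Poly N) = 0 := by
  rw [dunklA_apply, Finset.sum_eq_zero]
  · simp
  · intro k hk
    exact divA_of_swap_eq (Ne.symm (Finset.mem_filter.1 hk).2) (permOp_one_apply _)

/-- A linear operator that commutes with the multiplications by the variables and kills `1`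
vanishes. -/
theorem eq_zero_of_X_mul (T : Op N) (h1 : T 1 = 0) (hX : ∀ k f, T (X k * f) = X k * T f)
    (f : Poly N) : T f = 0 := by
  induction f using MvPolynomial.induction_on with
  | C a => rw [← mul_one (C a), ← smul_eq_C_mul, map_smul, h1, smul_zero]
  | add p q hp hq => rw [map_add, hp, hq, add_zero]
  | mul_X p i hp => rw [mul_comm, hX, hp, mul_zero]

/-- The commutator of two Dunkl operators kills 1, so it is enough that it commutes with
multiplication by each variable. -/
theorem dunklA_comm (β : ℕ) (i j : Fin N) (f : Poly N) :
    dunklA β i (dunklA β j f) = dunklA β j (dunklA β i f) := by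
  rcases eq_or_ne i j with rfl | hij
  · rfl
  -- Assuming only k ≠ i loses nothing: the remaining case k = i follows by exchanging the roles of
  -- i and j.
  have key : ∀ i j k : Fin N, i ≠ j → k ≠ i → ∀ f : Poly N,
      dunklA β i (dunklA β j (X k * f)) - dunklA β j (dunklA β i (X k * f)) =
        X k * (dunklA β i (dunklA β j f) - dunklA β j (dunklA β i f)) := by
    intro i j k hij hki f
    rcases eq_or_ne k j with rfl | hkj
    · have e1 : ∀ g : Poly N, dunklA β i (∑ l with l ≠ k, permOp (Equiv.swap k l) g)
          = permOp (Equiv.swap k i) (dunklA β k g) +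
            ∑ l ∈ ({l | l ≠ k} : Finset (Fin N)).erase i,
              permOp (Equiv.swap k l) (dunklA β i g) := by
        intro g
        rw [map_sum, ← Finset.add_sum_erase _ _ (show i ∈ ({l | l ≠ k} : Finset (Fin N)) by
          simp [hij])]
        congr 1
        · rw [permOp_dunklA]; simp
        · refine Finset.sum_congr rfl fun l hl => ?_
          simp only [Finset.mem_erase, Finset.mem_filter] at hl
          rw [permOp_dunklA, Equiv.swap_apply_of_ne_of_ne hij (Ne.symm hl.1)]
      have e2 : ∀ g : Poly N, ∑ l with l ≠ k, permOp (Equiv.swap k l) g =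
          permOp (Equiv.swap k i) g + ∑ l ∈ ({l | l ≠ k} : Finset (Fin N)).erase i,
              permOp (Equiv.swap k l) g := fun g =>
        (Finset.add_sum_erase _ _ (show i ∈ ({l | l ≠ k} : Finset (Fin N)) by simp [hij])).symm
      have e3 : dunklA β k (permOp (Equiv.swap i k) f)
          = permOp (Equiv.swap k i) (dunklA β i f) := by
        rw [permOp_dunklA, Equiv.swap_comm]; simp
      rw [dunklA_X_mul_self, dunklA_X_mul_of_ne β hki, map_add, map_add, map_smul, map_sub,
        map_smul, dunklA_X_mul_self, dunklA_X_mul_of_ne β hki, e1, e2 (dunklA β i f), e3,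
        Equiv.swap_comm i k]
      simp only [smul_add, mul_sub]
      abel
    · rw [dunklA_X_mul_of_ne β hki, dunklA_X_mul_of_ne β hkj, map_sub, map_sub, map_smul, map_smul,
        dunklA_X_mul_of_ne β hki, dunklA_X_mul_of_ne β hkj, permOp_dunklA, permOp_dunklA,
        Equiv.swap_apply_of_ne_of_ne hij (Ne.symm hki),
        Equiv.swap_apply_of_ne_of_ne (Ne.symm hij) (Ne.symm hkj), mul_sub]
      abel
  have := eq_zero_of_X_mul (dunklA β i * dunklA β j - dunklA β j * dunklA β i)
    (by simp [dunklA_one]) (fun k f => by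
      simp only [LinearMap.sub_apply, Module.End.mul_apply]
      rcases eq_or_ne k i with rfl | hki
      · have := key j k k hij.symm hij f
        rw [← neg_sub, this, ← mul_neg, neg_sub]
      · exact key i j k hij hki f) f
  simpa [sub_eq_zero] using this

end DunklAlgebra

/-! ### Cherednik operators -/

section Cherednik

variable {N : ℕ}

/-- The operator `x_j D^A_j`. -/
def xD (β : ℕ) (j : Fin N) : Op N := mulX j * dunklA β j

theorem xD_apply (β : ℕ) (j : Fin N) (f : Poly N) : xD β j f = X j * dunklA β j f := rfl

theorem permOp_xD (β : ℕ) (w : Equiv.Perm (Fin N)) (j : Fin N) (f : Poly N) :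
    permOp w (xD β j f) = xD β (w j) (permOp w f) := by
  rw [xD_apply, permOp_mul_apply, permOp_X, permOp_dunklA, xD_apply]

theorem xD_X_mul_of_ne (β : ℕ) {j k : Fin N} (h : k ≠ j) (f : Poly N) :
    xD β j (X k * f) = X k * xD β j f - (β : ℂ) • (X j * permOp (Equiv.swap j k) f) := by
  rw [xD_apply, dunklA_X_mul_of_ne β h, mul_sub, mul_smul_comm, xD_apply]
  ring

theorem xD_X_mul_self (β : ℕ) (j : Fin N) (f : Poly N) :
    xD β j (X j * f) = X j * xD β j f + X j * f
      + (β : ℂ) • ∑ k with k ≠ j, X j * permOp (Equiv.swap j k) f := by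
  rw [xD_apply, dunklA_X_mul_self, mul_add, mul_add, mul_smul_comm, xD_apply, Finset.mul_sum]

theorem xD_xD (β : ℕ) {i j : Fin N} (h : i ≠ j) (f : Poly N) :
    xD β i (xD β j f) = X i * (X j * dunklA β i (dunklA β j f))
      - (β : ℂ) • xD β i (permOp (Equiv.swap i j) f) := by
  rw [xD_apply, xD_apply, dunklA_X_mul_of_ne β h.symm, permOp_dunklA, mul_sub, mul_smul_comm,
    xD_apply, Equiv.swap_apply_right]

/-- The operators x_j D_j do not commute. By `xD_xD` both sides equal x_i x_j D_i D_j f up to the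
commutativity of the Dunkl operators. -/
theorem xD_comm (β : ℕ) {i j : Fin N} (h : i ≠ j) (f : Poly N) :
    xD β i (xD β j f) + (β : ℂ) • xD β i (permOp (Equiv.swap i j) f) =
      xD β j (xD β i f) + (β : ℂ) • xD β j (permOp (Equiv.swap i j) f) := by
  rw [xD_xD β h, xD_xD β h.symm, dunklA_comm β i j, Equiv.swap_comm j i]
  simp only [sub_add_cancel]
  ring

/-- The sum of the transpositions of `j` with the smaller indices, for the ordering of the indices
by `κ`. -/
def jucysMurphy (κ : Fin N → ℕ) (j : Fin N) : Op N :=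
  ∑ k with κ k < κ j, permOp (Equiv.swap j k)

/-- The Cherednik operator for the ordering of the indices by `κ`. -/
def cher (β : ℕ) (κ : Fin N → ℕ) (j : Fin N) : Op N :=
  xD β j + (β : ℂ) • jucysMurphy κ j

theorem cherednikA_eq (β : ℕ) (j : Fin N) :
    cherednikA β j = cher β (fun i : Fin N => (i : ℕ)) j := rfl

theorem jucysMurphy_apply (κ : Fin N → ℕ) (j : Fin N) (f : Poly N) :
    jucysMurphy κ j f = ∑ k with κ k < κ j, permOp (Equiv.swap j k) f := by
  simp [jucysMurphy]

theorem cher_apply (β : ℕ) (κ : Fin N → ℕ) (j : Fin N) (f : Poly N) :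
    cher β κ j f = xD β j f + (β : ℂ) • jucysMurphy κ j f := rfl

theorem permOp_jucysMurphy {κ κ' : Fin N → ℕ} (w : Equiv.Perm (Fin N)) {j : Fin N}
    (h : ∀ k, κ' (w k) < κ' (w j) ↔ κ k < κ j) (f : Poly N) :
    permOp w (jucysMurphy κ j f) = jucysMurphy κ' (w j) (permOp w f) := by
  rw [jucysMurphy_apply, jucysMurphy_apply, map_sum, Finset.sum_filter, Finset.sum_filter,
    ← Equiv.sum_comp w (fun k => if κ' k < κ' (w j) then _ else _)]
  refine Finset.sum_congr rfl fun k _ => ?_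
  simp only [h]
  congr 1
  rw [permOp_permOp, permOp_permOp, Equiv.swap_apply_apply]
  simp

theorem permOp_cher (β : ℕ) {κ κ' : Fin N → ℕ} (w : Equiv.Perm (Fin N)) {j : Fin N}
    (h : ∀ k, κ' (w k) < κ' (w j) ↔ κ k < κ j) (f : Poly N) :
    permOp w (cher β κ j f) = cher β κ' (w j) (permOp w f) := by
  rw [cher_apply, cher_apply, map_add, map_smul, permOp_xD, permOp_jucysMurphy w h]

/-- A transposition of two indices below j preserves the set of indices below j; this makes it
commute with the Jucys–Murphy element of j. -/
theorem swap_lt_iff {κ : Fin N → ℕ} {i k j : Fin N} (hk : κ k < κ j) (hi : κ i < κ j) (l : Fin N) :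
    κ (Equiv.swap i k l) < κ (Equiv.swap i k j) ↔ κ l < κ j := by
  have hji : j ≠ i := by rintro rfl; exact lt_irrefl _ hi
  have hjk : j ≠ k := by rintro rfl; exact lt_irrefl _ hk
  rw [Equiv.swap_apply_of_ne_of_ne hji hjk]
  rcases eq_or_ne l i with rfl | hli
  · rw [Equiv.swap_apply_left]; tauto
  rcases eq_or_ne l k with rfl | hlk
  · rw [Equiv.swap_apply_right]; tauto
  rw [Equiv.swap_apply_of_ne_of_ne hli hlk]

/-- The failure of x_i D_i and x_j D_j to commute is cancelled by the one transposition s_ij that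
occurs in the Jucys–Murphy element of j but not in that of i. -/
theorem cher_comm_of_lt (β : ℕ) {κ : Fin N → ℕ} {i j : Fin N} (hij : κ i < κ j)
    (f : Poly N) : cher β κ i (cher β κ j f) = cher β κ j (cher β κ i f) := by
  have hne : i ≠ j := by rintro rfl; exact lt_irrefl _ hij
  have swap_fix : ∀ k, κ k < κ i → Equiv.swap i k j = j := fun k hk =>
    Equiv.swap_apply_of_ne_of_ne hne.symm (by rintro rfl; omega)
  -- the Jucys-Murphy elements commute
  have h1 : jucysMurphy κ i (jucysMurphy κ j f) = jucysMurphy κ j (jucysMurphy κ i f) := by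
    rw [jucysMurphy_apply κ i, jucysMurphy_apply κ i f, map_sum]
    refine Finset.sum_congr rfl fun k hk => ?_
    have hk : κ k < κ i := (Finset.mem_filter.1 hk).2
    rw [permOp_jucysMurphy (κ' := κ) _ (swap_lt_iff (hk.trans hij) hij), swap_fix k hk]
  have h2 : jucysMurphy κ i (xD β j f) = xD β j (jucysMurphy κ i f) := by
    rw [jucysMurphy_apply κ i, jucysMurphy_apply κ i f, map_sum]
    refine Finset.sum_congr rfl fun k hk => ?_
    rw [permOp_xD, swap_fix k (Finset.mem_filter.1 hk).2]
  have hmem : i ∈ ({k | κ k < κ j} : Finset (Fin N)) := by simp [hij]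
  have h3 : xD β i (jucysMurphy κ j f) + xD β j (permOp (Equiv.swap i j) f) =
      jucysMurphy κ j (xD β i f) + xD β i (permOp (Equiv.swap i j) f) := by
    rw [jucysMurphy_apply κ j, jucysMurphy_apply κ j, map_sum, ← Finset.add_sum_erase _ _ hmem,
      ← Finset.add_sum_erase _ _ hmem, permOp_xD, Equiv.swap_apply_right, Equiv.swap_comm i j]
    have : ∀ k ∈ ({k | κ k < κ j} : Finset (Fin N)).erase i,
        permOp (Equiv.swap j k) (xD β i f) = xD β i (permOp (Equiv.swap j k) f) := fun k hk => by
      rw [permOp_xD, Equiv.swap_apply_of_ne_of_ne hne (Finset.ne_of_mem_erase hk).symm]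
    rw [Finset.sum_congr rfl this]
    abel
  have h4 := xD_comm β hne f
  simp only [cher_apply, map_add, map_smul, smul_add]
  rw [h1, h2]
  linear_combination (norm := module) h4 + (β : ℂ) • h3

theorem cher_comm (β : ℕ) {κ : Fin N → ℕ} (hκ : Function.Injective κ) (i j : Fin N) (f : Poly N) :
    cher β κ i (cher β κ j f) = cher β κ j (cher β κ i f) := by
  rcases lt_trichotomy (κ i) (κ j) with h | h | h
  · exact cher_comm_of_lt β h f
  · rw [hκ h]
  · exact (cher_comm_of_lt β h f).symm

/-- The sum of the squares of the Cherednik operators. -/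
def casimir (β : ℕ) : Op N := ∑ j : Fin N, cher β (fun i : Fin N => (i : ℕ)) j ^ 2

theorem casimir_apply (β : ℕ) (f : Poly N) : casimir β f =
    ∑ j : Fin N, cher β (fun i : Fin N => (i : ℕ)) j (cher β (fun i : Fin N => (i : ℕ)) j f) := by
  simp [casimir, pow_two]

theorem casimir_comm_cherednik (β : ℕ) (j : Fin N) (f : Poly N) :
    casimir β (cher β (fun i : Fin N => (i : ℕ)) j f) =
      cher β (fun i : Fin N => (i : ℕ)) j (casimir β f) := by
  rw [casimir_apply, casimir_apply, map_sum]
  refine Finset.sum_congr rfl fun i _ => ?_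
  rw [cher_comm β Fin.val_injective i j, cher_comm β Fin.val_injective i j]

theorem permOp_swap_cher_of_ne (β : ℕ) {i i' j : Fin N} (h : (i' : ℕ) = i + 1) (hj : j ≠ i)
    (hj' : j ≠ i') (f : Poly N) :
    permOp (Equiv.swap i i') (cher β (fun i : Fin N => (i : ℕ)) j f) =
      cher β (fun i : Fin N => (i : ℕ)) j (permOp (Equiv.swap i i') f) := by
  have hfix : Equiv.swap i i' j = j := Equiv.swap_apply_of_ne_of_ne hj hj'
  have := permOp_cher β (κ := fun i : Fin N => (i : ℕ)) (κ' := fun i : Fin N => (i : ℕ))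
    (Equiv.swap i i') (j := j) (fun k => ?_) f
  · rwa [hfix] at this
  · rw [hfix]
    have e1 : (j : ℕ) ≠ i := fun e => hj (Fin.ext e)
    have e2 : (j : ℕ) ≠ i' := fun e => hj' (Fin.ext e)
    rcases eq_or_ne k i with rfl | hki
    · rw [Equiv.swap_apply_left]; omega
    rcases eq_or_ne k i' with rfl | hki'
    · rw [Equiv.swap_apply_right]; omega
    rw [Equiv.swap_apply_of_ne_of_ne hki hki']

/-- The relation of the degenerate affine Hecke algebra for adjacent indices: conjugation by s
exchanges the two Jucys–Murphy sums except for s itself, and s² = 1 leaves the term β. -/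
theorem permOp_swap_cher_left (β : ℕ) {i i' : Fin N} (h : (i' : ℕ) = i + 1) (f : Poly N) :
    permOp (Equiv.swap i i') (cher β (fun i : Fin N => (i : ℕ)) i f) + (β : ℂ) • f =
      cher β (fun i : Fin N => (i : ℕ)) i' (permOp (Equiv.swap i i') f) := by
  have hne : i ≠ i' := by rintro rfl; omega
  rw [cher_apply, cher_apply, map_add, map_smul, permOp_xD, Equiv.swap_apply_left,
    jucysMurphy_apply, jucysMurphy_apply, map_sum]
  have hset : ({k | (k : ℕ) < i'} : Finset (Fin N)) =
      insert i ({k | (k : ℕ) < i} : Finset (Fin N)) := by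
    ext k
    simp only [Finset.mem_filter, Finset.mem_univ, true_and, Finset.mem_insert, Fin.ext_iff]
    omega
  rw [hset, Finset.sum_insert (by simp), Equiv.swap_comm i' i, permOp_swap_swap]
  have : ∀ k ∈ ({k | (k : ℕ) < i} : Finset (Fin N)),
      permOp (Equiv.swap i i') (permOp (Equiv.swap i k) f) =
        permOp (Equiv.swap i' k) (permOp (Equiv.swap i i') f) := by
    intro k hk
    have hk : (k : ℕ) < i := (Finset.mem_filter.1 hk).2
    have hki : k ≠ i := by rintro rfl; omega
    have hki' : k ≠ i' := by rintro rfl; omega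
    have e : Equiv.swap i' k = Equiv.swap i i' * Equiv.swap i k * (Equiv.swap i i')⁻¹ := by
      rw [← Equiv.swap_apply_apply, Equiv.swap_apply_left, Equiv.swap_apply_of_ne_of_ne hki hki']
    rw [permOp_permOp, permOp_permOp, e]
    simp
  rw [Finset.sum_congr rfl this]
  module

/-- From sA + β = Bs and sB = As + β one gets s(A² + B²) = (A² + B²)s; the other summands commute
with s separately. -/
theorem permOp_swap_casimir (β : ℕ) {i i' : Fin N} (h : (i' : ℕ) = i + 1) (f : Poly N) :
    permOp (Equiv.swap i i') (casimir β f) = casimir β (permOp (Equiv.swap i i') f) := by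
  have hne : i ≠ i' := by rintro rfl; omega
  have hmem : i' ∈ Finset.univ.erase i := by simp [hne.symm]
  rw [casimir_apply, casimir_apply, map_sum, ← Finset.add_sum_erase _ _ (Finset.mem_univ i),
    ← Finset.add_sum_erase _ _ (Finset.mem_univ i), ← Finset.add_sum_erase _ _ hmem,
    ← Finset.add_sum_erase _ _ hmem, ← add_assoc, ← add_assoc]
  congr 1
  · set A := cher β (fun i : Fin N => (i : ℕ)) i with hA
    set B := cher β (fun i : Fin N => (i : ℕ)) i' with hB
    have e1 : ∀ g, permOp (Equiv.swap i i') (A g) + (β : ℂ) • g =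
      B (permOp (Equiv.swap i i') g) := permOp_swap_cher_left β h
    have e2 : ∀ g, permOp (Equiv.swap i i') (B g) =
        A (permOp (Equiv.swap i i') g) + (β : ℂ) • g := by
      intro g
      have := congrArg (permOp (Equiv.swap i i')) (e1 (permOp (Equiv.swap i i') g))
      rw [map_add, permOp_swap_swap, permOp_swap_swap, map_smul, permOp_swap_swap] at this
      exact this.symm
    have e1' : ∀ g, permOp (Equiv.swap i i') (A g) =
      B (permOp (Equiv.swap i i') g) - (β : ℂ) • g := fun g => eq_sub_of_add_eq (e1 g)
    rw [e1', e1', e2, e2, map_sub, map_add, map_smul, map_smul]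
    module
  · refine Finset.sum_congr rfl fun j hj => ?_
    have h1 : j ≠ i := Finset.ne_of_mem_erase (Finset.mem_of_mem_erase hj)
    have h2 : j ≠ i' := Finset.ne_of_mem_erase hj
    rw [permOp_swap_cher_of_ne β h h1 h2, permOp_swap_cher_of_ne β h h1 h2]

theorem permOp_casimir (β : ℕ) (w : Equiv.Perm (Fin N)) (f : Poly N) :
    permOp w (casimir β f) = casimir β (permOp w f) := by
  rcases N with _ | n
  · rw [Subsingleton.elim w 1, permOp_one, permOp_one]
  have hw : w ∈ Submonoid.closure
      (Set.range fun i : Fin n => Equiv.swap i.castSucc i.succ) := by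
    rw [Equiv.Perm.mclosure_swap_castSucc_succ]; trivial
  induction hw using Submonoid.closure_induction generalizing f with
  | mem x hx =>
    obtain ⟨i, rfl⟩ := hx
    exact permOp_swap_casimir β (by simp) f
  | one => rw [permOp_one, permOp_one]
  | mul x y _ _ hx hy => rw [← permOp_permOp, hy, hx, permOp_permOp]

/-- An injective key is equivalent to a permutation. -/
theorem exists_perm_lt_iff {ι : Type*} [LinearOrder ι] {κ : Fin N → ι}
    (hκ : Function.Injective κ) :
    ∃ w : Equiv.Perm (Fin N), ∀ i j, w i < w j ↔ κ i < κ j := by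
  classical
  have hc : Fintype.card (Set.range κ) = N := by
    rw [Set.card_range_of_injective hκ, Fintype.card_fin]
  let e := monoEquivOfFin (Set.range κ) hc
  refine ⟨(Equiv.ofInjective κ hκ).trans e.symm.toEquiv, fun i j => ?_⟩
  simp [← Subtype.coe_lt_coe]

/-- Reordering the indices conjugates the Cherednik operators by a permutation, and the Casimir
commutes with permutations. This freedom of ordering is used in `casimir_prodX_mul`. -/
theorem casimir_eq_of_key (β : ℕ) {κ : Fin N → ℕ} (hκ : Function.Injective κ) (f : Poly N) :
    casimir β f = ∑ j, cher β κ j (cher β κ j f) := by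
  obtain ⟨w, hw⟩ := exists_perm_lt_iff hκ
  have key : ∀ j g, permOp w (cher β κ j g) =
      cher β (fun i : Fin N => (i : ℕ)) (w j) (permOp w g) := fun j g =>
    permOp_cher β w (fun k => by simpa using hw k j) g
  have : permOp w (casimir β f) = permOp w (∑ j, cher β κ j (cher β κ j f)) := by
    rw [permOp_casimir, casimir_apply, map_sum, ← Equiv.sum_comp w]
    simp only [key]
  rw [← permOp_inv_apply w (casimir β f), this, permOp_inv_apply]

theorem casimir_comm_xD (β : ℕ) (j : Fin N) (f : Poly N) :
    casimir β (xD β j f) = xD β j (casimir β f) := by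
  have e : ∀ g : Poly N, xD β j g = cher β (fun i : Fin N => (i : ℕ)) j g
      - (β : ℂ) • jucysMurphy (fun i : Fin N => (i : ℕ)) j g := fun g => by
    rw [cher_apply]; abel
  have e2 : casimir β (jucysMurphy (fun i : Fin N => (i : ℕ)) j f) =
      jucysMurphy (fun i : Fin N => (i : ℕ)) j (casimir β f) := by
    rw [jucysMurphy_apply, jucysMurphy_apply, map_sum]
    exact Finset.sum_congr rfl fun k _ => (permOp_casimir β _ f).symm
  rw [e, e, map_sub, map_smul, casimir_comm_cherednik, e2]

theorem sum_ne_eq_sum_lt {M : Type*} [AddCommMonoid M] {κ : Fin N → ℕ}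
    (hκ : Function.Injective κ) (F : Fin N → Fin N → M) :
    ∑ j, ∑ k with k ≠ j, F j k = ∑ j, ∑ k with κ k < κ j, (F j k + F k j) := by
  have h1 : ∀ j, ∑ k with k ≠ j, F j k =
      ∑ k with κ k < κ j, F j k + ∑ k with κ j < κ k, F j k := by
    intro j
    rw [← Finset.sum_union]
    · refine Finset.sum_congr ?_ fun _ _ => rfl
      ext k
      simp [← lt_or_lt_iff_ne, hκ.ne_iff.symm]
    · exact Finset.disjoint_filter.2 fun k _ h1 h2 => lt_asymm h1 h2
  have h2 : ∑ j, ∑ k with κ j < κ k, F j k = ∑ j, ∑ k with κ k < κ j, F k j :=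
    Finset.sum_comm' (by simp)
  simp only [Finset.sum_add_distrib]
  rw [← h2, ← Finset.sum_add_distrib]
  exact Finset.sum_congr rfl fun j _ => h1 j

theorem divA_swap_eq_neg {j k : Fin N} (h : j ≠ k) (f : Poly N) : divA k j f = -divA j k f := by
  apply divA_eq_of_mul_eq h.symm
  rw [Equiv.swap_comm, ← mul_divA h]
  ring

/-- The terms for (j, k) and (k, j) combine to (x_j - x_k) times the divided difference, which is 1
- s_jk. Adding the Jucys–Murphy elements cancels all transpositions, whence `sum_cher`. -/
theorem sum_xD (β : ℕ) {κ : Fin N → ℕ} (hκ : Function.Injective κ) (f : Poly N) :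
    ∑ j, xD β j f = ∑ j, X j * pderiv j f +
      (β : ℂ) • ∑ j, ∑ k with κ k < κ j, (f - permOp (Equiv.swap j k) f) := by
  simp only [xD_apply, dunklA_apply, mul_add, Finset.sum_add_distrib, mul_smul_comm,
    ← Finset.smul_sum, Finset.mul_sum]
  rw [sum_ne_eq_sum_lt hκ]
  congr 2
  refine Finset.sum_congr rfl fun j _ => Finset.sum_congr rfl fun k hk => ?_
  have hne : j ≠ k := by rintro rfl; exact lt_irrefl _ (Finset.mem_filter.1 hk).2
  rw [divA_swap_eq_neg hne, ← mul_divA hne]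
  ring

theorem card_key_lt {ι : Type*} [LinearOrder ι] {κ : Fin N → ι} {w : Equiv.Perm (Fin N)}
    (hw : ∀ i j, w i < w j ↔ κ i < κ j) (j : Fin N) : ({k | κ k < κ j} : Finset (Fin N)).card = w j := by
  have : ({k | κ k < κ j} : Finset (Fin N)) = (Finset.Iio (w j)).map w.symm.toEmbedding := by
    ext k
    simp [← hw]
  rw [this, Finset.card_map, Fin.card_Iio]

/-- The Cherednik operators add up to the Euler operator plus a constant, for every ordering. -/
theorem sum_cher (β : ℕ) {κ : Fin N → ℕ} (hκ : Function.Injective κ) (f : Poly N) :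
    ∑ j, cher β κ j f =
      ∑ j, X j * pderiv j f + ((β : ℂ) * ∑ i : Fin N, ((i : ℕ) : ℂ)) • f := by
  obtain ⟨w, hw⟩ := exists_perm_lt_iff hκ
  simp only [cher_apply, Finset.sum_add_distrib, sum_xD β hκ, ← Finset.smul_sum,
    jucysMurphy_apply, Finset.sum_sub_distrib, Finset.sum_const, card_key_lt hw]
  simp only [← Nat.cast_smul_eq_nsmul ℂ, ← Finset.sum_smul]
  rw [Equiv.sum_comp w (fun i : Fin N => ((i : ℕ) : ℂ))]
  module

end Cherednik

/-! ### Action on monomials -/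

section Triangularity

variable {N : ℕ}

theorem map_mem_restrictSupport {S : Set (Fin N →₀ ℕ)} {V : Submodule ℂ (Poly N)} (T : Op N)
    (h : ∀ b ∈ S, T (monomial b 1) ∈ V) {f : Poly N} (hf : f ∈ restrictSupport ℂ S) : T f ∈ V := by
  have : restrictSupport ℂ S ≤ V.comap T := by
    rw [restrictSupport_eq_span, Submodule.span_le]
    rintro _ ⟨b, hb, rfl⟩
    exact h b hb
  exact this hf

theorem monomial_mem {S : Set (Fin N →₀ ℕ)} {b : Fin N →₀ ℕ} (h : b ∈ S) (c : ℂ) :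
    monomial b c ∈ restrictSupport ℂ S :=
  (monomial_mem_restrictSupport ℂ).2 (Or.inl h)

/-- The exponent with the entries at `j` and `k` replaced by `u` and `v`. -/
def setTwo (b : Fin N →₀ ℕ) (j k : Fin N) (u v : ℕ) : Fin N →₀ ℕ := (b.update j u).update k v

theorem setTwo_right (b : Fin N →₀ ℕ) (j k : Fin N) (u v : ℕ) : setTwo b j k u v k = v := by
  simp [setTwo]

theorem setTwo_left (b : Fin N →₀ ℕ) {j k : Fin N} (h : j ≠ k) (u v : ℕ) :
    setTwo b j k u v j = u := by
  simp [setTwo, h]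

theorem setTwo_of_ne (b : Fin N →₀ ℕ) {j k l : Fin N} (hj : l ≠ j) (hk : l ≠ k) (u v : ℕ) :
    setTwo b j k u v l = b l := by
  simp [setTwo, hj, hk]

theorem setTwo_self (b : Fin N →₀ ℕ) (j k : Fin N) : setTwo b j k (b j) (b k) = b := by
  ext l
  by_cases hk : l = k
  · subst hk; exact setTwo_right ..
  by_cases hj : l = j
  · subst hj; exact setTwo_left _ hk ..
  exact setTwo_of_ne _ hj hk ..

theorem setTwo_comm (b : Fin N →₀ ℕ) {j k : Fin N} (h : j ≠ k) (u v : ℕ) :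
    setTwo b j k u v = setTwo b k j v u := by
  ext l
  by_cases hk : l = k
  · subst hk; rw [setTwo_right, setTwo_left _ h.symm]
  by_cases hj : l = j
  · subst hj; rw [setTwo_right, setTwo_left _ hk]
  rw [setTwo_of_ne _ hj hk, setTwo_of_ne _ hk hj]

theorem monomial_setTwo (b : Fin N →₀ ℕ) {j k : Fin N} (h : j ≠ k) (u v : ℕ) :
    (monomial (setTwo b j k u v) 1 : Poly N) =
      monomial (setTwo b j k 0 0) 1 * (X j ^ u * X k ^ v) := by
  rw [X_pow_eq_monomial, X_pow_eq_monomial, monomial_mul, monomial_mul, one_mul, one_mul]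
  congr 2
  ext l
  simp only [Finsupp.add_apply]
  by_cases hk : l = k
  · subst hk; simp [setTwo_right, h]
  by_cases hj : l = j
  · subst hj; simp [setTwo_left _ h, h]
  simp [setTwo_of_ne _ hj hk, Ne.symm hj, Ne.symm hk]

theorem permOp_monomial (w : Equiv.Perm (Fin N)) (b : Fin N →₀ ℕ) (c : ℂ) :
    permOp w (monomial b c) = monomial (b.mapDomain w) c := rename_monomial _ _ _

theorem permOp_swap_monomial (b : Fin N →₀ ℕ) {j k : Fin N} (h : j ≠ k) :
    permOp (Equiv.swap j k) (monomial b 1 : Poly N) =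
      monomial (setTwo b j k (b k) (b j)) 1 := by
  rw [permOp_monomial]
  congr 2
  ext l
  rw [Finsupp.mapDomain_equiv_apply, Equiv.symm_swap]
  by_cases hk : l = k
  · subst hk; rw [setTwo_right, Equiv.swap_apply_right]
  by_cases hj : l = j
  · subst hj; rw [setTwo_left _ h, Equiv.swap_apply_left]
  rw [setTwo_of_ne _ hj hk, Equiv.swap_apply_of_ne_of_ne hj hk]

/-- The geometric sum for (x_j^n - x_k^n)/(x_j - x_k), multiplied by the common part of the two
monomials. -/
theorem divA_monomial (b : Fin N →₀ ℕ) {j k : Fin N} (h : j ≠ k) (hb : b k ≤ b j) :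
    divA j k (monomial b 1 : Poly N) =
      ∑ t ∈ Finset.range (b j - b k), monomial (setTwo b j k (b k + t) (b j - 1 - t)) 1 := by
  apply divA_eq_of_mul_eq h
  obtain ⟨n, hn⟩ := Nat.exists_eq_add_of_le hb
  rw [permOp_swap_monomial b h]
  have e : (monomial b 1 : Poly N) = monomial (setTwo b j k 0 0) 1 * (X j ^ b j * X k ^ b k) := by
    rw [← monomial_setTwo b h, setTwo_self]
  rw [e, monomial_setTwo b h (b k), Finset.sum_congr rfl fun t _ => monomial_setTwo b h _ _,
    ← Finset.mul_sum, hn, Nat.add_sub_cancel_left]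
  have e2 : ∀ t ∈ Finset.range n, (X j ^ (b k + t) * X k ^ (b k + n - 1 - t) : Poly N) =
      X j ^ b k * X k ^ b k * (X j ^ t * X k ^ (n - 1 - t)) := fun t ht => by
    have ht := Finset.mem_range.1 ht
    rw [show b k + n - 1 - t = b k + (n - 1 - t) by omega, pow_add, pow_add]
    ring
  rw [Finset.sum_congr rfl e2, ← Finset.mul_sum]
  have := Commute.geom_sum₂_mul (Commute.all (X j : Poly N) (X k)) n
  rw [pow_add, pow_add]
  linear_combination monomial (setTwo b j k 0 0) 1 * X j ^ b k * X k ^ b k * this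

theorem X_mul_monomial_setTwo (b : Fin N →₀ ℕ) {j k : Fin N} (h : j ≠ k) (u v : ℕ) :
    (X j * monomial (setTwo b j k u v) 1 : Poly N) = monomial (setTwo b j k (u + 1) v) 1 := by
  rw [monomial_setTwo _ h, monomial_setTwo _ h (u + 1)]
  ring

theorem X_mul_divA_monomial_of_le (b : Fin N →₀ ℕ) {j k : Fin N} (h : j ≠ k) (hb : b k ≤ b j) :
    X j * divA j k (monomial b 1 : Poly N) =
      ∑ t ∈ Finset.range (b j - b k), monomial (setTwo b j k (b k + t + 1) (b j - 1 - t)) 1 := by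
  rw [divA_monomial b h hb, Finset.mul_sum]
  exact Finset.sum_congr rfl fun t _ => X_mul_monomial_setTwo b h _ _

theorem divA_monomial_of_ge (b : Fin N →₀ ℕ) {j k : Fin N} (h : j ≠ k) (hb : b j ≤ b k) :
    divA j k (monomial b 1 : Poly N) =
      -∑ t ∈ Finset.range (b k - b j), monomial (setTwo b j k (b k - 1 - t) (b j + t)) 1 := by
  rw [divA_swap_eq_neg h.symm, divA_monomial b h.symm hb]
  simp only [setTwo_comm b h]

theorem X_mul_divA_monomial_of_ge (b : Fin N →₀ ℕ) {j k : Fin N} (h : j ≠ k) (hb : b j ≤ b k) :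
    X j * divA j k (monomial b 1 : Poly N) =
      -∑ t ∈ Finset.range (b k - b j), monomial (setTwo b j k (b k - t) (b j + t)) 1 := by
  rw [divA_monomial_of_ge b h hb, mul_neg, Finset.mul_sum]
  congr 1
  refine Finset.sum_congr rfl fun t ht => ?_
  have ht := Finset.mem_range.1 ht
  rw [X_mul_monomial_setTwo b h, show b k - 1 - t + 1 = b k - t by omega]

/-- `c` arises from `b` by changing at most two entries, without increasing their sum or their
maximum. -/
def Move (b c : Fin N →₀ ℕ) : Prop :=
  ∃ j k, (∀ l, l ≠ j → l ≠ k → c l = b l) ∧ c j + c k ≤ b j + b k ∧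
    c j ≤ max (b j) (b k) ∧ c k ≤ max (b j) (b k)

/-- A set of exponents that is stable under the moves. -/
def MoveStable (S : Set (Fin N →₀ ℕ)) : Prop := ∀ b ∈ S, ∀ c, Move b c → c ∈ S

theorem move_setTwo (b : Fin N →₀ ℕ) {j k : Fin N} (h : j ≠ k) {u v : ℕ} (h1 : u + v ≤ b j + b k)
    (h2 : u ≤ max (b j) (b k)) (h3 : v ≤ max (b j) (b k)) : Move b (setTwo b j k u v) :=
  ⟨j, k, fun _ hj hk => setTwo_of_ne b hj hk u v, by
    rw [setTwo_left b h, setTwo_right]; exact ⟨h1, h2, h3⟩⟩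

theorem sum_setTwo (F : Fin N → ℕ → ℕ) (b : Fin N →₀ ℕ) {j k : Fin N} (h : j ≠ k) (u v : ℕ) :
    ∑ i, F i (setTwo b j k u v i) + F j (b j) + F k (b k) = ∑ i, F i (b i) + F j u + F k v := by
  have hk : k ∈ Finset.univ.erase j := by simp [h.symm]
  rw [← Finset.add_sum_erase _ _ (Finset.mem_univ j), ← Finset.add_sum_erase _ _ hk,
    ← Finset.add_sum_erase _ (fun i => F i (b i)) (Finset.mem_univ j),
    ← Finset.add_sum_erase _ (fun i => F i (b i)) hk, setTwo_left b h, setTwo_right,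
    Finset.sum_congr rfl fun i hi => by
      rw [setTwo_of_ne b (Finset.ne_of_mem_erase (Finset.mem_of_mem_erase hi))
        (Finset.ne_of_mem_erase hi)]]
  ring

theorem degree_setTwo (b : Fin N →₀ ℕ) {j k : Fin N} (h : j ≠ k) (u v : ℕ) :
    (setTwo b j k u v).degree + b j + b k = b.degree + u + v := by
  simpa [Finsupp.degree_eq_sum] using sum_setTwo (fun _ n => n) b h u v

theorem divA_monomial_mem (b : Fin N →₀ ℕ) {j k : Fin N} (h : j ≠ k) :
    divA j k (monomial b 1) ∈ restrictSupport ℂ {c | Move b c ∧ c.degree + 1 = b.degree} := by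
  rcases le_total (b k) (b j) with hb | hb
  · rw [divA_monomial b h hb]
    refine Submodule.sum_mem _ fun t ht => monomial_mem ?_ _
    constructor
    · have ht := Finset.mem_range.1 ht
      exact move_setTwo b h (by omega) (by omega) (by omega)
    · have ht := Finset.mem_range.1 ht
      have := degree_setTwo b h (b k + t) (b j - 1 - t)
      omega
  · rw [divA_monomial_of_ge b h hb]
    refine Submodule.neg_mem _ (Submodule.sum_mem _ fun t ht => monomial_mem ?_ _)
    constructor
    · have ht := Finset.mem_range.1 ht
      exact move_setTwo b h (by omega) (by omega) (by omega)
    · have ht := Finset.mem_range.1 ht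
      have := degree_setTwo b h (b k - 1 - t) (b j + t)
      omega

theorem pderiv_monomial_mem (b : Fin N →₀ ℕ) (j : Fin N) :
    pderiv j (monomial b 1) ∈ restrictSupport ℂ {c | Move b c ∧ c.degree + 1 = b.degree} := by
  rw [pderiv_monomial]
  rcases Nat.eq_zero_or_pos (b j) with h0 | h0
  · simp [h0]
  have hle : Finsupp.single j 1 ≤ b := by simpa [Finsupp.single_le_iff, Nat.one_le_iff_ne_zero] using h0.ne'
  obtain ⟨c, rfl⟩ := le_iff_exists_add.1 hle
  refine monomial_mem ?_ _
  refine ⟨⟨j, j, fun l hl _ => ?_, ?_, ?_, ?_⟩, ?_⟩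
  · simp [Ne.symm hl]
  · simp; omega
  · simp
  · simp
  · simp [add_comm]

theorem dunklA_monomial_mem (β : ℕ) (b : Fin N →₀ ℕ) (j : Fin N) :
    dunklA β j (monomial b 1) ∈ restrictSupport ℂ {c | Move b c ∧ c.degree + 1 = b.degree} := by
  rw [dunklA_apply]
  exact Submodule.add_mem _ (pderiv_monomial_mem b j) (Submodule.smul_mem _ _
    (Submodule.sum_mem _ fun k hk => divA_monomial_mem b (Ne.symm (Finset.mem_filter.1 hk).2)))

theorem dunklA_mem (β : ℕ) (j : Fin N) {S S' : Set (Fin N →₀ ℕ)}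
    (h : ∀ b ∈ S, ∀ c, Move b c → c.degree + 1 = b.degree → c ∈ S') {f : Poly N}
    (hf : f ∈ restrictSupport ℂ S) : dunklA β j f ∈ restrictSupport ℂ S' :=
  map_mem_restrictSupport _ (fun b hb => restrictSupport_mono ℂ (fun c hc => h b hb c hc.1 hc.2)
    (dunklA_monomial_mem β b j)) hf

theorem xD_monomial_mem (β : ℕ) (b : Fin N →₀ ℕ) (j : Fin N) :
    xD β j (monomial b 1) ∈ restrictSupport ℂ {c | Move b c ∧ c.degree = b.degree} := by
  rw [xD_apply, dunklA_apply, mul_add, mul_smul_comm, Finset.mul_sum, X_mul_pderiv_monomial]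
  refine Submodule.add_mem _ (Submodule.smul_of_tower_mem _ _ (monomial_mem ?_ _))
    (Submodule.smul_mem _ _ (Submodule.sum_mem _ fun k hk => ?_))
  · exact ⟨⟨j, j, fun _ _ _ => rfl, by simp⟩, rfl⟩
  have h : j ≠ k := Ne.symm (Finset.mem_filter.1 hk).2
  rcases le_total (b k) (b j) with hb | hb
  · rw [X_mul_divA_monomial_of_le b h hb]
    refine Submodule.sum_mem _ fun t ht => monomial_mem ?_ _
    constructor
    · have ht := Finset.mem_range.1 ht
      exact move_setTwo b h (by omega) (by omega) (by omega)
    · have ht := Finset.mem_range.1 ht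
      have := degree_setTwo b h (b k + t + 1) (b j - 1 - t)
      omega
  · rw [X_mul_divA_monomial_of_ge b h hb]
    refine Submodule.neg_mem _ (Submodule.sum_mem _ fun t ht => monomial_mem ?_ _)
    constructor
    · have ht := Finset.mem_range.1 ht
      exact move_setTwo b h (by omega) (by omega) (by omega)
    · have ht := Finset.mem_range.1 ht
      have := degree_setTwo b h (b k - t) (b j + t)
      omega

theorem dunklA_mem_of_stable (β : ℕ) (j : Fin N) {S : Set (Fin N →₀ ℕ)} (hS : MoveStable S)
    {f : Poly N} (hf : f ∈ restrictSupport ℂ S) : dunklA β j f ∈ restrictSupport ℂ S :=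
  dunklA_mem β j (fun b hb c hc _ => hS b hb c hc) hf

theorem xD_mem (β : ℕ) (j : Fin N) {S S' : Set (Fin N →₀ ℕ)}
    (h : ∀ b ∈ S, ∀ c, Move b c → c.degree = b.degree → c ∈ S') {f : Poly N}
    (hf : f ∈ restrictSupport ℂ S) : xD β j f ∈ restrictSupport ℂ S' :=
  map_mem_restrictSupport _ (fun b hb => restrictSupport_mono ℂ (fun c hc => h b hb c hc.1 hc.2)
    (xD_monomial_mem β b j)) hf

theorem xD_mem_of_stable (β : ℕ) (j : Fin N) {S : Set (Fin N →₀ ℕ)} (hS : MoveStable S)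
    {f : Poly N} (hf : f ∈ restrictSupport ℂ S) : xD β j f ∈ restrictSupport ℂ S :=
  xD_mem β j (fun b hb c hc _ => hS b hb c hc) hf

theorem permOp_mem (w : Equiv.Perm (Fin N)) {S S' : Set (Fin N →₀ ℕ)}
    (h : ∀ b ∈ S, b.mapDomain w ∈ S') {f : Poly N}
    (hf : f ∈ restrictSupport ℂ S) : permOp w f ∈ restrictSupport ℂ S' :=
  map_mem_restrictSupport _ (fun b hb => by
    rw [permOp_monomial]; exact monomial_mem (h b hb) _) hf

/-- A transposition of two entries is a move, and transpositions generate the permutations. -/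
theorem MoveStable.mapDomain {S : Set (Fin N →₀ ℕ)} (hS : MoveStable S)
    (w : Equiv.Perm (Fin N)) {b : Fin N →₀ ℕ} (hb : b ∈ S) : b.mapDomain w ∈ S := by
  induction w using Equiv.Perm.swap_induction_on with
  | one => simpa using hb
  | swap_mul w j k hjk ih =>
    refine hS _ ih _ ⟨j, k, fun l hj hk => ?_, ?_⟩
    · rw [Finsupp.mapDomain_equiv_apply, Finsupp.mapDomain_equiv_apply]
      simp [← Equiv.Perm.inv_def, Equiv.swap_apply_of_ne_of_ne hj hk]
    · simp only [Finsupp.mapDomain_equiv_apply]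
      simp [← Equiv.Perm.inv_def, add_comm]

theorem permOp_mem_of_stable (w : Equiv.Perm (Fin N)) {S : Set (Fin N →₀ ℕ)} (hS : MoveStable S)
    {f : Poly N} (hf : f ∈ restrictSupport ℂ S) : permOp w f ∈ restrictSupport ℂ S :=
  permOp_mem w (fun _ hb => hS.mapDomain w hb) hf

theorem jucysMurphy_mem_of_stable (κ : Fin N → ℕ) (j : Fin N) {S : Set (Fin N →₀ ℕ)}
    (hS : MoveStable S) {f : Poly N} (hf : f ∈ restrictSupport ℂ S) :
    jucysMurphy κ j f ∈ restrictSupport ℂ S := by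
  rw [jucysMurphy_apply]
  exact Submodule.sum_mem _ fun k _ => permOp_mem_of_stable _ hS hf

theorem cher_mem_of_stable (β : ℕ) (κ : Fin N → ℕ) (j : Fin N) {S : Set (Fin N →₀ ℕ)}
    (hS : MoveStable S) {f : Poly N} (hf : f ∈ restrictSupport ℂ S) :
    cher β κ j f ∈ restrictSupport ℂ S := by
  rw [cher_apply]
  exact Submodule.add_mem _ (xD_mem_of_stable β j hS hf)
    (Submodule.smul_mem _ _ (jucysMurphy_mem_of_stable κ j hS hf))

theorem casimir_mem_of_stable (β : ℕ) {S : Set (Fin N →₀ ℕ)}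
    (hS : MoveStable S) {f : Poly N} (hf : f ∈ restrictSupport ℂ S) :
    casimir β f ∈ restrictSupport ℂ S := by
  rw [casimir_apply]
  exact Submodule.sum_mem _ fun j _ =>
    cher_mem_of_stable β _ j hS (cher_mem_of_stable β _ j hS hf)

end Triangularity

/-! ### Eigenvalues -/

section Eigenvalues

variable {N : ℕ}

/-- The quantity that orders the exponents for the triangularity of the Cherednik operators. -/
def expKey (b : Fin N →₀ ℕ) : ℕ ×ₗ ℕ := toLex (∑ i, b i ^ 2, ∑ i : Fin N, (i : ℕ) * b i)

/-- The ordering of the positions of an exponent by their entries. -/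
def posKey (b : Fin N →₀ ℕ) (j : Fin N) : ℕ ×ₗ Fin N := toLex (b j, j)

theorem posKey_injective (b : Fin N →₀ ℕ) : Function.Injective (posKey b) := fun _ _ h =>
  congrArg (fun p => (ofLex p).2) h

theorem posKey_lt_iff (b : Fin N →₀ ℕ) (k j : Fin N) :
    posKey b k < posKey b j ↔ b k < b j ∨ b k = b j ∧ k < j := by
  simp [posKey, Prod.Lex.toLex_lt_toLex]

/-- The rank of an entry of an exponent. -/
def posRank (b : Fin N →₀ ℕ) (j : Fin N) : ℕ :=
  ({k | posKey b k < posKey b j} : Finset (Fin N)).card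

theorem expKey_lt_of_sq {b c : Fin N →₀ ℕ} (h : ∑ i, c i ^ 2 < ∑ i, b i ^ 2) :
    expKey c < expKey b := by
  rw [expKey, expKey, Prod.Lex.toLex_lt_toLex]; exact Or.inl h

/-- Strict convexity of the square: two entries with the same sum and a smaller maximum have a
smaller sum of squares. -/
theorem expKey_setTwo_lt {b : Fin N →₀ ℕ} {j k : Fin N} (h : j ≠ k) {u v : ℕ}
    (h1 : u + v = b j + b k) (h2 : u < max (b j) (b k)) (h3 : v < max (b j) (b k)) :
    expKey (setTwo b j k u v) < expKey b := by
  apply expKey_lt_of_sq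
  have := sum_setTwo (fun _ n => n ^ 2) b h u v
  have : u ^ 2 + v ^ 2 < b j ^ 2 + b k ^ 2 := by
    rcases le_total (b j) (b k) with hb | hb
    · rw [max_eq_right hb] at h2 h3
      nlinarith
    · rw [max_eq_left hb] at h2 h3
      nlinarith
  omega

/-- The sum of squares is unchanged, so the second component of the key decides: it drops when the
larger entry moves to the smaller position. -/
theorem expKey_setTwo_swap_lt {b : Fin N →₀ ℕ} {j k : Fin N} (h : k < j) (hb : b k < b j) :
    expKey (setTwo b j k (b k) (b j)) < expKey b := by
  rw [expKey, expKey, Prod.Lex.toLex_lt_toLex]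
  have h1 := sum_setTwo (fun _ n => n ^ 2) b h.ne' (b k) (b j)
  have h2 := sum_setTwo (fun i n => (i : ℕ) * n) b h.ne' (b k) (b j)
  have h3 : (k : ℕ) < j := h
  right
  constructor
  · omega
  · have : (j : ℕ) * b k + k * b j < j * b j + k * b k := by nlinarith
    omega

/-- The polynomials with exponents of smaller key. -/
def lowerKey (b : Fin N →₀ ℕ) : Submodule ℂ (Poly N) := restrictSupport ℂ {c | expKey c < expKey b}

/-- The contribution of a single k to the Cherednik operator at j. Modulo lower keys it is x^b
exactly when k precedes j in the ordering by (entry, position); summed over k this produces the rank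
in the eigenvalue. -/
theorem X_mul_divA_add_swap_mem (b : Fin N →₀ ℕ) {j k : Fin N} (h : j ≠ k) :
    X j * divA j k (monomial b 1 : Poly N)
      + (if k < j then permOp (Equiv.swap j k) (monomial b 1) else 0)
      - (if posKey b k < posKey b j then monomial b 1 else 0) ∈ lowerKey b := by
  simp only [posKey_lt_iff]
  rcases lt_trichotomy (b k) (b j) with hb | hb | hb
  · rw [X_mul_divA_monomial_of_le b h hb.le, if_pos (Or.inl hb)]
    obtain ⟨n, hn⟩ := Nat.exists_eq_add_of_lt hb
    -- The last term of the geometric sum is x^b itself; all earlier ones have a smaller maximum at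
    -- the two positions.
    have hlast : setTwo b j k (b k + n + 1) (b j - 1 - n) = b := by
      conv_rhs => rw [← setTwo_self b j k]
      congr 1 <;> omega
    rw [show b j - b k = n + 1 by omega, Finset.sum_range_succ, hlast]
    have h1 : ∑ t ∈ Finset.range n, monomial (setTwo b j k (b k + t + 1) (b j - 1 - t)) 1
        ∈ lowerKey b := by
      refine Submodule.sum_mem _ fun t ht => monomial_mem ?_ _
      have ht := Finset.mem_range.1 ht
      exact expKey_setTwo_lt h (by omega) (by omega) (by omega)
    have h2 : (if k < j then permOp (Equiv.swap j k) (monomial b 1 : Poly N) else 0)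
        ∈ lowerKey b := by
      split_ifs with hkj
      · rw [permOp_swap_monomial b h]
        exact monomial_mem (expKey_setTwo_swap_lt hkj hb) _
      · exact Submodule.zero_mem _
    convert Submodule.add_mem _ h1 h2 using 1
    abel
  · rw [X_mul_divA_monomial_of_le b h hb.le, hb]
    have : setTwo b j k (b k) (b j) = b := by
      rw [hb]; conv_rhs => rw [← setTwo_self b j k, hb]
    simp [permOp_swap_monomial b h, this]
  · rw [X_mul_divA_monomial_of_ge b h hb.le,
      if_neg (show ¬(b k < b j ∨ b k = b j ∧ k < j) by omega)]
    obtain ⟨n, hn⟩ := Nat.exists_eq_add_of_lt hb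
    rw [show b k - b j = n + 1 by omega, Finset.sum_range_succ', Nat.sub_zero, add_zero,
      permOp_swap_monomial b h]
    have h1 : ∑ t ∈ Finset.range n, monomial (setTwo b j k (b k - (t + 1)) (b j + (t + 1))) 1
        ∈ lowerKey b := by
      refine Submodule.sum_mem _ fun t ht => monomial_mem ?_ _
      have ht := Finset.mem_range.1 ht
      exact expKey_setTwo_lt h (by omega) (by omega) (by omega)
    -- The first term of the sum is the swapped monomial. It cancels against the transposition when
    -- k < j, and has lower key when j < k.
    have h2 : (if k < j then monomial (setTwo b j k (b k) (b j)) 1 else 0)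
        - (monomial (setTwo b j k (b k) (b j)) 1 : Poly N) ∈ lowerKey b := by
      split_ifs with hkj
      · simp
      · rw [zero_sub]
        refine Submodule.neg_mem _ (monomial_mem ?_ _)
        rw [setTwo_comm b h]
        exact expKey_setTwo_swap_lt (lt_of_le_of_ne (not_lt.1 hkj) h) hb
    convert Submodule.sub_mem _ h2 h1 using 1
    abel

theorem cherednik_monomial_sub_mem (β : ℕ) (b : Fin N →₀ ℕ) (j : Fin N) :
    cher β (fun i : Fin N => (i : ℕ)) j (monomial b 1)
      - ((b j + β * posRank b j : ℕ) : ℂ) • monomial b 1 ∈ lowerKey b := by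
  have e : cher β (fun i : Fin N => (i : ℕ)) j (monomial b 1)
      - ((b j + β * posRank b j : ℕ) : ℂ) • monomial b 1 =
      (β : ℂ) • ∑ k with k ≠ j, (X j * divA j k (monomial b 1 : Poly N)
      + (if k < j then permOp (Equiv.swap j k) (monomial b 1) else 0)
      - (if posKey b k < posKey b j then monomial b 1 else 0)) := by
    have h1 : ∑ k with k ≠ j, (if k < j then permOp (Equiv.swap j k) (monomial b 1 : Poly N) else 0)
        = jucysMurphy (fun i : Fin N => (i : ℕ)) j (monomial b 1) := by
      rw [jucysMurphy_apply, Finset.sum_filter, Finset.sum_filter]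
      refine Finset.sum_congr rfl fun k _ => ?_
      by_cases hk : k < j
      · simp [hk, hk.ne]
      · have : ¬ (k : ℕ) < j := hk
        simp [hk]
    have h2 : ∑ k with k ≠ j, (if posKey b k < posKey b j then (monomial b 1 : Poly N) else 0)
        = (posRank b j : ℂ) • monomial b 1 := by
      rw [posRank, Nat.cast_smul_eq_nsmul, ← Finset.sum_const, Finset.sum_filter,
        Finset.sum_filter]
      refine Finset.sum_congr rfl fun k _ => ?_
      by_cases hk : k = j
      · simp [hk]
      · simp [hk]
    rw [Finset.sum_sub_distrib, Finset.sum_add_distrib, h1, h2, cher_apply, xD_apply, dunklA_apply,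
      mul_add, mul_smul_comm, Finset.mul_sum, X_mul_pderiv_monomial, ← Nat.cast_smul_eq_nsmul ℂ]
    push_cast
    module
  rw [e]
  exact Submodule.smul_mem _ _ (Submodule.sum_mem _ fun k hk =>
    X_mul_divA_add_swap_mem b (Ne.symm (Finset.mem_filter.1 hk).2))

/-- Triangularity with respect to the key, with the given diagonal. -/
def KeyTriangular (T : Op N) (e : (Fin N →₀ ℕ) → ℂ) : Prop :=
  ∀ b, T (monomial b 1) - e b • monomial b 1 ∈ lowerKey b

theorem lowerKey_mono {b c : Fin N →₀ ℕ} (h : expKey c < expKey b) : lowerKey c ≤ lowerKey b :=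
  restrictSupport_mono ℂ fun _ hd => lt_trans hd h

theorem KeyTriangular.map_lowerKey {T : Op N} {e : (Fin N →₀ ℕ) → ℂ} (h : KeyTriangular T e)
    (b : Fin N →₀ ℕ) {f : Poly N} (hf : f ∈ lowerKey b) : T f ∈ lowerKey b := by
  refine map_mem_restrictSupport T (fun c hc => ?_) hf
  rw [← sub_add_cancel (T (monomial c 1)) (e c • monomial c 1)]
  exact Submodule.add_mem _ (lowerKey_mono hc (h c)) (Submodule.smul_mem _ _ (monomial_mem hc _))

theorem KeyTriangular.mul {T T' : Op N} {e e' : (Fin N →₀ ℕ) → ℂ} (h : KeyTriangular T e)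
    (h' : KeyTriangular T' e') : KeyTriangular (T * T') fun b => e b * e' b := fun b => by
  have h1 := h.map_lowerKey b (h' b)
  have h2 := Submodule.smul_mem _ (e' b) (h b)
  convert Submodule.add_mem _ h1 h2 using 1
  rw [map_sub, map_smul, Module.End.mul_apply]
  module

theorem KeyTriangular.sum {ι : Type*} (s : Finset ι) {T : ι → Op N} {e : ι → (Fin N →₀ ℕ) → ℂ}
    (h : ∀ i ∈ s, KeyTriangular (T i) (e i)) :
    KeyTriangular (∑ i ∈ s, T i) fun b => ∑ i ∈ s, e i b := fun b => by
  rw [LinearMap.sum_apply, Finset.sum_smul, ← Finset.sum_sub_distrib]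
  exact Submodule.sum_mem _ fun i hi => h i hi b

theorem KeyTriangular.add_smul_one {T : Op N} {e : (Fin N →₀ ℕ) → ℂ} (h : KeyTriangular T e)
    (c : ℂ) : KeyTriangular (T + c • 1) fun b => e b + c := fun b => by
  convert h b using 1
  simp only [LinearMap.add_apply, LinearMap.smul_apply, Module.End.one_apply]
  module

theorem keyTriangular_one : KeyTriangular (1 : Op N) fun _ => 1 := fun b => by simp

theorem KeyTriangular.list_ofFn_prod {m : ℕ} {T : Fin m → Op N} {e : Fin m → (Fin N →₀ ℕ) → ℂ}
    (h : ∀ i, KeyTriangular (T i) (e i)) :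
    KeyTriangular (List.ofFn T).prod fun b => ∏ i, e i b := by
  induction m with
  | zero => simpa using keyTriangular_one
  | succ m ih =>
    simp only [List.ofFn_succ, List.prod_cons, Fin.prod_univ_succ]
    exact (h 0).mul (ih fun i => h i.succ)

/-- The coefficient of a triangular operator at an exponent of maximal key. -/
theorem KeyTriangular.coeff {T : Op N} {e : (Fin N →₀ ℕ) → ℂ} (h : KeyTriangular T e)
    {b : Fin N →₀ ℕ} {f : Poly N} (hf : ∀ c ∈ f.support, expKey c ≤ expKey b) :
    coeff b (T f) = e b * coeff b f := by
  have h1 : T f = ∑ c ∈ f.support, MvPolynomial.coeff c f • T (monomial c 1) := by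
    conv_lhs => rw [f.as_sum, map_sum]
    refine Finset.sum_congr rfl fun c _ => ?_
    rw [← map_smul, smul_monomial, smul_eq_mul, mul_one]
  have h2 : ∀ c ∈ f.support, MvPolynomial.coeff b (T (monomial c 1)) = if c = b then e b else 0 := by
    intro c hc
    have h3 : MvPolynomial.coeff b (T (monomial c 1) - e c • monomial c 1) = 0 := by
      by_contra h0
      exact absurd (h c (mem_support_iff.2 h0)) (not_lt.2 (hf c hc))
    rw [coeff_sub, coeff_smul, coeff_monomial, sub_eq_zero] at h3
    rw [h3]
    split_ifs with hcb
    · simp [hcb]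
    · simp
  rw [h1, coeff_sum, Finset.sum_congr rfl fun c hc => by rw [coeff_smul, h2 c hc]]
  by_cases hb : b ∈ f.support
  · rw [Finset.sum_eq_single b] <;> simp +contextual [mul_comm]
  · rw [Finset.sum_eq_zero]
    · rw [notMem_support_iff.1 hb, mul_zero]
    · intro c hc
      rw [if_neg (by rintro rfl; exact hb hc), smul_zero]

/-- Comparing coefficients at an exponent of maximal key forces the eigenvalue to be a diagonal
entry. -/
theorem KeyTriangular.eq_zero {T : Op N} {e : (Fin N →₀ ℕ) → ℂ} (h : KeyTriangular T e)
    {E : ℂ} {f : Poly N} (hf : T f = E • f) (he : ∀ b ∈ f.support, e b ≠ E) : f = 0 := by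
  by_contra h0
  obtain ⟨b, hb, hmax⟩ := Finset.exists_max_image f.support expKey
    (Finset.nonempty_iff_ne_empty.2 fun h => h0 (support_eq_empty.1 h))
  have := h.coeff hmax
  rw [hf, coeff_smul, smul_eq_mul] at this
  exact he b hb (mul_right_cancel₀ (mem_support_iff.1 hb) this).symm

theorem keyTriangular_cherednik (β : ℕ) (j : Fin N) :
    KeyTriangular (cher β (fun i : Fin N => (i : ℕ)) j)
      fun b => ((b j + β * posRank b j : ℕ) : ℂ) :=
  fun b => cherednik_monomial_sub_mem β b j

theorem keyTriangular_casimir (β : ℕ) :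
    KeyTriangular (casimir β : Op N) fun b => ((∑ j, (b j + β * posRank b j) ^ 2 : ℕ) : ℂ) := by
  have := KeyTriangular.sum Finset.univ fun (j : Fin N) _ =>
    (keyTriangular_cherednik β j).mul (keyTriangular_cherednik β j)
  simpa [casimir, pow_two] using this

/-! ### Dominance -/

/-- The partial sums `λ_1 + ⋯ + λ_k`. -/
def partialSum (lam : Fin N → ℕ) (k : ℕ) : ℕ :=
  ∑ i ∈ Finset.univ.filter (fun i : Fin N => (i : ℕ) < k), lam i

/-- The exponents dominated by `lam`. -/
def domLE (lam : Fin N → ℕ) : Set (Fin N →₀ ℕ) :=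
  {b | ∀ A : Finset (Fin N), ∑ i ∈ A, b i ≤ partialSum lam A.card}

/-- The exponents strictly dominated by `lam`. -/
def domLT (lam : Fin N → ℕ) : Set (Fin N →₀ ℕ) :=
  domLE lam ∩ {b | ∑ i, b i ^ 2 < ∑ i, lam i ^ 2}

/-- Dominance is tested on all sets of positions, so exponents need not be sorted. If a set A
contains only one of the two changed positions, the maximum bound compares it with A or with A after
exchanging the two positions. -/
theorem moveStable_domLE (lam : Fin N → ℕ) : MoveStable (domLE lam) := by
  rintro b hb c ⟨j, k, h, hsum, hj, hk⟩ A
  have aux : ∀ j k : Fin N, (∀ l, l ≠ j → l ≠ k → c l = b l) → c j ≤ max (b j) (b k) →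
      j ∈ A → k ∉ A → ∑ i ∈ A, c i ≤ partialSum lam A.card := by
    intro j k h hj hjA hkA
    have e1 : ∑ i ∈ A, c i = c j + ∑ i ∈ A.erase j, b i := by
      rw [← Finset.add_sum_erase _ _ hjA]
      congr 1
      refine Finset.sum_congr rfl fun i hi => h i (Finset.ne_of_mem_erase hi) ?_
      rintro rfl
      exact hkA (Finset.mem_of_mem_erase hi)
    rcases le_max_iff.1 hj with hj | hj
    · have := hb A
      rw [← Finset.add_sum_erase _ _ hjA] at this
      omega
    -- Here c_j is bounded by b_k, so the test set is A with j replaced by k, of the same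
    -- cardinality.
    · have := hb (insert k (A.erase j))
      have hk' : k ∉ A.erase j := fun h => hkA (Finset.mem_of_mem_erase h)
      rw [Finset.sum_insert hk', Finset.card_insert_of_notMem hk',
        Finset.card_erase_add_one hjA] at this
      omega
  by_cases hjA : j ∈ A <;> by_cases hkA : k ∈ A
  · refine le_trans ?_ (hb A)
    rcases eq_or_ne j k with rfl | hjk
    · refine Finset.sum_le_sum fun i _ => ?_
      by_cases hi : i = j
      · subst hi; simpa using hj
      · exact (h i hi hi).le
    · have hk' : k ∈ A.erase j := Finset.mem_erase.2 ⟨hjk.symm, hkA⟩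
      have e : ∑ i ∈ (A.erase j).erase k, c i = ∑ i ∈ (A.erase j).erase k, b i :=
        Finset.sum_congr rfl fun i hi => h i (Finset.ne_of_mem_erase (Finset.mem_of_mem_erase hi))
          (Finset.ne_of_mem_erase hi)
      rw [← Finset.add_sum_erase _ _ hjA, ← Finset.add_sum_erase _ _ hk',
        ← Finset.add_sum_erase A (fun i => b i) hjA, ← Finset.add_sum_erase _ (fun i => b i) hk', e]
      omega
  · exact aux j k h hj hjA hkA
  · exact aux k j (fun l h1 h2 => h l h2 h1) (by rwa [max_comm]) hkA hjA
  · rw [Finset.sum_congr rfl fun i hi => h i (by rintro rfl; exact hjA hi)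
      (by rintro rfl; exact hkA hi)]
    exact hb A

/-- Convexity for the two changed entries. -/
theorem Move.sum_sq_le {b c : Fin N →₀ ℕ} (h : Move b c) : ∑ i, c i ^ 2 ≤ ∑ i, b i ^ 2 := by
  obtain ⟨j, k, h, hsum, hj, hk⟩ := h
  rcases eq_or_ne j k with rfl | hjk
  · refine Finset.sum_le_sum fun i _ => ?_
    by_cases hi : i = j
    · subst hi; exact Nat.pow_le_pow_left (by simpa using hj) 2
    · rw [h i hi hi]
  · have hk' : k ∈ Finset.univ.erase j := by simp [hjk.symm]
    rw [← Finset.add_sum_erase _ _ (Finset.mem_univ j), ← Finset.add_sum_erase _ _ hk',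
      ← Finset.add_sum_erase _ (fun i => b i ^ 2) (Finset.mem_univ j),
      ← Finset.add_sum_erase _ (fun i => b i ^ 2) hk',
      Finset.sum_congr rfl fun i hi => by rw [h i
        (Finset.ne_of_mem_erase (Finset.mem_of_mem_erase hi)) (Finset.ne_of_mem_erase hi)]]
    have : c j ^ 2 + c k ^ 2 ≤ b j ^ 2 + b k ^ 2 := by
      have key : ∀ u v p q : ℕ, u + v ≤ p + q → u ≤ p → v ≤ p → u ^ 2 + v ^ 2 ≤ p ^ 2 + q ^ 2 := by
        intro u v p q h1 h2 h3
        rcases le_total (u + v) p with h4 | h4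
        · nlinarith [Nat.zero_le (u * v)]
        -- Writing u + v = p + r, the pair (p, r) is at least as spread out as (u, v), since (p -
        -- u)(p - v) ≥ 0, and r ≤ q.
        · obtain ⟨r, hr⟩ := Nat.exists_eq_add_of_le h4
          have : r ≤ q := by omega
          have : r ≤ u := by omega
          have : u ^ 2 + v ^ 2 ≤ p ^ 2 + r ^ 2 := by nlinarith
          nlinarith
      rcases le_total (b j) (b k) with hb | hb
      · rw [max_eq_right hb] at hj hk
        have := key (c j) (c k) (b k) (b j) (by omega) hj hk
        omega
      · rw [max_eq_left hb] at hj hk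
        exact key (c j) (c k) (b j) (b k) hsum hj hk
    omega

theorem moveStable_domLT (lam : Fin N → ℕ) : MoveStable (domLT lam) := fun b hb c hc =>
  ⟨moveStable_domLE lam b hb.1 c hc, lt_of_le_of_lt hc.sum_sq_le hb.2⟩

end Eigenvalues

/-! ### Casimir eigenvalues in dominance order, and symmetric polynomials below a partition -/

section Dominance

variable {N : ℕ}

theorem mem_of_mem_support {S : Set (Fin N →₀ ℕ)} {f : Poly N} (hf : f ∈ restrictSupport ℂ S)
    {b : Fin N →₀ ℕ} (hb : b ∈ f.support) : b ∈ S := hf hb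

/-- The eigenvalue of `casimir β` attached to a partition. -/
def casimirEig (β : ℕ) (lam : Fin N → ℕ) : ℕ := ∑ j : Fin N, (lam j + β * (N - 1 - j)) ^ 2

/-- Each rank is written as the number of thresholds t below it. For fixed t the positions of rank
above t form a set of N - 1 - t elements, to which dominance applies. -/
theorem sum_mul_rank_le {lam : Fin N → ℕ} {b : Fin N →₀ ℕ} (hb : b ∈ domLE lam)
    (w : Equiv.Perm (Fin N)) :
    ∑ j, b j * (w j : ℕ) ≤ ∑ j : Fin N, lam j * (N - 1 - j) := by
  have h1 : ∀ j, b j * (w j : ℕ) = ∑ t : Fin N, if t < w j then b j else 0 := fun j => by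
    rw [← Finset.sum_filter, Finset.sum_const, smul_eq_mul, mul_comm]
    congr 1
    rw [← Fin.card_Iio]
    congr 1
    ext t; simp
  have h2 : ∀ j : Fin N, lam j * (N - 1 - j) =
      ∑ t : Fin N, if (j : ℕ) < N - 1 - t then lam j else 0 := fun j => by
    rw [← Finset.sum_filter, Finset.sum_const, smul_eq_mul, mul_comm]
    congr 1
    rw [show N - 1 - (j : ℕ) = (Fin.rev j : ℕ) by rw [Fin.val_rev]; omega, ← Fin.card_Iio]
    congr 1
    ext t
    simp only [Finset.mem_Iio, Finset.mem_filter, Finset.mem_univ, true_and, Fin.lt_def,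
      Fin.val_rev]
    omega
  rw [Finset.sum_congr rfl fun j _ => h1 j, Finset.sum_congr rfl fun j _ => h2 j,
    Finset.sum_comm (f := fun j t => if t < w j then b j else 0),
    Finset.sum_comm (f := fun j t : Fin N => if (j : ℕ) < N - 1 - t then lam j else 0)]
  refine Finset.sum_le_sum fun t _ => ?_
  rw [← Finset.sum_filter, ← Finset.sum_filter]
  refine (hb _).trans (le_of_eq ?_)
  rw [partialSum]
  have : ({j | t < w j} : Finset (Fin N)) = (Finset.Ioi t).map w.symm.toEmbedding := by
    ext k; simp
  rw [this, Finset.card_map, Fin.card_Ioi]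

/-- After expanding the squares, the sum of b_j² is strictly smaller by the definition of `domLT`,
the mixed term is bounded by `sum_mul_rank_le`, and the squares of the ranks are the same numbers
permuted. The strictness comes from the first term, so it holds also for β = 0. -/
theorem casimir_diag_lt (β : ℕ) {lam : Fin N → ℕ} {b : Fin N →₀ ℕ} (hb : b ∈ domLT lam) :
    ∑ j, (b j + β * posRank b j) ^ 2 < casimirEig β lam := by
  obtain ⟨w, hw⟩ := exists_perm_lt_iff (posKey_injective b)
  have hr : ∀ j, posRank b j = w j := fun j => card_key_lt hw j
  have h1 := sum_mul_rank_le hb.1 w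
  have h2 : ∑ i, b i ^ 2 < ∑ i, lam i ^ 2 := hb.2
  have h3 : ∑ j, (w j : ℕ) ^ 2 = ∑ j : Fin N, (N - 1 - (j : ℕ)) ^ 2 := by
    rw [Equiv.sum_comp w fun j : Fin N => (j : ℕ) ^ 2, ← Equiv.sum_comp Fin.revPerm]
    refine Finset.sum_congr rfl fun j _ => ?_
    rw [Fin.revPerm_apply, Fin.val_rev]
    congr 1; omega
  have e1 : ∑ j, (b j + β * posRank b j) ^ 2 =
      ∑ i, b i ^ 2 + 2 * β * ∑ j, b j * (w j : ℕ) + β ^ 2 * ∑ j, (w j : ℕ) ^ 2 := by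
    simp only [hr, Finset.mul_sum, ← Finset.sum_add_distrib]
    exact Finset.sum_congr rfl fun j _ => by ring
  have e2 : casimirEig β lam = ∑ i, lam i ^ 2 + 2 * β * ∑ j : Fin N, lam j * (N - 1 - j)
      + β ^ 2 * ∑ j : Fin N, (N - 1 - (j : ℕ)) ^ 2 := by
    simp only [casimirEig, Finset.mul_sum, ← Finset.sum_add_distrib]
    exact Finset.sum_congr rfl fun j _ => by ring
  rw [e1, e2, h3]
  have := Nat.mul_le_mul_left (2 * β) h1
  omega

/-- There are no eigenvectors of `casimir β` with eigenvalue attached to `lam` strictly below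
`lam`. -/
theorem eq_zero_of_casimir_eq (β : ℕ) {lam : Fin N → ℕ} {f : Poly N}
    (hf : f ∈ restrictSupport ℂ (domLT lam))
    (h : casimir β f = (casimirEig β lam : ℂ) • f) : f = 0 :=
  (keyTriangular_casimir β).eq_zero h fun b hb => by
    exact_mod_cast (casimir_diag_lt β (mem_of_mem_support hf hb)).ne

theorem eq_filter_of_lower {A : Finset (Fin N)} (hA : ∀ i j, i ≤ j → j ∈ A → i ∈ A) :
    A = Finset.univ.filter fun i : Fin N => (i : ℕ) < A.card := by
  apply Finset.eq_of_subset_of_card_le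
  · intro j hj
    have : Finset.Iic j ⊆ A := fun i hi => hA i j (Finset.mem_Iic.1 hi) hj
    have := Finset.card_le_card this
    rw [Fin.card_Iic] at this
    simp; omega
  · rw [← Finset.card_map Fin.valEmbedding]
    refine (Finset.card_le_card (t := Finset.range A.card) fun x hx => ?_).trans
      (Finset.card_range _).le
    simp only [Finset.mem_map, Finset.mem_filter, Finset.mem_univ, true_and] at hx
    obtain ⟨i, hi, rfl⟩ := hx
    simpa using hi

theorem sum_lower_eq_partialSum (lam : Fin N → ℕ) {A : Finset (Fin N)}
    (hA : ∀ i j, i ≤ j → j ∈ A → i ∈ A) : ∑ i ∈ A, lam i = partialSum lam A.card := by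
  rw [partialSum, ← eq_filter_of_lower hA]

theorem exists_antitone_comp_perm (b : Fin N → ℕ) :
    ∃ τ : Equiv.Perm (Fin N), Antitone (b ∘ τ) := by
  refine ⟨Fin.revPerm.trans (Tuple.sort b), fun i j hij => ?_⟩
  exact Tuple.monotone_sort b (Fin.rev_le_rev.2 hij)

/-- Equivalent to ⟨μ, λ - μ⟩ ≥ 0. Decomposing μ into the indicators of its level sets, which are
initial segments as μ decreases, this is a sum of differences of partial sums. -/
theorem sq_sum_add_le {lam μ : Fin N → ℕ} (hμ : Antitone μ)
    (h : ∀ A : Finset (Fin N), ∑ i ∈ A, μ i ≤ partialSum lam A.card) :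
    ∑ i, (μ i : ℤ) ^ 2 + ∑ i, ((lam i : ℤ) - μ i) ^ 2 ≤ ∑ i, (lam i : ℤ) ^ 2 := by
  have key : 0 ≤ ∑ i, (μ i : ℤ) * ((lam i : ℤ) - μ i) := by
    obtain ⟨T, hT⟩ : ∃ T, ∀ i, μ i ≤ T := ⟨∑ i, μ i, fun i =>
      Finset.single_le_sum (fun _ _ => Nat.zero_le _) (Finset.mem_univ i)⟩
    have h1 : ∀ i, (μ i : ℤ) * ((lam i : ℤ) - μ i) =
        ∑ t ∈ Finset.range T, if t < μ i then (lam i : ℤ) - μ i else 0 := fun i => by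
      rw [← Finset.sum_filter, Finset.sum_const, nsmul_eq_mul]
      have : (Finset.range T).filter (fun t => t < μ i) = Finset.range (μ i) := by
        ext t
        have := hT i
        simp only [Finset.mem_range, Finset.mem_filter]
        omega
      rw [this, Finset.card_range]
    rw [Finset.sum_congr rfl fun i _ => h1 i, Finset.sum_comm]
    refine Finset.sum_nonneg fun t _ => ?_
    rw [← Finset.sum_filter, Finset.sum_sub_distrib, sub_nonneg]
    have hlow : ∀ i j, i ≤ j → j ∈ ({i | t < μ i} : Finset (Fin N)) →
        i ∈ ({i | t < μ i} : Finset (Fin N)) := fun i j hij hj => by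
      simp only [Finset.mem_filter, Finset.mem_univ, true_and] at hj ⊢
      exact hj.trans_le (hμ hij)
    have := h ({i | t < μ i} : Finset (Fin N))
    rw [← sum_lower_eq_partialSum lam hlow] at this
    exact_mod_cast this
  have e : ∑ i, (lam i : ℤ) ^ 2 = ∑ i, (μ i : ℤ) ^ 2 + ∑ i, ((lam i : ℤ) - μ i) ^ 2
      + 2 * ∑ i, (μ i : ℤ) * ((lam i : ℤ) - μ i) := by
    rw [Finset.mul_sum, ← Finset.sum_add_distrib, ← Finset.sum_add_distrib]
    exact Finset.sum_congr rfl fun i _ => by ring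
  omega

/-- By `sq_sum_add_le` for the sorted b, the sums of squares agree only if the sorted b equals λ.
Thus the sum of squares detects strict dominance, also between different sizes. -/
theorem sum_sq_le_or_perm {lam : Fin N → ℕ} {b : Fin N →₀ ℕ} (hb : b ∈ domLE lam) :
    b ∈ domLT lam ∨ ∃ w : Equiv.Perm (Fin N), ⇑b = lam ∘ w := by
  obtain ⟨τ, hτ⟩ := exists_antitone_comp_perm b
  have h := sq_sum_add_le (lam := lam) hτ fun A => by
    have := hb (A.map τ.toEmbedding)
    rwa [Finset.sum_map, Finset.card_map] at this
  have e : ∑ i, (((b ∘ τ) i : ℕ) : ℤ) ^ 2 = ∑ i, (b i : ℤ) ^ 2 :=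
    Equiv.sum_comp τ fun i => (b i : ℤ) ^ 2
  rw [e] at h
  by_cases h0 : ∑ i, ((lam i : ℤ) - ((b ∘ τ) i : ℕ)) ^ 2 = 0
  · right
    refine ⟨τ.symm, ?_⟩
    have h1 : ∀ i, lam i = b (τ i) := fun i => by
      have := (Finset.sum_eq_zero_iff_of_nonneg fun i _ => sq_nonneg _).1 h0 i (Finset.mem_univ i)
      have := pow_eq_zero_iff (two_ne_zero) |>.1 this
      simp only [Function.comp_apply] at this
      omega
    funext i
    simp [h1]
  · left
    refine ⟨hb, ?_⟩
    have : 0 ≤ ∑ i, ((lam i : ℤ) - ((b ∘ τ) i : ℕ)) ^ 2 := Finset.sum_nonneg fun _ _ => sq_nonneg _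
    have : ∑ i, (b i : ℤ) ^ 2 < ∑ i, (lam i : ℤ) ^ 2 := by omega
    show ∑ i, b i ^ 2 < ∑ i, lam i ^ 2
    exact_mod_cast this

/-- Outside the common part, A and the initial segment of the same size have equally many elements,
separated by the value of μ at position |A|. -/
theorem sum_le_of_antitone {μ : Fin N → ℕ} (hμ : Antitone μ) (A : Finset (Fin N)) :
    ∑ i ∈ A, μ i ≤ partialSum μ A.card := by
  rcases Nat.lt_or_ge A.card N with hk | hk
  · set I := Finset.univ.filter fun i : Fin N => (i : ℕ) < A.card with hI
    have hIcard : I.card = A.card := by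
      have : I = Finset.Iio ⟨A.card, hk⟩ := by ext i; simp [hI, Fin.lt_def]
      rw [this, Fin.card_Iio]
    have hc : (A \ I).card = (I \ A).card := by
      have h1 := Finset.card_sdiff_add_card_inter A I
      have h2 := Finset.card_sdiff_add_card_inter I A
      rw [Finset.inter_comm] at h2
      omega
    show _ ≤ ∑ i ∈ I, μ i
    rw [← Finset.sum_inter_add_sum_sdiff A I, ← Finset.sum_inter_add_sum_sdiff I A,
      Finset.inter_comm I A]
    refine Nat.add_le_add_left ?_ _
    calc ∑ i ∈ A \ I, μ i ≤ (A \ I).card • μ ⟨A.card, hk⟩ :=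
          Finset.sum_le_card_nsmul _ _ _ fun i hi => hμ (by
            simp only [hI, Finset.mem_sdiff, Finset.mem_filter, Finset.mem_univ, true_and,
              not_lt] at hi
            exact hi.2)
      _ = (I \ A).card • μ ⟨A.card, hk⟩ := by rw [hc]
      _ ≤ ∑ i ∈ I \ A, μ i := Finset.card_nsmul_le_sum _ _ _ fun i hi => hμ (by
            simp only [hI, Finset.mem_sdiff, Finset.mem_filter, Finset.mem_univ, true_and] at hi
            exact hi.1.le)
  · rw [partialSum]
    refine Finset.sum_le_sum_of_subset fun i _ => ?_
    simp only [Finset.mem_filter, Finset.mem_univ, true_and]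
    omega

theorem partialSum_succ_eq_Iic (lam : Fin N → ℕ) (k : Fin N) :
    partialSum lam (k + 1) = ∑ i ∈ Finset.Iic k, lam i := by
  have : (Finset.univ.filter fun i : Fin N => (i : ℕ) < k + 1) = Finset.Iic k :=
    Finset.ext fun i => by
      rw [Finset.mem_filter, Finset.mem_Iic, Fin.le_def]
      simp
  rw [partialSum, this]

/-- A partition as an exponent. -/
def toExp (lam : Fin N → ℕ) : Fin N →₀ ℕ := Finsupp.equivFunOnFinite.symm lam

@[simp] theorem toExp_apply (lam : Fin N → ℕ) (i : Fin N) : toExp lam i = lam i := rfl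

theorem coe_toExp (lam : Fin N → ℕ) : ⇑(toExp lam) = lam := rfl

theorem toExp_coe (b : Fin N →₀ ℕ) : toExp ⇑b = b := by ext; rfl

theorem eq_of_antitone_of_perm {μ ν : Fin N → ℕ} (hμ : Antitone μ) (hν : Antitone ν)
    {w : Equiv.Perm (Fin N)} (h : μ = ν ∘ w) : μ = ν := by
  rw [h]
  exact Tuple.unique_antitone (f := ν) (σ := w) (τ := 1) (h ▸ hμ) (by simpa using hν)

theorem toExp_mem_domLE_iff {lam μ : Fin N → ℕ} (hμ : Antitone μ) :
    toExp μ ∈ domLE lam ↔ ∀ k : Fin N, ∑ i ∈ Finset.Iic k, μ i ≤ ∑ i ∈ Finset.Iic k, lam i := by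
  constructor
  · intro h k
    have := h (Finset.Iic k)
    rwa [Fin.card_Iic, partialSum_succ_eq_Iic] at this
  · intro h A
    refine (sum_le_of_antitone hμ A).trans ?_
    rcases hA : A.card with _ | k
    · simp [partialSum]
    · have hk : k < N := by
        have := Finset.card_le_univ A
        rw [Fintype.card_fin] at this; omega
      have := h ⟨k, hk⟩
      rwa [← partialSum_succ_eq_Iic, ← partialSum_succ_eq_Iic] at this

theorem toExp_mem_domLT_iff {lam μ : Fin N → ℕ} (hlam : Antitone lam) (hμ : Antitone μ) :
    toExp μ ∈ domLT lam ↔ DomLT μ lam := by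
  constructor
  · rintro ⟨h1, h2⟩
    refine ⟨(toExp_mem_domLE_iff hμ).1 h1, ?_⟩
    rintro rfl
    exact lt_irrefl (∑ i, μ i ^ 2) h2
  · rintro ⟨h1, h2⟩
    rcases sum_sq_le_or_perm ((toExp_mem_domLE_iff hμ).2 h1) with h | ⟨w, hw⟩
    · exact h
    · exact absurd (eq_of_antitone_of_perm hμ hlam hw) h2

/-! ### Symmetric polynomials -/

/-- The symmetric polynomials. -/
def symPoly (N : ℕ) : Submodule ℂ (Poly N) where
  carrier := {f | ∀ w, permOp w f = f}
  add_mem' hf hg w := by rw [map_add, hf w, hg w]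
  zero_mem' w := map_zero _
  smul_mem' c f hf w := by rw [map_smul, hf w]

theorem coeff_permOp (w : Equiv.Perm (Fin N)) (b : Fin N →₀ ℕ) (f : Poly N) :
    coeff (b.mapDomain w) (permOp w f) = coeff b f :=
  coeff_rename_mapDomain _ w.injective _ _

theorem toExp_mapDomain (μ : Fin N → ℕ) (w : Equiv.Perm (Fin N)) :
    (toExp μ).mapDomain w = toExp (μ ∘ w.symm) := by
  ext i
  rw [Finsupp.mapDomain_equiv_apply]; rfl

theorem coeff_comp_of_mem_symPoly {f : Poly N} (hf : f ∈ symPoly N) (μ : Fin N → ℕ)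
    (w : Equiv.Perm (Fin N)) : coeff (toExp (μ ∘ w)) f = coeff (toExp μ) f := by
  conv_rhs => rw [← coeff_permOp w.symm, hf, toExp_mapDomain]
  rfl

theorem prod_X_pow_eq (a : Fin N → ℕ) :
    ∏ i, (X i : Poly N) ^ a i = monomial (toExp a) 1 := by
  rw [monomial_eq, C_1, one_mul, Finsupp.prod_fintype _ _ fun _ => pow_zero _]
  rfl

theorem coeff_mSym (μ : Fin N → ℕ) (a : Fin N → ℕ) [Decidable (∃ w : Equiv.Perm (Fin N), a = μ ∘ w)] :
    coeff (toExp a) (mSym μ : Poly N) =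
      if ∃ w : Equiv.Perm (Fin N), a = μ ∘ w then 1 else 0 := by
  have hinj : ∀ c : Fin N → ℕ, toExp c = toExp a ↔ c = a := fun c =>
    Finsupp.equivFunOnFinite.symm.injective.eq_iff
  simp only [mSym, prod_X_pow_eq, coeff_sum, coeff_monomial, hinj, Finset.sum_ite_eq',
    Finset.mem_image, Finset.mem_univ, true_and]
  simp only [eq_comm]

theorem mSym_mem_symPoly (μ : Fin N → ℕ) : mSym μ ∈ symPoly N := by
  classical
  intro w
  ext b
  have e : b = (toExp (b ∘ w)).mapDomain w := by
    rw [toExp_mapDomain]; ext i; simp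
  conv_lhs => rw [e, coeff_permOp]
  conv_rhs => rw [← toExp_coe b]
  rw [coeff_mSym, coeff_mSym]
  congr 1
  refine propext ⟨fun ⟨v, hv⟩ => ⟨v * w⁻¹, ?_⟩, fun ⟨v, hv⟩ => ⟨v * w, ?_⟩⟩
  · funext i
    have := congrFun hv (w⁻¹ i)
    simpa using this
  · funext i
    simp [hv]

theorem mem_support_mSym {μ : Fin N → ℕ} {b : Fin N →₀ ℕ} (hb : b ∈ (mSym μ : Poly N).support) :
    ∃ w : Equiv.Perm (Fin N), ⇑b = μ ∘ w := by
  classical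
  rw [mem_support_iff, ← toExp_coe b, coeff_mSym] at hb
  by_contra h
  exact hb (if_neg h)

theorem coeff_mSym_self (μ : Fin N → ℕ) : coeff (toExp μ) (mSym μ : Poly N) = 1 := by
  classical
  rw [coeff_mSym, if_pos ⟨1, rfl⟩]

theorem MoveStable.comp_perm {S : Set (Fin N →₀ ℕ)} (hS : MoveStable S) {μ : Fin N → ℕ}
    (hμ : toExp μ ∈ S) (w : Equiv.Perm (Fin N)) : toExp (μ ∘ w) ∈ S := by
  have := hS.mapDomain w.symm hμ
  rwa [toExp_mapDomain] at this

theorem mSym_mem_restrictSupport {S : Set (Fin N →₀ ℕ)} (hS : MoveStable S) {μ : Fin N → ℕ}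
    (hμ : toExp μ ∈ S) : mSym μ ∈ restrictSupport ℂ S := by
  intro b hb
  obtain ⟨w, hw⟩ := mem_support_mSym hb
  rw [← toExp_coe b, hw]
  exact hS.comp_perm hμ w

/-- Only partitions in the support of f are allowed, so dominance bounds on the support pass to the
expansion. -/
theorem mem_span_mSym {f : Poly N} (hf : f ∈ symPoly N) :
    f ∈ Submodule.span ℂ {q | ∃ μ : Fin N → ℕ, Antitone μ ∧ toExp μ ∈ f.support ∧ q = mSym μ} := by
  classical
  have e : f = ∑ c ∈ f.support.filter (fun c : Fin N →₀ ℕ => Antitone ⇑c), coeff c f • mSym ⇑c := by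
    ext b
    obtain ⟨τ, hτ⟩ := exists_antitone_comp_perm b
    have hb : coeff b f = coeff (toExp (⇑b ∘ τ)) f := by
      rw [coeff_comp_of_mem_symPoly hf, toExp_coe]
    have h1 : ∀ c ∈ f.support.filter (fun c : Fin N →₀ ℕ => Antitone ⇑c), coeff b (coeff c f • mSym ⇑c : Poly N)
        = if c = toExp (⇑b ∘ τ) then coeff c f else 0 := by
      intro c hc
      have hc := (Finset.mem_filter.1 hc).2
      rw [coeff_smul, ← toExp_coe b, coeff_mSym, smul_eq_mul, toExp_coe]
      have : (∃ w : Equiv.Perm (Fin N), ⇑b = ⇑c ∘ w) ↔ c = toExp (⇑b ∘ τ) := by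
        constructor
        · rintro ⟨w, hw⟩
          have h2 : (⇑b ∘ τ) = ⇑c ∘ (τ.trans w) := by rw [hw]; rfl
          rw [eq_of_antitone_of_perm hτ hc h2, toExp_coe]
        · intro h
          refine ⟨τ.symm, ?_⟩
          rw [h, coe_toExp]
          funext i; simp
      simp only [this]
      split_ifs <;> simp
    rw [coeff_sum, Finset.sum_congr rfl h1, Finset.sum_ite_eq', hb]
    split_ifs with h
    · rfl
    · by_contra h0
      exact h (Finset.mem_filter.2 ⟨mem_support_iff.2 h0, hτ⟩)
  rw [e]
  refine Submodule.sum_mem _ fun c hc => Submodule.smul_mem _ _ (Submodule.subset_span ?_)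
  have hc := Finset.mem_filter.1 hc
  rw [← e]
  exact ⟨c, hc.2, by rw [toExp_coe]; exact hc.1, rfl⟩

/-- The symmetric polynomials strictly below `lam`. -/
def symLT (lam : Fin N → ℕ) : Submodule ℂ (Poly N) := restrictSupport ℂ (domLT lam) ⊓ symPoly N

theorem symLT_eq_span {lam : Fin N → ℕ} (hlam : Antitone lam) : symLT lam =
    Submodule.span ℂ {q | ∃ μ : Fin N → ℕ, Antitone μ ∧ DomLT μ lam ∧ q = mSym μ} := by
  apply le_antisymm
  · rintro f ⟨hf, hs⟩
    refine Submodule.span_mono ?_ (mem_span_mSym hs)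
    rintro q ⟨μ, hμ, hm, rfl⟩
    exact ⟨μ, hμ, (toExp_mem_domLT_iff hlam hμ).1 (hf hm), rfl⟩
  · rw [Submodule.span_le]
    rintro q ⟨μ, hμ, hd, rfl⟩
    exact ⟨mSym_mem_restrictSupport (moveStable_domLT lam) ((toExp_mem_domLT_iff hlam hμ).2 hd),
      mSym_mem_symPoly μ⟩

instance finiteDimensional_symLT (lam : Fin N → ℕ) : FiniteDimensional ℂ (symLT lam) := by
  have hfin : (domLT lam).Finite := by
    -- Dominance tested on one-element sets bounds every entry by the first part of λ.
    refine (Set.finite_Iic (toExp fun _ : Fin N => partialSum lam 1)).subset fun b hb i => ?_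
    simpa using hb.1 {i}
  have : Finite (domLT lam) := hfin
  have : FiniteDimensional ℂ (restrictSupport ℂ (domLT lam)) :=
    Module.Finite.of_basis (basisRestrictSupport ℂ (domLT lam))
  exact Submodule.finiteDimensional_of_le (inf_le_left : symLT lam ≤ restrictSupport ℂ (domLT lam))

/-- The exponent of largest key in the orbit of `lam`. -/
def revExp (lam : Fin N → ℕ) : Fin N →₀ ℕ := toExp (lam ∘ Fin.rev)

/-- Within the orbit of λ the sum of squares is constant, and the rearrangement inequality shows
that the increasing arrangement maximizes the second component. -/
theorem expKey_le_revExp {lam : Fin N → ℕ} (hlam : Antitone lam) {c : Fin N →₀ ℕ}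
    (hc : c ∈ domLE lam) : expKey c ≤ expKey (revExp lam) := by
  have hsq : ∑ i, revExp lam i ^ 2 = ∑ i, lam i ^ 2 :=
    Equiv.sum_comp Fin.revPerm fun i => lam i ^ 2
  rcases sum_sq_le_or_perm hc with h | ⟨w, hw⟩
  · exact (expKey_lt_of_sq (hsq ▸ h.2)).le
  · rw [expKey, expKey, Prod.Lex.toLex_le_toLex]
    right
    refine ⟨?_, ?_⟩
    · simp only [hsq, hw]
      exact Equiv.sum_comp w fun i => lam i ^ 2
    · have hm : Monovary (fun i : Fin N => (i : ℕ)) (lam ∘ Fin.rev) := by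
        intro i j hij
        by_contra h
        have h : j ≤ i := le_of_lt (not_le.1 h)
        exact absurd hij (not_lt.2 (hlam (Fin.rev_le_rev.2 h)))
      have := hm.sum_mul_comp_perm_le_sum_mul (σ := w.trans Fin.revPerm)
      simpa [hw, revExp] using this

theorem posRank_revExp {lam : Fin N → ℕ} (hlam : Antitone lam) (j : Fin N) :
    posRank (revExp lam) j = j := by
  have : ({k | posKey (revExp lam) k < posKey (revExp lam) j} : Finset (Fin N)) = Finset.Iio j := by
    ext k
    simp only [posKey_lt_iff, Finset.mem_filter, Finset.mem_univ, true_and, Finset.mem_Iio, revExp,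
      toExp_apply, Function.comp_apply]
    constructor
    · rintro (h | ⟨_, h⟩)
      · by_contra hk
        exact absurd h (not_lt.2 (hlam (Fin.rev_le_rev.2 (not_lt.1 hk))))
      · exact h
    · intro h
      rcases (hlam (Fin.rev_le_rev.2 h.le)).lt_or_eq with h1 | h1
      · exact Or.inl h1
      · exact Or.inr ⟨h1, h⟩
  rw [posRank, this, Fin.card_Iio]

theorem casimir_diag_revExp (β : ℕ) {lam : Fin N → ℕ} (hlam : Antitone lam) :
    ∑ j, (revExp lam j + β * posRank (revExp lam) j) ^ 2 = casimirEig β lam := by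
  simp only [posRank_revExp hlam]
  rw [casimirEig, ← Equiv.sum_comp Fin.revPerm]
  refine Finset.sum_congr rfl fun j _ => ?_
  simp only [revExp, toExp_apply, Function.comp_apply, Fin.revPerm_apply, Fin.rev_rev, Fin.val_rev]
  congr 3; omega

theorem coeff_revExp {f : Poly N} (hf : f ∈ symPoly N) (lam : Fin N → ℕ) :
    coeff (revExp lam) f = coeff (toExp lam) f :=
  coeff_comp_of_mem_symPoly hf lam Fin.revPerm

theorem mem_symLT {lam : Fin N → ℕ} {f : Poly N} (hf : f ∈ restrictSupport ℂ (domLE lam))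
    (hs : f ∈ symPoly N) (h0 : coeff (toExp lam) f = 0) : f ∈ symLT lam := by
  refine ⟨fun b hb => ?_, hs⟩
  have hb : b ∈ f.support := hb
  rcases sum_sq_le_or_perm (mem_of_mem_support hf hb) with h | ⟨w, hw⟩
  · exact h
  · refine absurd ?_ (mem_support_iff.1 hb)
    rw [← toExp_coe b, hw, coeff_comp_of_mem_symPoly hs, h0]

theorem casimir_mem_symPoly (β : ℕ) {f : Poly N} (hs : f ∈ symPoly N) :
    casimir β f ∈ symPoly N := fun w => by rw [permOp_casimir, hs w]

theorem toExp_mem_domLE_self {lam : Fin N → ℕ} (hlam : Antitone lam) : toExp lam ∈ domLE lam :=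
  (toExp_mem_domLE_iff hlam).2 fun _ => le_rfl

theorem domLT_subset (lam : Fin N → ℕ) : domLT lam ⊆ domLE lam := fun _ h => h.1

/-- By symmetry only the coefficient at λ has to vanish, and it may be read off at the reversed
exponent, where the key is maximal and triangularity gives it exactly. -/
theorem casimir_sub_mem_symLT (β : ℕ) {lam : Fin N → ℕ} (hlam : Antitone lam) {f : Poly N}
    (hf : f ∈ restrictSupport ℂ (domLE lam)) (hs : f ∈ symPoly N) :
    casimir β f - (casimirEig β lam : ℂ) • f ∈ symLT lam := by
  have hs' := casimir_mem_symPoly β hs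
  refine mem_symLT (Submodule.sub_mem _ (casimir_mem_of_stable β (moveStable_domLE lam) hf)
    (Submodule.smul_mem _ _ hf)) (Submodule.sub_mem _ hs' (Submodule.smul_mem _ _ hs)) ?_
  rw [coeff_sub, coeff_smul, ← coeff_revExp hs', ← coeff_revExp hs,
    (keyTriangular_casimir β).coeff fun c hc => expKey_le_revExp hlam (mem_of_mem_support hf hc),
    casimir_diag_revExp β hlam, smul_eq_mul, sub_self]

/-- The operator `casimir β - casimirEig β lam` is bijective strictly below `lam`. -/
theorem exists_casimir_sub_eq (β : ℕ) {lam : Fin N → ℕ} {r : Poly N}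
    (hr : r ∈ symLT lam) :
    ∃ q ∈ symLT lam, casimir β q - (casimirEig β lam : ℂ) • q = r := by
  have hmap : ∀ f ∈ symLT lam, (casimir β - (casimirEig β lam : ℂ) • 1 : Op N) f ∈ symLT lam :=
    fun f hf => Submodule.sub_mem _ ⟨casimir_mem_of_stable β (moveStable_domLT lam) hf.1,
      casimir_mem_symPoly β hf.2⟩ (Submodule.smul_mem _ _ hf)
  -- An injective endomorphism of a finite-dimensional space is surjective.
  have hinj : Function.Injective (LinearMap.restrict _ hmap) := by
    rw [injective_iff_map_eq_zero]
    rintro ⟨f, hf⟩ h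
    have h := congrArg Subtype.val h
    simp only [LinearMap.coe_restrict_apply, LinearMap.sub_apply, LinearMap.smul_apply,
      Module.End.one_apply, ZeroMemClass.coe_zero, sub_eq_zero] at h
    exact Subtype.ext (eq_zero_of_casimir_eq β hf.1 h)
  obtain ⟨⟨q, hq⟩, h⟩ := LinearMap.surjective_of_injective hinj ⟨r, hr⟩
  refine ⟨q, hq, ?_⟩
  simpa using congrArg Subtype.val h

end Dominance

/-! ### Jack polynomials as eigenvectors of the Casimir -/

section JackPolynomials

variable {N : ℕ}

/-- The Euler operator. -/
def euler (N : ℕ) : Op N := ∑ j, mulX j * ddx j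

theorem euler_apply (f : Poly N) : euler N f = ∑ j, X j * pderiv j f := by
  simp [euler, mulX, ddx]

theorem coeff_euler (b : Fin N →₀ ℕ) (f : Poly N) :
    coeff b (euler N f) = (b.degree : ℂ) * coeff b f := by
  induction f using MvPolynomial.induction_on' with
  | monomial u a =>
    rw [euler_apply, coeff_sum]
    simp only [X_mul_pderiv_monomial, coeff_smul, coeff_monomial]
    split_ifs with h
    · subst h
      rw [Finsupp.degree_eq_sum, Nat.cast_sum, Finset.sum_mul]
      simp
    · simp
  | add p q hp hq => rw [map_add, coeff_add, coeff_add, hp, hq, mul_add]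

theorem euler_eq_smul_iff {n : ℕ} {f : Poly N} :
    euler N f = (n : ℂ) • f ↔ f ∈ restrictSupport ℂ {b | b.degree = n} := by
  constructor
  · intro h b hb
    have hb : b ∈ f.support := hb
    have := congrArg (coeff b) h
    rw [coeff_euler, coeff_smul, smul_eq_mul] at this
    exact_mod_cast mul_right_cancel₀ (mem_support_iff.1 hb) this
  · intro h
    ext b
    rw [coeff_euler, coeff_smul, smul_eq_mul]
    by_cases hb : b ∈ f.support
    · have : b.degree = n := mem_of_mem_support h hb
      rw [this]
    · rw [notMem_support_iff.1 hb, mul_zero, mul_zero]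

theorem sum_cher_eq_euler (β : ℕ) {κ : Fin N → ℕ} (hκ : Function.Injective κ) (f : Poly N) :
    ∑ j, cher β κ j f = euler N f + ((β : ℂ) * ∑ i : Fin N, ((i : ℕ) : ℂ)) • f := by
  rw [sum_cher β hκ, euler_apply]

theorem casimir_comm_euler (β : ℕ) (f : Poly N) :
    casimir β (euler N f) = euler N (casimir β f) := by
  have e : ∀ g : Poly N, euler N g = ∑ j, cher β (fun i : Fin N => (i : ℕ)) j g
      - ((β : ℂ) * ∑ i : Fin N, ((i : ℕ) : ℂ)) • g := fun g => by
    rw [sum_cher_eq_euler β Fin.val_injective, add_sub_cancel_right]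
  rw [e, e, map_sub, map_smul, map_sum]
  congr 1
  exact Finset.sum_congr rfl fun j _ => casimir_comm_cherednik β j f

theorem euler_mem {S : Set (Fin N →₀ ℕ)} {f : Poly N} (hf : f ∈ restrictSupport ℂ S) :
    euler N f ∈ restrictSupport ℂ S := by
  intro b hb
  have hb : b ∈ (euler N f).support := hb
  rw [mem_support_iff, coeff_euler] at hb
  exact mem_of_mem_support hf (mem_support_iff.2 (right_ne_zero_of_mul hb))

/-- The characterization of the Jack polynomials as eigenvectors. -/
structure IsJack (β : ℕ) (lam : Fin N → ℕ) (f : Poly N) : Prop where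
  sub_mem : f - mSym lam ∈ symLT lam
  casimir_eq : casimir β f = (casimirEig β lam : ℂ) • f
  euler_eq : euler N f = ((∑ i, lam i : ℕ) : ℂ) • f

theorem mSym_mem_domLE {lam : Fin N → ℕ} (hlam : Antitone lam) :
    mSym lam ∈ restrictSupport ℂ (domLE lam) :=
  mSym_mem_restrictSupport (moveStable_domLE lam) (toExp_mem_domLE_self hlam)

theorem euler_mSym (lam : Fin N → ℕ) :
    euler N (mSym lam) = ((∑ i, lam i : ℕ) : ℂ) • mSym lam := by
  rw [euler_eq_smul_iff]
  intro b hb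
  obtain ⟨w, hw⟩ := mem_support_mSym hb
  show b.degree = _
  rw [Finsupp.degree_eq_sum, hw]
  exact Equiv.sum_comp w lam

/-- The defect of m_λ as an eigenvector lies strictly below λ, where it can be removed by
`exists_casimir_sub_eq`. -/
theorem exists_isJack (β : ℕ) {lam : Fin N → ℕ} (hlam : Antitone lam) :
    ∃ f : Poly N, IsJack β lam f := by
  obtain ⟨q, hq, hq'⟩ := exists_casimir_sub_eq β
    (casimir_sub_mem_symLT β hlam (mSym_mem_domLE hlam) (mSym_mem_symPoly lam))
  have hc : casimir β (mSym lam - q) = (casimirEig β lam : ℂ) • (mSym lam - q) := by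
    rw [map_sub, smul_sub]
    linear_combination (norm := module) (-1 : ℂ) • hq'
  refine ⟨mSym lam - q, ⟨?_, hc, ?_⟩⟩
  · rw [sub_sub_cancel_left]; exact Submodule.neg_mem _ hq
  -- Homogeneity is automatic: the defect of the Euler equation is again an eigenvector for the
  -- eigenvalue of λ, but supported strictly below λ.
  · rw [← sub_eq_zero]
    refine eq_zero_of_casimir_eq β (lam := lam) ?_ ?_
    · rw [map_sub, euler_mSym]
      have : (((∑ i, lam i : ℕ) : ℂ) • mSym lam - euler N q -
          ((∑ i, lam i : ℕ) : ℂ) • (mSym lam - q) : Poly N) =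
          ((∑ i, lam i : ℕ) : ℂ) • q - euler N q := by module
      rw [this]
      exact Submodule.sub_mem _ (Submodule.smul_mem _ _ hq.1) (euler_mem hq.1)
    · rw [map_sub, map_smul, casimir_comm_euler, hc, map_smul]
      module

theorem IsJack.mem_symPoly {β : ℕ} {lam : Fin N → ℕ} {f : Poly N} (h : IsJack β lam f) :
    f ∈ symPoly N := by
  have := Submodule.add_mem _ h.sub_mem.2 (mSym_mem_symPoly lam)
  rwa [sub_add_cancel] at this

theorem IsJack.mem_domLE {β : ℕ} {lam : Fin N → ℕ} (hlam : Antitone lam) {f : Poly N}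
    (h : IsJack β lam f) : f ∈ restrictSupport ℂ (domLE lam) := by
  have := Submodule.add_mem _ (restrictSupport_mono ℂ (domLT_subset lam) h.sub_mem.1)
    (mSym_mem_domLE hlam)
  rwa [sub_add_cancel] at this

theorem toExp_notMem_domLT (lam : Fin N → ℕ) : toExp lam ∉ domLT lam := fun h =>
  lt_irrefl (∑ i, lam i ^ 2) h.2

theorem coeff_eq_zero_of_mem {S : Set (Fin N →₀ ℕ)} {f : Poly N} (hf : f ∈ restrictSupport ℂ S)
    {b : Fin N →₀ ℕ} (hb : b ∉ S) : coeff b f = 0 := by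
  by_contra h
  exact hb (mem_of_mem_support hf (mem_support_iff.2 h))

theorem IsJack.coeff_self {β : ℕ} {lam : Fin N → ℕ} {f : Poly N} (h : IsJack β lam f) :
    coeff (toExp lam) f = 1 := by
  have := coeff_eq_zero_of_mem h.sub_mem.1 (toExp_notMem_domLT lam)
  rwa [coeff_sub, coeff_mSym_self, sub_eq_zero] at this

/-- A symmetric eigenvector dominated by `lam` is a multiple of the Jack polynomial. -/
theorem IsJack.eq_smul {β : ℕ} {lam : Fin N → ℕ} (hlam : Antitone lam) {f q : Poly N}
    (h : IsJack β lam f)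
    (hq : q ∈ restrictSupport ℂ (domLE lam)) (hs : q ∈ symPoly N)
    (hc : casimir β q = (casimirEig β lam : ℂ) • q) : q = coeff (toExp lam) q • f := by
  rw [← sub_eq_zero]
  refine eq_zero_of_casimir_eq β (lam := lam) (mem_symLT (Submodule.sub_mem _ hq
    (Submodule.smul_mem _ _ (h.mem_domLE hlam)))
    (Submodule.sub_mem _ hs (Submodule.smul_mem _ _ h.mem_symPoly)) ?_).1 ?_
  · rw [coeff_sub, coeff_smul, h.coeff_self, smul_eq_mul, mul_one, sub_self]
  · rw [map_sub, map_smul, hc, h.casimir_eq]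
    module

/-! ### Products of shifted Dunkl operators -/

/-- The product `(x_{j_1} D_{j_1} + c β) (x_{j_2} D_{j_2} + (c + 1) β) ⋯` over a list of
indices. -/
def dunklProd (β : ℕ) : List (Fin N) → ℕ → Op N
  | [], _ => 1
  | j :: L, c => (xD β j + ((β : ℂ) * c) • 1) * dunklProd β L (c + 1)

theorem dunklProd_cons (β : ℕ) (j : Fin N) (L : List (Fin N)) (c : ℕ) (f : Poly N) :
    dunklProd β (j :: L) c f =
      xD β j (dunklProd β L (c + 1) f) + ((β : ℂ) * c) • dunklProd β L (c + 1) f := rfl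

theorem permOp_dunklProd (β : ℕ) (w : Equiv.Perm (Fin N)) (L : List (Fin N)) (c : ℕ)
    (f : Poly N) : permOp w (dunklProd β L c f) = dunklProd β (L.map w) c (permOp w f) := by
  induction L generalizing c with
  | nil => rfl
  | cons j L ih => rw [List.map_cons, dunklProd_cons, dunklProd_cons, map_add, map_smul,
      permOp_xD, ih]

theorem casimir_dunklProd (β : ℕ) (L : List (Fin N)) (c : ℕ) (f : Poly N) :
    casimir β (dunklProd β L c f) = dunklProd β L c (casimir β f) := by
  induction L generalizing c with
  | nil => rfl
  | cons j L ih => rw [dunklProd_cons, dunklProd_cons, map_add, map_smul, casimir_comm_xD, ih]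

theorem dunklProd_mem (β : ℕ) (L : List (Fin N)) (c : ℕ) {S : Set (Fin N →₀ ℕ)}
    (hS : ∀ b ∈ S, ∀ c, Move b c → c.degree = b.degree → c ∈ S) {f : Poly N}
    (hf : f ∈ restrictSupport ℂ S) : dunklProd β L c f ∈ restrictSupport ℂ S := by
  induction L generalizing c with
  | nil => exact hf
  | cons j L ih =>
    rw [dunklProd_cons]
    exact Submodule.add_mem _ (xD_mem β j hS (ih _)) (Submodule.smul_mem _ _ (ih _))

theorem dunklProd_swap_fixed (β : ℕ) {i j : Fin N} {L : List (Fin N)} (hi : i ∉ L) (hj : j ∉ L)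
    (c : ℕ) {f : Poly N} (hf : f ∈ symPoly N) :
    permOp (Equiv.swap i j) (dunklProd β L c f) = dunklProd β L c f := by
  have : L.map (Equiv.swap i j) = L := by
    conv_rhs => rw [← List.map_id L]
    refine List.map_congr_left fun l hl => Equiv.swap_apply_of_ne_of_ne ?_ ?_
    · rintro rfl; exact hi hl
    · rintro rfl; exact hj hl
  rw [permOp_dunklProd, this, hf]

/-- On symmetric polynomials the factors can be permuted. -/
theorem dunklProd_perm (β : ℕ) {L L' : List (Fin N)} (h : L.Perm L') (hL : L.Nodup) (c : ℕ)
    {f : Poly N} (hf : f ∈ symPoly N) : dunklProd β L c f = dunklProd β L' c f := by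
  induction h generalizing c with
  | nil => rfl
  | cons j _ ih =>
    rw [dunklProd_cons, dunklProd_cons, ih (List.nodup_cons.1 hL).2]
  | swap i j L =>
    have hj : j ≠ i := by rintro rfl; simp at hL
    have h1 : j ∉ L := fun h => by simp [h] at hL
    have h2 : i ∉ L := fun h => by simp [h] at hL
    -- The two indices do not occur in L, so their transposition fixes the inner polynomial. The
    -- shift by β between consecutive factors is exactly what `xD_comm` then needs.
    have := xD_comm β hj (dunklProd β L (c + 1 + 1) f)
    rw [dunklProd_swap_fixed β h1 h2 _ hf] at this
    simp only [dunklProd_cons, map_add, map_smul, smul_add, smul_smul]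
    push_cast
    linear_combination (norm := module) this
  | trans h1 _ ih1 ih2 => rw [ih1 hL, ih2 (h1.nodup_iff.1 hL)]

theorem dunklProd_toList_of_perm (β : ℕ) {L : List (Fin N)} {J : Finset (Fin N)} (hL : L.Nodup)
    (hJ : ∀ i, i ∈ L ↔ i ∈ J) (c : ℕ) {f : Poly N} (hf : f ∈ symPoly N) :
    dunklProd β L c f = dunklProd β J.toList c f :=
  dunklProd_perm β ((List.perm_ext_iff_of_nodup hL J.nodup_toList).2 fun i => by
    rw [hJ, Finset.mem_toList]) hL c hf

/-- Any k in K can be moved to the front, where the constant is 0, so the product is divisible by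
x_k. A rearrangement of λ has too few non-zero entries to be divisible by all these variables; hence
an eigenvector for the eigenvalue of λ remains strictly below λ, and this is 0. -/
theorem dunklProd_succ_eq_zero (β : ℕ) {lam : Fin N → ℕ} (hlam : Antitone lam) {m : ℕ}
    (hm : ∀ i : Fin N, m ≤ (i : ℕ) → lam i = 0) {f : Poly N} (hf : IsJack β lam f)
    {K : Finset (Fin N)} (hK : m < K.card) : dunklProd β K.toList 0 f = 0 := by
  have hle : dunklProd β K.toList 0 f ∈ restrictSupport ℂ (domLE lam) :=
    dunklProd_mem β _ _ (fun b hb c hc _ => moveStable_domLE lam b hb c hc) (hf.mem_domLE hlam)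
  refine eq_zero_of_casimir_eq β (lam := lam) (fun b hb => ?_) ?_
  · have hb : b ∈ (dunklProd β K.toList 0 f).support := hb
    rcases sum_sq_le_or_perm (mem_of_mem_support hle hb) with h | ⟨w, hw⟩
    · exact h
    · exfalso
      have hpos : ∀ k ∈ K, b k ≠ 0 := by
        intro k hk h0
        have e : dunklProd β K.toList 0 f = X k * dunklA β k
            (dunklProd β (K.erase k).toList 1 f) := by
          rw [← dunklProd_toList_of_perm β (L := k :: (K.erase k).toList)
            (by simp [Finset.nodup_toList]) (by
            intro i
            simp only [List.mem_cons, Finset.mem_toList, Finset.mem_erase]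
            by_cases hi : i = k
            · simp [hi, hk]
            · simp [hi]) 0 hf.mem_symPoly, dunklProd_cons, Nat.cast_zero, mul_zero, zero_smul,
            add_zero, xD_apply]
        rw [mem_support_iff, e, coeff_X_mul', if_neg (by simp [h0])] at hb
        exact hb rfl
      have hsub : K.map w.toEmbedding ⊆ Finset.univ.filter fun i : Fin N => (i : ℕ) < m := by
        intro i hi
        rw [Finset.mem_map] at hi
        obtain ⟨k, hk, rfl⟩ := hi
        rw [Finset.mem_filter]
        refine ⟨Finset.mem_univ _, ?_⟩
        by_contra h
        exact hpos k hk (by rw [hw]; exact hm _ (not_lt.1 h))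
      have h1 := Finset.card_le_card hsub
      have h2 : (Finset.univ.filter fun i : Fin N => (i : ℕ) < m).card ≤ m := by
        rw [← Finset.card_map Fin.valEmbedding]
        refine (Finset.card_le_card (t := Finset.range m) fun x hx => ?_).trans
          (Finset.card_range _).le
        simp only [Finset.mem_map, Finset.mem_filter, Finset.mem_univ, true_and] at hx
        obtain ⟨i, hi, rfl⟩ := hx
        simpa using hi
      rw [Finset.card_map] at h1
      omega
  · rw [casimir_dunklProd, hf.casimir_eq, map_smul]

/-- Prepending j gives a product over m + 1 indices starting with the constant 0, which vanishes;
the factor x_j can be cancelled. -/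
theorem dunklA_dunklProd_eq_zero (β : ℕ) {lam : Fin N → ℕ} (hlam : Antitone lam) {m : ℕ}
    (hm : ∀ i : Fin N, m ≤ (i : ℕ) → lam i = 0) {f : Poly N} (hf : IsJack β lam f)
    {J : Finset (Fin N)} (hJ : J.card = m) {j : Fin N} (hj : j ∉ J) :
    dunklA β j (dunklProd β J.toList 1 f) = 0 := by
  have h := dunklProd_succ_eq_zero β hlam hm hf (K := insert j J)
    (by rw [Finset.card_insert_of_notMem hj]; omega)
  rw [← dunklProd_toList_of_perm β (L := j :: J.toList) (by simp [hj, J.nodup_toList])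
    (by simp) 0 hf.mem_symPoly, dunklProd_cons, Nat.cast_zero, mul_zero, zero_smul, add_zero,
    xD_apply] at h
  exact (mul_eq_zero.1 h).resolve_left (X_ne_zero j)

end JackPolynomials

/-! ### The Casimir on a product of variables times a polynomial -/

section RaisingJack

variable {N : ℕ}

/-- The product of the variables in `J`. -/
def prodX (J : Finset (Fin N)) : Poly N := ∏ j ∈ J, X j

theorem prodX_insert {J : Finset (Fin N)} {j : Fin N} (h : j ∉ J) :
    prodX (insert j J) = X j * prodX J := Finset.prod_insert h

theorem permOp_prodX (w : Equiv.Perm (Fin N)) (J : Finset (Fin N)) :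
    permOp w (prodX J) = prodX (J.map w.toEmbedding) := by
  rw [prodX, prodX, Finset.prod_map, permOp_apply, map_prod]
  simp

theorem permOp_swap_prodX_of_notMem {J : Finset (Fin N)} {j k : Fin N} (hj : j ∉ J) (hk : k ∉ J) :
    permOp (Equiv.swap j k) (prodX J) = prodX J := by
  rw [prodX, permOp_apply, map_prod]
  refine Finset.prod_congr rfl fun i hi => ?_
  rw [rename_X, Equiv.swap_apply_of_ne_of_ne]
  · rintro rfl; exact hj hi
  · rintro rfl; exact hk hi

theorem permOp_swap_prodX_of_mem {J : Finset (Fin N)} {j k : Fin N} (hj : j ∈ J) (hk : k ∈ J) :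
    permOp (Equiv.swap j k) (prodX J) = prodX J := by
  rw [permOp_prodX]
  congr 1
  apply Finset.eq_of_subset_of_card_le _ (by rw [Finset.card_map])
  intro i hi
  obtain ⟨l, hl, rfl⟩ := Finset.mem_map.1 hi
  simp only [Equiv.coe_toEmbedding]
  rcases eq_or_ne l j with rfl | h1
  · rwa [Equiv.swap_apply_left]
  rcases eq_or_ne l k with rfl | h2
  · rwa [Equiv.swap_apply_right]
  rwa [Equiv.swap_apply_of_ne_of_ne h1 h2]

theorem pderiv_prodX_of_notMem {J : Finset (Fin N)} {j : Fin N} (hj : j ∉ J) :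
    pderiv j (prodX J) = 0 := by
  induction J using Finset.induction_on with
  | empty => simp [prodX]
  | insert k J hk ih =>
    rw [Finset.mem_insert, not_or] at hj
    rw [prodX_insert hk, Derivation.leibniz, ih hj.2, pderiv_X_of_ne (Ne.symm hj.1)]
    simp

theorem divA_prodX_of_mem_of_notMem {J : Finset (Fin N)} {j k : Fin N} (hj : j ∈ J) (hk : k ∉ J) :
    divA j k (prodX J) = prodX (J.erase j) := by
  have hne : j ≠ k := by rintro rfl; exact hk hj
  have hj' : j ∉ J.erase j := Finset.notMem_erase j J
  have hk' : k ∉ J.erase j := fun h => hk (Finset.mem_of_mem_erase h)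
  conv_lhs => rw [← Finset.insert_erase hj, prodX_insert hj', mul_comm]
  rw [divA_mul hne, divA_of_swap_eq hne (permOp_swap_prodX_of_notMem hj' hk'), divA_X_left hne]
  ring

theorem divA_prodX_of_notMem_of_mem {J : Finset (Fin N)} {j k : Fin N} (hj : j ∉ J) (hk : k ∈ J) :
    divA j k (prodX J) = -prodX (J.erase k) := by
  have hne : j ≠ k := by rintro rfl; exact hj hk
  rw [divA_swap_eq_neg hne.symm, divA_prodX_of_mem_of_notMem hk hj]

/-- In the twisted Leibniz rule only k outside J contribute, because X_J is fixed by the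
transpositions inside J. -/
theorem xD_prodX_mul_of_mem (β : ℕ) {J : Finset (Fin N)} {j : Fin N} (hj : j ∈ J) (h : Poly N) :
    xD β j (prodX J * h) = prodX J * (xD β j h + h +
      (β : ℂ) • ∑ k with k ∉ J, permOp (Equiv.swap j k) h) := by
  have hj' : j ∉ J.erase j := Finset.notMem_erase j J
  have hJ : prodX J = X j * prodX (J.erase j) := by
    rw [← prodX_insert hj', Finset.insert_erase hj]
  have h1 : ∑ k with k ≠ j, divA j k (prodX J) * permOp (Equiv.swap j k) h =
      prodX (J.erase j) * ∑ k with k ∉ J, permOp (Equiv.swap j k) h := by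
    rw [Finset.mul_sum, Finset.sum_filter, Finset.sum_filter]
    refine Finset.sum_congr rfl fun k _ => ?_
    by_cases hk : k ∈ J
    · rw [if_neg (not_not.2 hk)]
      split_ifs with hkj
      · rw [divA_of_swap_eq (Ne.symm hkj) (permOp_swap_prodX_of_mem hj hk), zero_mul]
      · rfl
    · rw [if_pos hk, if_pos (by rintro rfl; exact hk hj), divA_prodX_of_mem_of_notMem hj hk]
  have h2 : pderiv j (prodX J) = prodX (J.erase j) := by
    rw [hJ, Derivation.leibniz, pderiv_prodX_of_notMem hj', pderiv_X_self]
    simp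
  rw [xD_apply, dunklA_mul, h1, h2, xD_apply, hJ]
  simp only [smul_eq_C_mul]
  ring

/-- Only k in J contribute, and x_j times X_J without x_k is the image of X_J under s_jk. -/
theorem xD_prodX_mul_of_notMem (β : ℕ) {J : Finset (Fin N)} {j : Fin N} (hj : j ∉ J) (h : Poly N)
    (h0 : dunklA β j h = 0) :
    xD β j (prodX J * h) = -((β : ℂ) • ∑ k with k ∈ J, permOp (Equiv.swap j k) (prodX J * h)) := by
  have h1 : X j * ∑ k with k ≠ j, divA j k (prodX J) * permOp (Equiv.swap j k) h =
      - ∑ k with k ∈ J, permOp (Equiv.swap j k) (prodX J * h) := by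
    rw [Finset.mul_sum, ← Finset.sum_neg_distrib, Finset.sum_filter, Finset.sum_filter]
    refine Finset.sum_congr rfl fun k _ => ?_
    by_cases hk : k ∈ J
    · have hne : j ≠ k := by rintro rfl; exact hj hk
      rw [if_pos hk, if_pos hne.symm, divA_prodX_of_notMem_of_mem hj hk, permOp_mul_apply]
      conv_rhs => rw [← Finset.insert_erase hk, prodX_insert (Finset.notMem_erase k J),
        permOp_mul_apply, permOp_X, Equiv.swap_apply_right, permOp_swap_prodX_of_notMem
          (fun h => hj (Finset.mem_of_mem_erase h)) (Finset.notMem_erase k J)]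
      ring
    · rw [if_neg hk]
      split_ifs with hkj
      · rw [divA_of_swap_eq (Ne.symm hkj) (permOp_swap_prodX_of_notMem hj hk), zero_mul, mul_zero]
      · rfl
  rw [xD_apply, dunklA_mul, h0, pderiv_prodX_of_notMem hj, mul_zero, zero_mul, zero_add, zero_add,
    mul_smul_comm, h1, smul_neg]

/-- A key that puts the elements of `J` first. -/
def keyFirst (J : Finset (Fin N)) (j : Fin N) : ℕ := if j ∈ J then j else N + j

/-- A key that puts the elements of `J` last. -/
def keyLast (J : Finset (Fin N)) (j : Fin N) : ℕ := if j ∈ J then N + j else j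

theorem keyFirst_injective (J : Finset (Fin N)) : Function.Injective (keyFirst J) := by
  intro i j h
  simp only [keyFirst] at h
  apply Fin.ext
  split_ifs at h <;> omega

theorem keyLast_injective (J : Finset (Fin N)) : Function.Injective (keyLast J) := by
  intro i j h
  simp only [keyLast] at h
  apply Fin.ext
  split_ifs at h <;> omega

/-- Multiplication by X_J creates the transpositions of j with the complement of J. These are the
ones that enter the Jucys–Murphy element when J moves from the first to the last place. -/
theorem cher_keyFirst_of_mem (β : ℕ) {J : Finset (Fin N)} {j : Fin N} (hj : j ∈ J) (h : Poly N) :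
    cher β (keyFirst J) j (prodX J * h) = prodX J * (cher β (keyLast J) j h + h) := by
  have h1 : jucysMurphy (keyFirst J) j (prodX J * h) =
      prodX J * ∑ k with k ∈ J ∧ k < j, permOp (Equiv.swap j k) h := by
    rw [jucysMurphy_apply, Finset.mul_sum]
    refine Finset.sum_congr ?_ fun k hk => ?_
    · ext k
      simp only [Finset.mem_filter, Finset.mem_univ, true_and, keyFirst, hj, if_true, Fin.lt_def]
      split_ifs with hk <;> simp [hk]
      omega
    · rw [permOp_mul_apply, permOp_swap_prodX_of_mem hj (Finset.mem_filter.1 hk).2.1]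
  have h2 : jucysMurphy (keyLast J) j h = ∑ k with k ∉ J, permOp (Equiv.swap j k) h +
      ∑ k with k ∈ J ∧ k < j, permOp (Equiv.swap j k) h := by
    rw [jucysMurphy_apply, ← Finset.sum_union]
    · refine Finset.sum_congr ?_ fun _ _ => rfl
      ext k
      simp only [Finset.mem_filter, Finset.mem_univ, true_and, keyLast, hj, if_true, Fin.lt_def,
        Finset.mem_union]
      split_ifs with hk <;> simp [hk]
      omega
    · exact Finset.disjoint_filter.2 fun k _ h1 h2 => h1 h2.1
  rw [cher_apply, xD_prodX_mul_of_mem β hj, h1, cher_apply, h2]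
  simp only [smul_eq_C_mul]
  ring

theorem jucysMurphy_keyLast_of_notMem {J : Finset (Fin N)} {j : Fin N} (hj : j ∉ J) {h : Poly N}
    (hs : ∀ k, k ∉ J → permOp (Equiv.swap j k) h = h) :
    jucysMurphy (keyLast J) j h =
      (({k | k ∉ J ∧ k < j} : Finset (Fin N)).card : ℂ) • h := by
  have : ({k | keyLast J k < keyLast J j} : Finset (Fin N)) =
      ({k | k ∉ J ∧ k < j} : Finset (Fin N)) := by
    ext k
    simp only [Finset.mem_filter, Finset.mem_univ, true_and, keyLast, hj, if_false, Fin.lt_def]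
    split_ifs with hk <;> simp [hk]
    omega
  rw [jucysMurphy_apply, this, Finset.sum_congr rfl fun k hk => hs k (Finset.mem_filter.1 hk).2.1,
    Finset.sum_const, Nat.cast_smul_eq_nsmul]

theorem cher_keyLast_of_notMem (β : ℕ) {J : Finset (Fin N)} {j : Fin N} (hj : j ∉ J) {h : Poly N}
    (h0 : dunklA β j h = 0) (hs : ∀ k, k ∉ J → permOp (Equiv.swap j k) h = h) :
    cher β (keyLast J) j h =
      ((β : ℂ) * (({k | k ∉ J ∧ k < j} : Finset (Fin N)).card : ℂ)) • h := by
  rw [cher_apply, xD_apply, h0, mul_zero, zero_add, jucysMurphy_keyLast_of_notMem hj hs, smul_smul]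

/-- With J first, the Jucys–Murphy element of j contains all transpositions with J, and these cancel
x_j D_j. The scalar left over is the one of `cher_keyLast_of_notMem`. -/
theorem cher_keyFirst_of_notMem (β : ℕ) {J : Finset (Fin N)} {j : Fin N} (hj : j ∉ J) {h : Poly N}
    (h0 : dunklA β j h = 0) (hs : ∀ k, k ∉ J → permOp (Equiv.swap j k) h = h) :
    cher β (keyFirst J) j (prodX J * h) =
      ((β : ℂ) * (({k | k ∉ J ∧ k < j} : Finset (Fin N)).card : ℂ)) • (prodX J * h) := by
  have h1 : jucysMurphy (keyFirst J) j (prodX J * h) =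
      ∑ k with k ∈ J, permOp (Equiv.swap j k) (prodX J * h) +
        (({k | k ∉ J ∧ k < j} : Finset (Fin N)).card : ℂ) • (prodX J * h) := by
    rw [jucysMurphy_apply, Nat.cast_smul_eq_nsmul, ← Finset.sum_const]
    have : ∀ k ∈ ({k | k ∉ J ∧ k < j} : Finset (Fin N)),
        prodX J * h = permOp (Equiv.swap j k) (prodX J * h) := fun k hk => by
      have hk := (Finset.mem_filter.1 hk).2.1
      rw [permOp_mul_apply, permOp_swap_prodX_of_notMem hj hk, hs k hk]
    rw [Finset.sum_congr rfl this, ← Finset.sum_union]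
    · refine Finset.sum_congr ?_ fun _ _ => rfl
      ext k
      simp only [Finset.mem_filter, Finset.mem_univ, true_and, keyFirst, hj, if_false, Fin.lt_def,
        Finset.mem_union]
      split_ifs with hk <;> simp [hk]
      omega
    · exact Finset.disjoint_filter.2 fun k _ h1 h2 => h2.1 h1
  rw [cher_apply, xD_prodX_mul_of_notMem β hj h h0, h1]
  module

theorem sum_card_lt (A : Finset (Fin N)) :
    ∑ j ∈ A, ({k | k ∈ A ∧ k < j} : Finset (Fin N)).card = ∑ i ∈ Finset.range A.card, i := by
  induction A using Finset.induction_on_max with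
  | empty => simp
  | insert a A hA ih =>
    have ha : a ∉ A := fun h => lt_irrefl a (hA a h)
    rw [Finset.sum_insert ha, Finset.card_insert_of_notMem ha, Finset.sum_range_succ, ← ih, add_comm]
    congr 1
    · refine Finset.sum_congr rfl fun j hj => ?_
      congr 1
      ext k
      have : k = a → ¬ k < j := by rintro rfl; exact (hA j hj).asymm
      simp only [Finset.mem_filter, Finset.mem_univ, true_and, Finset.mem_insert]
      tauto
    · congr 1
      ext k
      simp only [Finset.mem_filter, Finset.mem_univ, true_and, Finset.mem_insert]
      constructor
      · rintro ⟨rfl | h, h'⟩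
        · exact absurd h' (lt_irrefl _)
        · exact h
      · exact fun h => ⟨Or.inr h, hA k h⟩

theorem casimirEig_addOnes (β : ℕ) {m : ℕ} (hmN : m ≤ N) {lam : Fin N → ℕ}
    (hm : ∀ i : Fin N, m ≤ (i : ℕ) → lam i = 0) :
    casimirEig β (addOnes m lam) + 2 * β * ∑ i ∈ Finset.range (N - m), i =
      casimirEig β lam + 2 * (∑ i, lam i + β * ∑ i ∈ Finset.range N, i) + m := by
  obtain ⟨n, rfl⟩ := Nat.exists_eq_add_of_le hmN
  have h1 : ∑ j : Fin (m + n), ((if (j : ℕ) < m then 2 * β * (m + n - 1 - j) + 1 else 0) : ℕ) =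
      2 * β * ∑ j ∈ Finset.range m, (m + n - 1 - j) + m := by
    rw [Fin.sum_univ_eq_sum_range (fun j => if j < m then 2 * β * (m + n - 1 - j) + 1 else 0),
      Finset.sum_range_add]
    rw [Finset.sum_congr rfl fun j hj => if_pos (Finset.mem_range.1 hj)]
    simp [Finset.sum_add_distrib, Finset.mul_sum]
  have h2 : ∑ i ∈ Finset.range (m + n), i = ∑ j ∈ Finset.range m, (m + n - 1 - j)
      + ∑ i ∈ Finset.range n, i := by
    rw [← Finset.sum_range_reflect, Finset.sum_range_add, ← Finset.sum_range_reflect _ n]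
    congr 1
    refine Finset.sum_congr rfl fun j hj => ?_
    have := Finset.mem_range.1 hj
    omega
  have h3 : casimirEig β (addOnes m lam) = casimirEig β lam + 2 * ∑ i, lam i +
      ∑ j : Fin (m + n), ((if (j : ℕ) < m then 2 * β * (m + n - 1 - j) + 1 else 0) : ℕ) := by
    simp only [casimirEig, Finset.mul_sum, ← Finset.sum_add_distrib, addOnes]
    refine Finset.sum_congr rfl fun j _ => ?_
    split_ifs with h
    · ring
    · rw [hm j (not_lt.1 h)]; ring
  rw [h3, h1, Nat.add_sub_cancel_left, h2]
  ring

/-- With J first on the left and last on the right, each operator for j in J is shifted by 1 when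
X_J is pulled out, while those outside J act by the same scalars on both sides. The shift adds to
the eigenvalue twice the sum of the Cherednik operators over J, known from the degree, plus m. -/
theorem casimir_prodX_mul (β : ℕ) {m : ℕ} (hmN : m ≤ N) {lam : Fin N → ℕ}
    (hm : ∀ i : Fin N, m ≤ (i : ℕ) → lam i = 0) {J : Finset (Fin N)} (hJ : J.card = m)
    {g : Poly N} (h0 : ∀ j, j ∉ J → dunklA β j g = 0)
    (hs : ∀ j k, j ∉ J → k ∉ J → permOp (Equiv.swap j k) g = g)
    (hc : casimir β g = (casimirEig β lam : ℂ) • g)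
    (he : euler N g = ((∑ i, lam i : ℕ) : ℂ) • g) :
    casimir β (prodX J * g) = (casimirEig β (addOnes m lam) : ℂ) • (prodX J * g) := by
  have hsplit : ∀ F : Fin N → Poly N, ∑ j, F j = ∑ j ∈ J, F j + ∑ j ∈ Jᶜ, F j := fun F =>
    (Finset.sum_add_sum_compl J F).symm
  set r : Fin N → ℂ := fun j => (β : ℂ) * (({k | k ∉ J ∧ k < j} : Finset (Fin N)).card : ℂ) with hr
  have hlast : ∀ j ∈ Jᶜ, cher β (keyLast J) j g = r j • g := fun j hj =>
    cher_keyLast_of_notMem β (Finset.mem_compl.1 hj) (h0 j (Finset.mem_compl.1 hj))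
      fun k hk => hs j k (Finset.mem_compl.1 hj) hk
  have hfirst : ∀ j ∈ Jᶜ, cher β (keyFirst J) j (prodX J * g) = r j • (prodX J * g) := fun j hj =>
    cher_keyFirst_of_notMem β (Finset.mem_compl.1 hj) (h0 j (Finset.mem_compl.1 hj))
      fun k hk => hs j k (Finset.mem_compl.1 hj) hk
  have h1 : casimir β (prodX J * g) =
      prodX J * ∑ j ∈ J, (cher β (keyLast J) j (cher β (keyLast J) j g)
        + (2 : ℂ) • cher β (keyLast J) j g + g) + (∑ j ∈ Jᶜ, r j ^ 2) • (prodX J * g) := by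
    rw [casimir_eq_of_key β (keyFirst_injective J), hsplit, Finset.mul_sum, Finset.sum_smul]
    congr 1
    · refine Finset.sum_congr rfl fun j hj => ?_
      rw [cher_keyFirst_of_mem β hj, cher_keyFirst_of_mem β hj, map_add]
      congr 1
      module
    · refine Finset.sum_congr rfl fun j hj => ?_
      rw [hfirst j hj, map_smul, hfirst j hj, smul_smul, pow_two]
  have h2 : casimir β g = ∑ j ∈ J, cher β (keyLast J) j (cher β (keyLast J) j g)
      + (∑ j ∈ Jᶜ, r j ^ 2) • g := by
    rw [casimir_eq_of_key β (keyLast_injective J), hsplit, Finset.sum_smul]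
    congr 1
    refine Finset.sum_congr rfl fun j hj => ?_
    rw [hlast j hj, map_smul, hlast j hj, smul_smul, pow_two]
  have h3 := sum_cher_eq_euler β (keyLast_injective J) g
  rw [hsplit, Finset.sum_congr rfl hlast, ← Finset.sum_smul] at h3
  have h4 : ∑ j ∈ Jᶜ, r j = (β : ℂ) * ((∑ i ∈ Finset.range (N - m), i : ℕ) : ℂ) := by
    rw [hr, ← Finset.mul_sum, ← Nat.cast_sum]
    have := sum_card_lt Jᶜ
    simp only [Finset.mem_compl] at this
    rw [this, Finset.card_compl, Fintype.card_fin, hJ]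
  have h5 := casimirEig_addOnes β hmN hm
  have h5' := congrArg (Nat.cast : ℕ → ℂ) h5
  push_cast at h5'
  have h6 : ∑ i : Fin N, ((i : ℕ) : ℂ) = ∑ i ∈ Finset.range N, (i : ℂ) :=
    Fin.sum_univ_eq_sum_range (fun i => (i : ℂ)) N
  rw [h4, he, h6] at h3
  rw [hc] at h2
  have h7 : casimir β (prodX J * g) = prodX J * ((casimirEig β (addOnes m lam) : ℂ) • g) := by
    rw [h1, ← mul_smul_comm, ← mul_add]
    congr 1
    rw [Finset.sum_add_distrib, Finset.sum_add_distrib, ← Finset.smul_sum, Finset.sum_const, hJ,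
      ← Nat.cast_smul_eq_nsmul ℂ]
    have h8 : (casimirEig β (addOnes m lam) : ℂ) = casimirEig β lam +
      2 * (∑ x, (lam x : ℂ) + β * ∑ x ∈ Finset.range N, (x : ℂ)) + m
        - 2 * β * ∑ x ∈ Finset.range (N - m), (x : ℂ) := by
      linear_combination h5'
    rw [h8]
    push_cast at h3
    -- In the expansion of the squares (A + 1)², `h2` evaluates the quadratic terms and `h3` the
    -- linear ones.
    linear_combination (norm := module) (2 : ℂ) • h3 - h2
  rw [h7, mul_smul_comm]

end RaisingJack

/-! ### The Kirillov–Noumi operators on Jack polynomials -/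

section RaisingJack

variable {N : ℕ}

/-- The term -β k_i in each factor compensates the Jucys–Murphy element, leaving x_j D_j with a
constant that depends only on the place of the factor. -/
theorem cherednik_prod_apply (β : ℕ) {m : ℕ} (k : Fin m → Fin N) (hk : StrictMono k) (c : ℕ)
    {f : Poly N} (hf : f ∈ symPoly N) :
    (List.ofFn fun i : Fin m => cherednikA β (k i) +
      ((β : ℂ) * (((i : ℕ) : ℂ) + c - ((k i : ℕ) : ℂ))) • (1 : Op N)).prod f =
      dunklProd β (List.ofFn k) c f := by
  induction m generalizing c with
  | zero => simp [dunklProd]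
  | succ m ih =>
    rw [List.ofFn_succ, List.ofFn_succ, List.prod_cons, dunklProd_cons, Module.End.mul_apply]
    have h1 := ih (fun i => k i.succ) (fun i j h => hk (by simpa using h)) (c + 1)
    have h2 : (fun i : Fin m => cherednikA β (k i.succ) +
        ((β : ℂ) * (((i.succ : ℕ) : ℂ) + c - ((k i.succ : ℕ) : ℂ))) • (1 : Op N)) =
        fun i : Fin m => cherednikA β (k i.succ) +
        ((β : ℂ) * (((i : ℕ) : ℂ) + (c + 1 : ℕ) - ((k i.succ : ℕ) : ℂ))) • (1 : Op N) := by
      funext i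
      rw [Fin.val_succ]
      push_cast
      congr 3
      ring
    rw [h2, h1]
    set g := dunklProd β (List.ofFn fun i => k i.succ) (c + 1) f with hg
    have hmem : ∀ l : Fin N, l ≤ k 0 → l ∉ List.ofFn fun i => k i.succ := by
      intro l hl h
      obtain ⟨i, hi⟩ := (List.mem_ofFn' _ _).1 h
      have : k 0 < k i.succ := hk (Fin.succ_pos i)
      rw [← hi] at hl
      exact absurd this (not_lt.2 hl)
    -- The later indices are larger than k 0, so every transposition of k 0 with a smaller index
    -- fixes g.
    have hjm : jucysMurphy (fun i : Fin N => (i : ℕ)) (k 0) g = ((k 0 : ℕ) : ℂ) • g := by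
      rw [jucysMurphy_apply, Finset.sum_congr rfl fun l hl => ?_, Finset.sum_const,
        Nat.cast_smul_eq_nsmul]
      rotate_left
      · exact g
      · have hl : l < k 0 := (Finset.mem_filter.1 hl).2
        exact dunklProd_swap_fixed β (hmem _ le_rfl) (hmem l hl.le) _ hf
      · congr 1
        rw [← Fin.card_Iio]
        congr 1
        ext l
        simp
    rw [cherednikA_eq, LinearMap.add_apply, cher_apply, hjm, LinearMap.smul_apply,
      Module.End.one_apply, Fin.val_zero]
    push_cast
    module

theorem mulX_prod_apply {m : ℕ} (k : Fin m → Fin N) (f : Poly N) :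
    (List.ofFn fun i => mulX (k i)).prod f = (∏ i, X (k i)) * f := by
  induction m with
  | zero => simp
  | succ m ih =>
    rw [List.ofFn_succ, List.prod_cons, Module.End.mul_apply, ih, Fin.prod_univ_succ, mul_assoc]
    rfl

theorem raisingJ_apply_of_mem_symPoly (β m : ℕ) {f : Poly N} (hf : f ∈ symPoly N) :
    raisingJ N β m f =
      ∑ J ∈ Finset.powersetCard m (Finset.univ : Finset (Fin N)),
        prodX J * dunklProd β J.toList 1 f := by
  classical
  rw [raisingJ, raising, LinearMap.sum_apply]
  refine Finset.sum_bij (fun k _ => Finset.univ.image k) ?_ ?_ ?_ ?_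
  · intro k hk
    have hk := (Finset.mem_filter.1 hk).2
    rw [Finset.mem_powersetCard, Finset.card_image_of_injective _ hk.injective]
    simp
  · intro k hk k' hk' h
    have hk := (Finset.mem_filter.1 hk).2
    have hk' := (Finset.mem_filter.1 hk').2
    refine (StrictMono.range_inj hk hk').1 ?_
    have := congrArg (fun s : Finset (Fin N) => (s : Set (Fin N))) h
    simpa using this
  · intro J hJ
    have hJ := (Finset.mem_powersetCard.1 hJ).2
    refine ⟨J.orderEmbOfFin hJ, Finset.mem_filter.2 ⟨Finset.mem_univ _, OrderEmbedding.strictMono _⟩,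
      ?_⟩
    apply Finset.coe_injective
    rw [Finset.coe_image, Finset.coe_univ, Set.image_univ, Finset.range_orderEmbOfFin]
  · intro k hk
    have hk := (Finset.mem_filter.1 hk).2
    have h1 := cherednik_prod_apply β k hk 1 hf
    rw [Nat.cast_one] at h1
    rw [Module.End.mul_apply, h1, mulX_prod_apply, prodX, Finset.prod_image fun _ _ _ _ h =>
      hk.injective h, dunklProd_toList_of_perm β (List.nodup_ofFn.2 hk.injective) _ 1 hf]
    intro i
    rw [List.mem_ofFn', Finset.mem_image]
    simp

theorem permOp_prodX_mul_dunklProd (β : ℕ) (w : Equiv.Perm (Fin N)) (J : Finset (Fin N)) (c : ℕ)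
    {f : Poly N} (hf : f ∈ symPoly N) :
    permOp w (prodX J * dunklProd β J.toList c f) =
      prodX (J.map w.toEmbedding) * dunklProd β (J.map w.toEmbedding).toList c f := by
  rw [permOp_mul_apply, permOp_prodX, permOp_dunklProd, hf w,
    dunklProd_toList_of_perm β (L := J.toList.map w) (J := J.map w.toEmbedding)
      (J.nodup_toList.map w.injective) (by
        intro i
        rw [List.mem_map, Finset.mem_map]
        simp only [Finset.mem_toList, Equiv.coe_toEmbedding]) c hf]

theorem raisingJ_mem_symPoly (β m : ℕ) {f : Poly N} (hf : f ∈ symPoly N) :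
    raisingJ N β m f ∈ symPoly N := by
  intro w
  rw [raisingJ_apply_of_mem_symPoly β m hf, map_sum]
  simp only [permOp_prodX_mul_dunklProd β w _ 1 hf]
  refine Finset.sum_bij' (fun J _ => J.map w.toEmbedding) (fun J _ => J.map w.symm.toEmbedding)
    ?_ ?_ ?_ ?_ ?_
  · intro J hJ
    rw [Finset.mem_powersetCard] at hJ ⊢
    exact ⟨Finset.subset_univ _, by rw [Finset.card_map, hJ.2]⟩
  · intro J hJ
    rw [Finset.mem_powersetCard] at hJ ⊢
    exact ⟨Finset.subset_univ _, by rw [Finset.card_map, hJ.2]⟩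
  · intro J _
    ext i; simp
  · intro J _
    ext i; simp
  · intro J _; rfl

/-- Already the individual summands, which need not be symmetric, are eigenvectors. -/
theorem casimir_raisingJ (β : ℕ) {m : ℕ} (hmN : m ≤ N) {lam : Fin N → ℕ} (hlam : Antitone lam)
    (hm : ∀ i : Fin N, m ≤ (i : ℕ) → lam i = 0) {f : Poly N} (hf : IsJack β lam f) :
    casimir β (raisingJ N β m f) =
      (casimirEig β (addOnes m lam) : ℂ) • raisingJ N β m f := by
  rw [raisingJ_apply_of_mem_symPoly β m hf.mem_symPoly, map_sum, Finset.smul_sum]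
  refine Finset.sum_congr rfl fun J hJ => ?_
  have hJ := (Finset.mem_powersetCard.1 hJ).2
  refine casimir_prodX_mul β hmN hm hJ
    (fun j hj => dunklA_dunklProd_eq_zero β hlam hm hf hJ hj) (fun j k hj hk => ?_) ?_ ?_
  · exact dunklProd_swap_fixed β (by simpa using hj) (by simpa using hk) 1 hf.mem_symPoly
  · rw [casimir_dunklProd, hf.casimir_eq, map_smul]
  · rw [euler_eq_smul_iff]
    exact dunklProd_mem β _ _ (fun b hb c _ hc => by
      rw [Set.mem_ofPred_eq] at hb ⊢; rw [hc, hb]) (euler_eq_smul_iff.1 hf.euler_eq)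

theorem prodX_eq_monomial (J : Finset (Fin N)) :
    prodX J = monomial (toExp fun i => if i ∈ J then 1 else 0) 1 := by
  rw [← prod_X_pow_eq, prodX]
  simp only [pow_ite, pow_one, pow_zero, Finset.prod_ite_mem, Finset.univ_inter]

theorem partialSum_addOnes (lam : Fin N → ℕ) (m : ℕ) {k : ℕ} (hk : k ≤ N) :
    partialSum (addOnes m lam) k = partialSum lam k + min k m := by
  rw [partialSum, partialSum]
  simp only [addOnes, Finset.sum_add_distrib]
  congr 1
  rw [← Finset.sum_filter, Finset.filter_filter, Finset.sum_const, smul_eq_mul, mul_one]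
  have : (Finset.univ.filter fun i : Fin N => (i : ℕ) < k ∧ (i : ℕ) < m).map Fin.valEmbedding =
      Finset.range (min k m) := by
    ext x
    simp only [Finset.mem_map, Finset.mem_filter, Finset.mem_univ, true_and, Finset.mem_range,
      Fin.valEmbedding_apply]
    constructor
    · rintro ⟨i, hi, rfl⟩; omega
    · intro hx
      exact ⟨⟨x, by omega⟩, by simp; omega, rfl⟩
  rw [← Finset.card_map, this, Finset.card_range]

theorem prodX_mul_mem (lam : Fin N → ℕ) {J : Finset (Fin N)} {m : ℕ} (hJ : J.card = m)
    {g : Poly N} (hg : g ∈ restrictSupport ℂ (domLE lam)) :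
    prodX J * g ∈ restrictSupport ℂ (domLE (addOnes m lam)) := by
  refine map_mem_restrictSupport (LinearMap.mulLeft ℂ (prodX J)) (fun b hb => ?_) hg
  rw [LinearMap.mulLeft_apply, prodX_eq_monomial, monomial_mul, one_mul]
  refine monomial_mem (fun A => ?_) _
  have h1 : ∑ i ∈ A, (if i ∈ J then 1 else 0) ≤ min A.card m := by
    rw [← Finset.sum_filter, Finset.sum_const, smul_eq_mul, mul_one]
    refine le_min (Finset.card_le_card (Finset.filter_subset _ _)) ?_
    rw [← hJ]
    exact Finset.card_le_card fun i hi => (Finset.mem_filter.1 hi).2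
  have h2 := hb A
  have h3 : A.card ≤ N := by simpa using Finset.card_le_univ A
  rw [partialSum_addOnes lam m h3]
  simp only [Finsupp.add_apply, toExp_apply, Finset.sum_add_distrib]
  omega

theorem raisingJ_mem_domLE (β m : ℕ) {lam : Fin N → ℕ} {f : Poly N} (hf : f ∈ symPoly N)
    (hf' : f ∈ restrictSupport ℂ (domLE lam)) :
    raisingJ N β m f ∈ restrictSupport ℂ (domLE (addOnes m lam)) := by
  rw [raisingJ_apply_of_mem_symPoly β m hf]
  exact Submodule.sum_mem _ fun J hJ => prodX_mul_mem lam (Finset.mem_powersetCard.1 hJ).2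
    (dunklProd_mem β _ _ (fun b hb c hc _ => moveStable_domLE lam b hb c hc) hf')

theorem antitone_addOnes (m : ℕ) {lam : Fin N → ℕ} (hlam : Antitone lam) :
    Antitone (addOnes m lam) := by
  intro i j hij
  have := hlam hij
  have h : (i : ℕ) ≤ j := hij
  simp only [addOnes]
  split_ifs <;> omega

theorem part_succ (lam : Fin N → ℕ) {j : ℕ} (hj : j < N) : part lam (j + 1) = lam ⟨j, hj⟩ := by
  simp [part, hj]

/-- The leading coefficient of the raising operator. -/
theorem coeff_raisingJ (β : ℕ) {m : ℕ} (hmN : m ≤ N) {lam : Fin N → ℕ} (hlam : Antitone lam)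
    (hm : ∀ i : Fin N, m ≤ (i : ℕ) → lam i = 0) {f : Poly N} (hf : f ∈ symPoly N)
    (hf' : f ∈ restrictSupport ℂ (domLE lam)) :
    coeff (toExp (addOnes m lam)) (raisingJ N β m f) =
      raisingCoeff β m lam * coeff (toExp lam) f := by
  classical
  rw [← coeff_revExp (raisingJ_mem_symPoly β m hf), ← coeff_revExp hf, raisingJ, raising,
    LinearMap.sum_apply, coeff_sum]
  obtain ⟨n, rfl⟩ := Nat.exists_eq_add_of_le' hmN
  -- the index tuple of the last `m` positions
  have hk0 : StrictMono (Fin.natAdd n : Fin m → Fin (n + m)) := Fin.strictMono_natAdd n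
  rw [Finset.sum_eq_single_of_mem (Fin.natAdd n : Fin m → Fin (n + m))
    (Finset.mem_filter.2 ⟨Finset.mem_univ _, hk0⟩)]
  · have hexp : revExp (addOnes m lam) = revExp lam + toExp fun i => if n ≤ (i : ℕ) then 1 else 0 := by
      ext i
      simp only [revExp, toExp_apply, Function.comp_apply, addOnes, Finsupp.add_apply, Fin.val_rev]
      congr 1
      have := i.2
      simp only [show (n + m - (i + 1) < m) ↔ n ≤ (i : ℕ) by omega]
    have hprod : (∏ i, X (Fin.natAdd n i) : Poly (n + m)) =
        monomial (toExp fun i : Fin (n + m) => if n ≤ (i : ℕ) then 1 else 0) 1 := by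
      rw [← prod_X_pow_eq, Fin.prod_univ_add]
      have h1 : ∏ i : Fin n, (X (Fin.castAdd m i) : Poly (n + m)) ^
          (if n ≤ (Fin.castAdd m i : ℕ) then 1 else 0) = 1 :=
        Finset.prod_eq_one fun i _ => by
          rw [if_neg (by rw [Fin.val_castAdd]; exact not_le.2 i.2), pow_zero]
      rw [h1, one_mul]
      simp
    have htri := (KeyTriangular.list_ofFn_prod fun i : Fin m =>
      (keyTriangular_cherednik β (Fin.natAdd n i)).add_smul_one
        ((β : ℂ) * (((i : ℕ) : ℂ) + 1 - ((Fin.natAdd n i : ℕ) : ℂ)))).coeff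
      (b := revExp lam) (f := f) fun c hc => expKey_le_revExp hlam (mem_of_mem_support hf' hc)
    rw [Module.End.mul_apply, mulX_prod_apply, hprod, hexp, mul_comm, coeff_mul_monomial, mul_one]
    refine htri.trans ?_
    congr 1
    -- At the reversed exponent the rank of a position is the position itself, so the constant -β
    -- k_i cancels it.
    have hfac : ∀ i : Fin m, ((revExp lam (Fin.natAdd n i) +
        β * posRank (revExp lam) (Fin.natAdd n i) : ℕ) : ℂ) +
        (β : ℂ) * (((i : ℕ) : ℂ) + 1 - ((Fin.natAdd n i : ℕ) : ℂ)) =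
        (part lam (m - i) : ℂ) + β * ((i : ℕ) + 1) := by
      intro i
      have hi : m - (i : ℕ) = m - 1 - i + 1 := by omega
      rw [posRank_revExp hlam, hi, part_succ lam (by omega)]
      have e : revExp lam (Fin.natAdd n i) = lam ⟨m - 1 - i, by omega⟩ := by
        simp only [revExp, toExp_apply, Function.comp_apply]
        congr 1
        ext
        rw [Fin.val_rev, Fin.val_natAdd]
        show _ = m - 1 - (i : ℕ)
        omega
      rw [e, Fin.val_natAdd]
      push_cast
      ring
    rw [Finset.prod_congr rfl fun i _ => hfac i,
      Fin.prod_univ_eq_prod_range (fun i => (part lam (m - i) : ℂ) + β * ((i : ℕ) + 1)) m,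
      raisingCoeff]
    refine Finset.prod_bij' (fun i _ => m - i) (fun j _ => m - j) ?_ ?_ ?_ ?_ ?_
    · intro i hi
      have := Finset.mem_range.1 hi
      rw [Finset.mem_Icc]; omega
    · intro j hj
      have := Finset.mem_Icc.1 hj
      rw [Finset.mem_range]; omega
    · intro i hi
      have := Finset.mem_range.1 hi
      omega
    · intro j hj
      have := Finset.mem_Icc.1 hj
      omega
    · intro i hi
      have := Finset.mem_range.1 hi
      rw [Nat.cast_sub this.le]
      ring
  -- Any other tuple contains one of the first n positions; its summand is divisible by that
  -- variable, whose exponent in the reversed λ + (1^m) is 0.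
  · intro k hk hne
    have hk := (Finset.mem_filter.1 hk).2
    obtain ⟨i, hi⟩ : ∃ i, (k i : ℕ) < n := by
      by_contra! h
      refine hne ((StrictMono.range_inj hk hk0).1 ?_)
      have hsub : Finset.univ.image k ⊆ Finset.univ.image (Fin.natAdd n : Fin m → Fin (n + m)) := by
        intro x hx
        obtain ⟨i, _, rfl⟩ := Finset.mem_image.1 hx
        have h1 := h i
        have h2 := (k i).2
        refine Finset.mem_image.2 ⟨⟨k i - n, by omega⟩, Finset.mem_univ _, ?_⟩
        ext
        simp; omega
      have := Finset.eq_of_subset_of_card_le hsub (by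
        rw [Finset.card_image_of_injective _ hk.injective,
          Finset.card_image_of_injective _ hk0.injective])
      have := congrArg (fun s : Finset (Fin (n + m)) => (s : Set (Fin (n + m)))) this
      simpa using this
    rw [Module.End.mul_apply, mulX_prod_apply, ← Finset.mul_prod_erase _ _ (Finset.mem_univ i),
      mul_assoc, coeff_X_mul', if_neg]
    rw [Finsupp.mem_support_iff, not_not]
    have hr : m ≤ (Fin.rev (k i) : ℕ) := by rw [Fin.val_rev]; omega
    simp only [revExp, toExp_apply, Function.comp_apply, addOnes, hm _ hr, if_neg (not_lt.2 hr), add_zero]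

theorem IsJack.raisingJ_eq {β : ℕ} {m : ℕ} (hmN : m ≤ N) {lam : Fin N → ℕ} (hlam : Antitone lam)
    (hm : ∀ i : Fin N, m ≤ (i : ℕ) → lam i = 0) {f f' : Poly N} (hf : IsJack β lam f)
    (hf' : IsJack β (addOnes m lam) f') :
    raisingJ N β m f = raisingCoeff β m lam • f' := by
  rw [hf'.eq_smul (antitone_addOnes m hlam)
    (raisingJ_mem_domLE β m hf.mem_symPoly (hf.mem_domLE hlam))
    (raisingJ_mem_symPoly β m hf.mem_symPoly) (casimir_raisingJ β hmN hlam hm hf),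
    coeff_raisingJ β hmN hlam hm hf.mem_symPoly (hf.mem_domLE hlam), hf.coeff_self, mul_one]

end RaisingJack

/-! ### Transport of the operators along `substOne` -/

section Transport

variable {N : ℕ}

/-- Operators with the commutation relations of `x_j` and `x_j D^A_j`. -/
structure DunklLike (β : ℕ) (Y T : Fin N → Op N) : Prop where
  comm : ∀ i j f, Y i (Y j f) = Y j (Y i f)
  perm : ∀ (w : Equiv.Perm (Fin N)) j f, permOp w (Y j f) = Y (w j) (permOp w f)
  one : ∀ j, T j 1 = 0
  of_ne : ∀ j k, k ≠ j → ∀ f, T j (Y k f) = Y k (T j f) - (β : ℂ) • Y j (permOp (Equiv.swap j k) f)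
  self : ∀ j f, T j (Y j f) = Y j (T j f) + Y j f +
    (β : ℂ) • ∑ k with k ≠ j, Y j (permOp (Equiv.swap j k) f)

theorem list_ofFn_pow_prod {M : Type*} [Monoid M] {m : ℕ} (A : Fin m → M)
    (hA : ∀ i j, Commute (A i) (A j)) (n : Fin m → ℕ) (j : Fin m) :
    (List.ofFn fun i => A i ^ (n i + if i = j then 1 else 0)).prod =
      A j * (List.ofFn fun i => A i ^ n i).prod := by
  induction m with
  | zero => exact j.elim0
  | succ m ih =>
    rw [List.ofFn_succ, List.ofFn_succ, List.prod_cons, List.prod_cons]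
    refine Fin.cases ?_ (fun j => ?_) j
    · simp [pow_succ', mul_assoc, Fin.succ_ne_zero]
    · have := ih (fun i => A i.succ) (fun i j => hA _ _) (fun i => n i.succ) j
      simp only [Fin.succ_inj, if_neg (Fin.succ_ne_zero j).symm, add_zero]
      rw [this, ← mul_assoc, ← mul_assoc, ((hA 0 j.succ).pow_left (n 0)).eq]

theorem substOne_monomial (Y : Fin N → Op N) (b : Fin N →₀ ℕ) :
    substOne Y (monomial b 1) = (List.ofFn fun j => Y j ^ b j).prod 1 := by
  have := (basisMonomials (Fin N) ℂ).constr_basis ℂ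
    (fun n : Fin N →₀ ℕ => (List.ofFn fun j => Y j ^ n j).prod (1 : Poly N)) b
  rwa [coe_basisMonomials] at this

theorem substOne_one (Y : Fin N → Op N) : substOne Y 1 = 1 := by
  have := substOne_monomial Y 0
  simpa using this

theorem substOne_X_mul {Y : Fin N → Op N} (hY : ∀ i j f, Y i (Y j f) = Y j (Y i f)) (j : Fin N)
    (f : Poly N) : substOne Y (X j * f) = Y j (substOne Y f) := by
  have hA : ∀ i j, Commute (Y i) (Y j) := fun i j => LinearMap.ext fun f => hY i j f
  induction f using MvPolynomial.induction_on' with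
  | monomial b a =>
    have e : (monomial b a : Poly N) = a • monomial b 1 := by
      rw [smul_monomial, smul_eq_mul, mul_one]
    rw [e, mul_smul_comm, map_smul, map_smul, map_smul, X, monomial_mul, one_mul, add_comm,
      substOne_monomial, substOne_monomial]
    have := list_ofFn_pow_prod Y hA b j
    rw [← Module.End.mul_apply, ← this]
    simp [Finsupp.single_apply, eq_comm]
  | add p q hp hq => rw [mul_add, map_add, map_add, map_add, hp, hq]

theorem eq_zero_of_X_mul_step (T : Op N) (h1 : T 1 = 0)
    (hX : ∀ k f, T f = 0 → T (X k * f) = 0) (f : Poly N) : T f = 0 := by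
  induction f using MvPolynomial.induction_on with
  | C a => rw [← mul_one (C a), ← smul_eq_C_mul, map_smul, h1, smul_zero]
  | add p q hp hq => rw [map_add, hp, hq, add_zero]
  | mul_X p i hp => rw [mul_comm, hX _ _ hp]

variable {β : ℕ} {Y T : Fin N → Op N}

theorem DunklLike.substOne_X_mul (h : DunklLike β Y T) (j : Fin N) (f : Poly N) :
    substOne Y (X j * f) = Y j (substOne Y f) := CalogeroPoly.substOne_X_mul h.comm j f

theorem DunklLike.substOne_permOp (h : DunklLike β Y T) (w : Equiv.Perm (Fin N)) (f : Poly N) :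
    substOne Y (permOp w f) = permOp w (substOne Y f) := by
  rw [← sub_eq_zero]
  refine eq_zero_of_X_mul_step (substOne Y * permOp w - permOp w * substOne Y) ?_ ?_ f
  · simp [substOne_one]
  · intro k f hf
    simp only [LinearMap.sub_apply, Module.End.mul_apply, sub_eq_zero] at hf ⊢
    rw [permOp_mul_apply, permOp_X, h.substOne_X_mul, h.substOne_X_mul, hf, h.perm]

theorem xD_one (β : ℕ) (j : Fin N) : xD β j (1 : Poly N) = 0 := by
  rw [xD_apply, dunklA_one, mul_zero]

/-- The commutation relations with the variables and the value on 1 determine x_j D_j; the fields of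
`DunklLike` are these data for T, so induction over multiplication by variables applies. -/
theorem DunklLike.substOne_xD (h : DunklLike β Y T) (j : Fin N) (f : Poly N) :
    substOne Y (xD β j f) = T j (substOne Y f) := by
  rw [← sub_eq_zero]
  refine eq_zero_of_X_mul_step (substOne Y * xD β j - T j * substOne Y) ?_ ?_ f
  · simp [substOne_one, xD_one, h.one]
  · intro k f hf
    simp only [LinearMap.sub_apply, Module.End.mul_apply, sub_eq_zero] at hf ⊢
    rcases eq_or_ne k j with rfl | hkj
    · rw [xD_X_mul_self, map_add, map_add, map_smul, map_sum]
      simp only [h.substOne_X_mul, h.substOne_permOp]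
      rw [hf, h.self]
    · rw [xD_X_mul_of_ne β hkj, map_sub, map_smul, h.substOne_X_mul, h.substOne_X_mul,
        h.substOne_X_mul, h.substOne_permOp, hf, h.of_ne j k hkj]

/-- The analogue of the Cherednik operator. -/
def cherLike (β : ℕ) (T : Fin N → Op N) (j : Fin N) : Op N :=
  T j + (β : ℂ) • jucysMurphy (fun i : Fin N => (i : ℕ)) j

theorem DunklLike.substOne_cher (h : DunklLike β Y T) (j : Fin N) (f : Poly N) :
    substOne Y (cher β (fun i : Fin N => (i : ℕ)) j f) = cherLike β T j (substOne Y f) := by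
  rw [cher_apply, map_add, map_smul, h.substOne_xD, jucysMurphy_apply, map_sum]
  simp only [h.substOne_permOp]
  rw [← jucysMurphy_apply]
  rfl

theorem list_ofFn_prod_intertwine {m : ℕ} (S : Op N) {A B : Fin m → Op N}
    (h : ∀ i f, S (A i f) = B i (S f)) (f : Poly N) :
    S ((List.ofFn A).prod f) = (List.ofFn B).prod (S f) := by
  induction m with
  | zero => simp
  | succ m ih =>
    rw [List.ofFn_succ, List.ofFn_succ, List.prod_cons, List.prod_cons, Module.End.mul_apply,
      Module.End.mul_apply, h, ih fun i f => h _ f]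

theorem raising_intertwine (β m : ℕ) (S : Op N) {x x' D D' : Fin N → Op N}
    (hx : ∀ j f, S (x j f) = x' j (S f)) (hD : ∀ j f, S (D j f) = D' j (S f)) (f : Poly N) :
    S (raising β m x D f) = raising β m x' D' (S f) := by
  rw [raising, raising, LinearMap.sum_apply, LinearMap.sum_apply, map_sum]
  refine Finset.sum_congr rfl fun k _ => ?_
  rw [Module.End.mul_apply, Module.End.mul_apply, list_ofFn_prod_intertwine S fun i f => hx _ f,
    list_ofFn_prod_intertwine S (B := fun i : Fin m => D' (k i) +
      ((β : ℂ) * (((i : ℕ) : ℂ) + 1 - ((k i : ℕ) : ℂ))) • (1 : Op N))]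
  intro i f
  simp only [LinearMap.add_apply, LinearMap.smul_apply, Module.End.one_apply, map_add, map_smul, hD]

theorem DunklLike.substOne_raisingJ (h : DunklLike β Y T) (m : ℕ) (f : Poly N) :
    substOne Y (raisingJ N β m f) = raising β m Y (cherLike β T) (substOne Y f) :=
  raising_intertwine β m _ (fun j f => h.substOne_X_mul j f) (fun j f => h.substOne_cher j f) f

/-! ### Type `A` -/

theorem sqrtTwo_sq : sqrtTwo * sqrtTwo = 2 := by
  rw [sqrtTwo, ← Complex.ofReal_mul, Real.mul_self_sqrt (by norm_num)]; simp

theorem sqrtTwo_ne_zero : sqrtTwo ≠ 0 := fun h => by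
  have := sqrtTwo_sq
  rw [h] at this
  norm_num at this

theorem sqrtTwo_inv_sq : sqrtTwo⁻¹ * sqrtTwo⁻¹ = 2⁻¹ := by
  rw [← mul_inv, sqrtTwo_sq]

theorem creA_apply (β : ℕ) (j : Fin N) (f : Poly N) :
    creA β j f = sqrtTwo⁻¹ • ((2 : ℂ) • (X j * f) - dunklA β j f) := rfl

theorem annA_apply (β : ℕ) (j : Fin N) (f : Poly N) :
    annA β j f = sqrtTwo⁻¹ • dunklA β j f := rfl

theorem creA_comm (β : ℕ) (i j : Fin N) (f : Poly N) :
    creA β i (creA β j f) = creA β j (creA β i f) := by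
  rcases eq_or_ne i j with rfl | hij
  · rfl
  simp only [creA_apply, map_smul, map_sub]
  rw [dunklA_X_mul_of_ne β hij, dunklA_X_mul_of_ne β hij.symm, dunklA_comm β i j,
    Equiv.swap_comm j i, mul_left_comm]
  module

theorem annA_creA_of_ne (β : ℕ) {j k : Fin N} (h : k ≠ j) (f : Poly N) :
    annA β j (creA β k f) = creA β k (annA β j f) - (β : ℂ) • permOp (Equiv.swap j k) f := by
  simp only [creA_apply, annA_apply, map_smul, map_sub]
  rw [dunklA_X_mul_of_ne β h, dunklA_comm β j k]
  have := congrArg (fun c : ℂ => (2 * c) • (β : ℂ) • permOp (Equiv.swap j k) f) sqrtTwo_inv_sq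
  linear_combination (norm := skip) (-1 : ℂ) • this
  rw [show (2 * 2⁻¹ : ℂ) = 1 by norm_num]
  module

theorem annA_creA_self (β : ℕ) (j : Fin N) (f : Poly N) :
    annA β j (creA β j f) = creA β j (annA β j f) + f +
      (β : ℂ) • ∑ k with k ≠ j, permOp (Equiv.swap j k) f := by
  simp only [creA_apply, annA_apply, map_smul, map_sub]
  rw [dunklA_X_mul_self β]
  have := congrArg (fun c : ℂ => (2 * c) •
    (f + (β : ℂ) • ∑ k with k ≠ j, permOp (Equiv.swap j k) f)) sqrtTwo_inv_sq
  linear_combination (norm := skip) this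
  rw [show (2 * 2⁻¹ : ℂ) = 1 by norm_num]
  module

theorem permOp_creA (β : ℕ) (w : Equiv.Perm (Fin N)) (j : Fin N) (f : Poly N) :
    permOp w (creA β j f) = creA β (w j) (permOp w f) := by
  rw [creA_apply, creA_apply, map_smul, map_sub, map_smul, permOp_mul_apply, permOp_X,
    permOp_dunklA]

theorem dunklLike_A (β : ℕ) :
    DunklLike β (fun j : Fin N => creA β j) (fun j => creA β j * annA β j) where
  comm := creA_comm β
  perm := permOp_creA β
  one j := by simp [annA_apply, dunklA_one]
  of_ne j k h f := by
    simp only [Module.End.mul_apply]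
    rw [annA_creA_of_ne β h, map_sub, map_smul, creA_comm β j k]
  self j f := by
    simp only [Module.End.mul_apply]
    rw [annA_creA_self, map_add, map_add, map_smul, map_sum]

/-! ### Type `B` on even polynomials -/

/-- The operator `D^A_j - 1`. -/
def dunklM (β : ℕ) (j : Fin N) : Op N := dunklA β j - 1

theorem dunklM_apply (β : ℕ) (j : Fin N) (f : Poly N) : dunklM β j f = dunklA β j f - f := rfl

theorem dunklM_comm (β : ℕ) (i j : Fin N) (f : Poly N) :
    dunklM β i (dunklM β j f) = dunklM β j (dunklM β i f) := by
  simp only [dunklM_apply, map_sub]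
  rw [dunklA_comm β i j]
  abel

theorem dunklM_X_mul_of_ne (β : ℕ) {j k : Fin N} (h : k ≠ j) (f : Poly N) :
    dunklM β j (X k * f) = X k * dunklM β j f - (β : ℂ) • permOp (Equiv.swap j k) f := by
  rw [dunklM_apply, dunklM_apply, dunklA_X_mul_of_ne β h, mul_sub]
  abel

theorem dunklM_X_mul_self (β : ℕ) (j : Fin N) (f : Poly N) :
    dunklM β j (X j * f) = X j * dunklM β j f + f
      + (β : ℂ) • ∑ k with k ≠ j, permOp (Equiv.swap j k) f := by
  rw [dunklM_apply, dunklM_apply, dunklA_X_mul_self β, mul_sub]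
  abel

theorem permOp_dunklM (β : ℕ) (w : Equiv.Perm (Fin N)) (j : Fin N) (f : Poly N) :
    permOp w (dunklM β j f) = dunklM β (w j) (permOp w f) := by
  rw [dunklM_apply, dunklM_apply, map_sub, permOp_dunklA]

/-- The operator `(D^A_j - 1) x_j + c`. -/
def lagQ (β : ℕ) (c : ℂ) (j : Fin N) : Op N := dunklM β j * mulX j + c • 1

/-- The operator `(b̃†_j)² / 2` on even polynomials. -/
def lagY (β : ℕ) (c : ℂ) (j : Fin N) : Op N := lagQ β c j * dunklM β j

/-- The operator `b̃†_j b̃_j / 2` on even polynomials. -/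
def lagT (β : ℕ) (c : ℂ) (j : Fin N) : Op N := -(lagQ β c j * dunklA β j)

theorem lagQ_apply (β : ℕ) (c : ℂ) (j : Fin N) (f : Poly N) :
    lagQ β c j f = dunklM β j (X j * f) + c • f := rfl

theorem lagY_apply (β : ℕ) (c : ℂ) (j : Fin N) (f : Poly N) :
    lagY β c j f = dunklM β j (X j * dunklM β j f) + c • dunklM β j f := rfl

theorem lagY_eq (β : ℕ) (c : ℂ) (j : Fin N) (f : Poly N) :
    lagY β c j f = lagQ β c j (dunklM β j f) := rfl

theorem lagT_apply (β : ℕ) (c : ℂ) (j : Fin N) (f : Poly N) :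
    lagT β c j f = -lagQ β c j (dunklA β j f) := rfl

/-- As the operators `lagY` commute with each other, relations between `lagT` and `lagY` reduce to
relations between `lagQ` and `lagY`. -/
theorem lagT_eq (β : ℕ) (c : ℂ) (j : Fin N) (f : Poly N) :
    lagT β c j f = -(lagY β c j f + lagQ β c j f) := by
  rw [lagT_apply, show dunklA β j f = dunklM β j f + f by rw [dunklM_apply]; abel, map_add]
  rfl

theorem X_mul_dunklM_of_ne (β : ℕ) {j k : Fin N} (h : k ≠ j) (f : Poly N) :
    X k * dunklM β j f = dunklM β j (X k * f) + (β : ℂ) • permOp (Equiv.swap j k) f := by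
  rw [dunklM_X_mul_of_ne β h]; abel

theorem permOp_swap_X_mul (j k : Fin N) (f : Poly N) : permOp (Equiv.swap j k) (X k * f) =
    X j * permOp (Equiv.swap j k) f := by
  rw [permOp_mul_apply, permOp_X, Equiv.swap_apply_right]

theorem permOp_swap_dunklM (β : ℕ) (j k : Fin N) (f : Poly N) :
    permOp (Equiv.swap j k) (dunklM β k f) = dunklM β j (permOp (Equiv.swap j k) f) := by
  rw [permOp_dunklM, Equiv.swap_apply_right]

/-- The part of the exchange relation `lagQ_lagY_of_ne` that is free of the constant c. The variable
x_j is pushed inward past both operators at k; two of the transposition terms cancel and one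
survives. -/
theorem dunklM_X_dunklM_X (β : ℕ) {j k : Fin N} (h : k ≠ j) (f : Poly N) :
    dunklM β j (X j * dunklM β k (X k * dunklM β k f)) =
      dunklM β k (X k * dunklM β k (dunklM β j (X j * f))) +
      (β : ℂ) • dunklM β j (X j * dunklM β j (permOp (Equiv.swap j k) f)) := by
  have e1 : X j * dunklM β k (X k * dunklM β k f) =
      dunklM β k (X k * dunklM β k (X j * f)) + (β : ℂ) • dunklM β k (X k * permOp (Equiv.swap j k) f)
        + (β : ℂ) • (X j * dunklM β j (permOp (Equiv.swap j k) f)) := by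
    rw [X_mul_dunklM_of_ne β h.symm, mul_left_comm, X_mul_dunklM_of_ne β h.symm,
      Equiv.swap_comm k j, permOp_swap_X_mul, permOp_swap_dunklM, mul_add, map_add,
      mul_smul_comm, map_smul]
  have e2 : dunklM β j (X k * dunklM β k (X j * f)) =
      X k * dunklM β k (dunklM β j (X j * f)) - (β : ℂ) • dunklM β j (X k * permOp (Equiv.swap j k) f) := by
    rw [dunklM_X_mul_of_ne β h, permOp_swap_dunklM, dunklM_comm β j k, Equiv.swap_comm j k,
      permOp_swap_X_mul]
  rw [e1, map_add, map_add, map_smul, map_smul, dunklM_comm β j k (X k * _), e2, map_sub, map_smul,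
    dunklM_comm β j k]
  module

theorem lagQ_lagY_of_ne (β : ℕ) (c : ℂ) {j k : Fin N} (h : k ≠ j) (f : Poly N) :
    lagQ β c j (lagY β c k f) =
      lagY β c k (lagQ β c j f) + (β : ℂ) • lagY β c j (permOp (Equiv.swap j k) f) := by
  have e : dunklM β j (X j * dunklM β k f) = dunklM β k (dunklM β j (X j * f)) +
      (β : ℂ) • dunklM β j (permOp (Equiv.swap j k) f) := by
    rw [X_mul_dunklM_of_ne β h.symm, map_add, map_smul, dunklM_comm β j k, Equiv.swap_comm k j]
  simp only [lagQ_apply, lagY_apply, map_add, map_smul, smul_add]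
  rw [dunklM_X_dunklM_X β h, e]
  module

/-- Passing D_i - 1 through Y_j and then Q_i through Y_j yields two transposition terms of opposite
sign. -/
theorem lagY_comm (β : ℕ) (c : ℂ) (i j : Fin N) (f : Poly N) :
    lagY β c i (lagY β c j f) = lagY β c j (lagY β c i f) := by
  rcases eq_or_ne i j with rfl | hij
  · rfl
  have e : dunklM β i (lagY β c j f) = lagY β c j (dunklM β i f) -
      (β : ℂ) • dunklM β i (dunklM β j (permOp (Equiv.swap i j) f)) := by
    rw [lagY_apply, lagY_apply, map_add, map_smul, dunklM_comm β i j (X j * _),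
      dunklM_X_mul_of_ne β hij.symm, permOp_swap_dunklM, dunklM_comm β i j f, map_sub, map_smul,
      dunklM_comm β j i (permOp _ f)]
    abel
  rw [lagY_eq β c i (lagY β c j f), e, map_sub, map_smul, lagQ_lagY_of_ne β c hij.symm,
    ← lagY_eq β c i f, ← lagY_eq β c i (dunklM β j _), permOp_dunklM, Equiv.swap_apply_left]
  abel

theorem lagQ_lagY_self (β : ℕ) (c : ℂ) (j : Fin N) (f : Poly N) :
    lagQ β c j (lagY β c j f) + lagY β c j f +
      (β : ℂ) • ∑ k with k ≠ j, lagY β c j (permOp (Equiv.swap j k) f) =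
      lagY β c j (lagQ β c j f) := by
  have e : dunklM β j (lagQ β c j f) = lagQ β c j (dunklM β j f) + dunklM β j f +
      (β : ℂ) • ∑ k with k ≠ j, dunklM β j (permOp (Equiv.swap j k) f) := by
    rw [lagQ_apply, lagQ_apply, map_add, map_smul, dunklM_X_mul_self β, map_add, map_add, map_smul,
      map_sum]
    module
  simp only [lagY_eq]
  rw [e, map_add, map_add, map_smul, map_sum]

theorem permOp_lagQ (β : ℕ) (c : ℂ) (w : Equiv.Perm (Fin N)) (j : Fin N) (f : Poly N) :
    permOp w (lagQ β c j f) = lagQ β c (w j) (permOp w f) := by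
  rw [lagQ_apply, lagQ_apply, map_add, map_smul, permOp_dunklM, permOp_mul_apply, permOp_X]

theorem dunklLike_L (β : ℕ) (c : ℂ) :
    DunklLike β (fun j : Fin N => lagY β c j) (fun j => lagT β c j) where
  comm := lagY_comm β c
  perm w j f := by
    show permOp w (lagQ β c j (dunklM β j f)) = lagQ β c (w j) (dunklM β (w j) (permOp w f))
    rw [permOp_lagQ, permOp_dunklM]
  one j := by simp [lagT_apply, dunklA_one]
  of_ne j k h f := by
    rw [lagT_eq, lagT_eq, lagQ_lagY_of_ne β c h, lagY_comm β c j k, map_neg, map_add]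
    module
  self j f := by
    have := lagQ_lagY_self β c j f
    rw [lagT_eq, lagT_eq, map_neg, map_add, ← this]
    module

end Transport

/-! ### Type B operators on polynomials in the squares -/

section Even

variable {N : ℕ}

/-- The substitution `x_j ↦ z_j²`. -/
def sqOp : Op N := (expand 2).toLinearMap

theorem sqOp_mul (f g : Poly N) : sqOp (f * g) = sqOp f * sqOp g := map_mul (expand 2) f g

theorem sqOp_X (j : Fin N) : sqOp (X j : Poly N) = X j ^ 2 := expand_X _ _

theorem sqOp_one : sqOp (1 : Poly N) = 1 := map_one (expand 2)

theorem sqOp_mSym (μ : Fin N → ℕ) : sqOp (mSym μ) = mSymSq μ := rfl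

theorem pderiv_sqOp (j : Fin N) (f : Poly N) :
    pderiv j (sqOp f) = (2 : ℂ) • (X j * sqOp (pderiv j f)) := by
  induction f using MvPolynomial.induction_on with
  | C a =>
    have : sqOp (C a : Poly N) = C a := expand_C _ _
    rw [this, pderiv_C, map_zero, mul_zero, smul_zero]
  | add p q hp hq => rw [map_add, map_add, hp, hq, map_add, map_add, mul_add, smul_add]
  | mul_X p i hp =>
    rw [sqOp_mul, Derivation.leibniz, hp, Derivation.leibniz, map_add, smul_eq_mul, smul_eq_mul,
      smul_eq_mul, smul_eq_mul, sqOp_mul, sqOp_mul, sqOp_X, pderiv_pow, pderiv_X]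
    rcases eq_or_ne i j with rfl | h
    · simp only [Pi.single_eq_same, sqOp_one, smul_eq_C_mul, map_ofNat]
      push_cast
      ring
    · simp only [Pi.single_eq_of_ne h, map_zero, smul_eq_C_mul]
      ring

theorem sRefl_sqOp (j k : Fin N) (f : Poly N) :
    sRefl j k (sqOp f) = sqOp (permOp (Equiv.swap j k) f) := rename_expand _ _ _

theorem tRefl_sqOp (j : Fin N) (f : Poly N) : tRefl j (sqOp f) = sqOp f := by
  have : (tRefl j).comp (expand 2) = expand 2 := by
    ext1 i
    by_cases h : i = j <;> simp [tRefl, h]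
  exact DFunLike.congr_fun this f

theorem ttsRefl_sqOp (j k : Fin N) (f : Poly N) :
    ttsRefl j k (sqOp f) = sqOp (permOp (Equiv.swap j k) f) := by
  rw [ttsRefl, AlgHom.comp_apply, AlgHom.comp_apply, sRefl_sqOp, tRefl_sqOp, tRefl_sqOp]

theorem X_add_X_ne_zero (j k : Fin N) : (X j + X k : Poly N) ≠ 0 := fun h => by
  have := congrArg (eval fun _ => (1 : ℂ)) h
  norm_num at this

theorem ttsRefl_X {j k : Fin N} (h : k ≠ j) : ttsRefl j k (X j : Poly N) = -X k := by
  simp [ttsRefl, sRefl, tRefl, h]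

theorem dunklB_apply (β : ℕ) (γ : ℝ) (j : Fin N) (f : Poly N) :
    dunklB β γ j f = pderiv j f + (β : ℂ) • ∑ k : {k : Fin N // k ≠ j},
        (divDiff (X j - X k.1) (sRefl j k.1) (sRefl_dvd j k.1) f
          + divDiff (X j + X k.1) (ttsRefl j k.1) (ttsRefl_dvd j k.1 k.2) f) +
      (γ : ℂ) • divDiff (X j) (tRefl j) (tRefl_dvd j) f := by
  simp [dunklB, ddx]

theorem divDiff_eq {l q : Poly N} {r : Poly N →ₐ[ℂ] Poly N} (h : ∀ f, l ∣ f - r f) (hl : l ≠ 0)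
    {f : Poly N} (e : l * q = f - r f) : divDiff l r h f = q :=
  mul_left_cancel₀ hl (by rw [mul_divDiff l r h hl, e])

theorem sum_subtype_ne (j : Fin N) (F : Fin N → Poly N) :
    ∑ k : {k : Fin N // k ≠ j}, F k = ∑ k with k ≠ j, F k :=
  (Finset.sum_subtype _ (by simp) F).symm

theorem sq_sub_sq_mul_divA {j k : Fin N} (h : k ≠ j) (f : Poly N) :
    (X j - X k) * ((X j + X k) * sqOp (divA j k f)) =
      sqOp f - sqOp (permOp (Equiv.swap j k) f) := by
  rw [← map_sub, ← mul_divA h.symm, sqOp_mul, map_sub, sqOp_X, sqOp_X]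
  ring

/-- On even polynomials both reflections act as s_jk, and the two divided differences add up with
numerators z_j + z_k and z_j - z_k. The sign changes act trivially, so γ does not enter here. -/
theorem dunklB_sqOp (β : ℕ) (γ : ℝ) (j : Fin N) (f : Poly N) :
    dunklB β γ j (sqOp f) = (2 : ℂ) • (X j * sqOp (dunklA β j f)) := by
  have h1 : ∀ k : {k : Fin N // k ≠ j},
      divDiff (X j - X k.1) (sRefl j k.1) (sRefl_dvd j k.1) (sqOp f)
          + divDiff (X j + X k.1) (ttsRefl j k.1) (ttsRefl_dvd j k.1 k.2) (sqOp f) =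
        (2 : ℂ) • (X j * sqOp (divA j k.1 f)) := by
    rintro ⟨k, hk⟩
    rw [divDiff_eq (sRefl_dvd j k) (X_sub_X_ne_zero hk.symm)
        (q := (X j + X k) * sqOp (divA j k f)),
      divDiff_eq (ttsRefl_dvd j k hk) (X_add_X_ne_zero j k) (q := (X j - X k) * sqOp (divA j k f))]
    · simp only [smul_eq_C_mul, map_ofNat]
      ring
    · rw [ttsRefl_sqOp, ← sq_sub_sq_mul_divA hk]
      ring
    · rw [sRefl_sqOp, sq_sub_sq_mul_divA hk]
  have h2 : divDiff (X j) (tRefl j) (tRefl_dvd j) (sqOp f) = 0 :=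
    divDiff_eq _ (X_ne_zero j) (by rw [tRefl_sqOp, mul_zero, sub_self])
  rw [dunklB_apply, h2, Finset.sum_congr rfl fun k _ => h1 k,
    sum_subtype_ne j fun k => (2 : ℂ) • (X j * sqOp (divA j k f)), pderiv_sqOp, dunklA_apply,
    map_add, map_smul, map_sum, ← Finset.smul_sum, ← Finset.mul_sum, smul_zero, add_zero, mul_add,
    mul_smul_comm]
  module

/-- The creation operator b̃†_j maps even polynomials to z_j times even ones and back; this is the
second half, where (1 - t_j)/z_j contributes 2γ. Together with the 1 from ∂z_j it leads to the
constant γ - 1/2 in `lagQ`. -/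
theorem dunklB_X_mul_sqOp (β : ℕ) (γ : ℝ) (j : Fin N) (f : Poly N) :
    dunklB β γ j (X j * sqOp f) = sqOp ((2 : ℂ) • xD β j f + (1 + 2 * (γ : ℂ)) • f +
      (2 * (β : ℂ)) • ∑ k with k ≠ j, permOp (Equiv.swap j k) f) := by
  have h1 : ∀ k : {k : Fin N // k ≠ j},
      divDiff (X j - X k.1) (sRefl j k.1) (sRefl_dvd j k.1) (X j * sqOp f)
          + divDiff (X j + X k.1) (ttsRefl j k.1) (ttsRefl_dvd j k.1 k.2) (X j * sqOp f) =
        sqOp ((2 : ℂ) • (X j * divA j k.1 f + permOp (Equiv.swap j k.1) f)) := by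
    rintro ⟨k, hk⟩
    apply mul_left_cancel₀ (X_add_X_ne_zero j k)
    apply mul_left_cancel₀ (X_sub_X_ne_zero hk.symm)
    have e1 := mul_divDiff _ _ (sRefl_dvd j k) (X_sub_X_ne_zero hk.symm) (X j * sqOp f)
    have e2 := mul_divDiff _ _ (ttsRefl_dvd j k hk) (X_add_X_ne_zero j k) (X j * sqOp f)
    rw [map_mul (sRefl j k), sRefl_sqOp, show sRefl j k (X j) = (X k : Poly N) by simp [sRefl]] at e1
    rw [map_mul (ttsRefl j k), ttsRefl_sqOp, ttsRefl_X hk] at e2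
    have e3 := sq_sub_sq_mul_divA hk f
    simp only [map_smul, map_add, sqOp_mul, sqOp_X]
    simp only [smul_eq_C_mul, map_ofNat]
    linear_combination (X j + X k) * e1 + (X j - X k) * e2 - 2 * X j ^ 2 * e3
  have h2 : divDiff (X j) (tRefl j) (tRefl_dvd j) (X j * sqOp f) = sqOp ((2 : ℂ) • f) := by
    refine divDiff_eq _ (X_ne_zero j) ?_
    rw [map_mul, tRefl_sqOp, show tRefl j (X j) = (-X j : Poly N) by simp [tRefl], map_smul,
      smul_eq_C_mul, map_ofNat]
    ring
  rw [dunklB_apply, h2, Finset.sum_congr rfl fun k _ => h1 k,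
    sum_subtype_ne j fun k => sqOp ((2 : ℂ) • (X j * divA j k f + permOp (Equiv.swap j k) f)),
    ← map_sum, ← Finset.smul_sum, Finset.sum_add_distrib, ← Finset.mul_sum, Derivation.leibniz,
    pderiv_sqOp, pderiv_X_self, xD_apply, dunklA_apply]
  simp only [map_add, map_smul, sqOp_mul, sqOp_X, smul_eq_mul, mul_one]
  simp only [smul_eq_C_mul, map_ofNat, map_mul, map_one, map_add]
  ring

theorem creB_sqOp (β : ℕ) (γ : ℝ) (j : Fin N) (f : Poly N) :
    creB β γ j (sqOp f) = (-(2 * sqrtTwo⁻¹)) • (X j * sqOp (dunklM β j f)) := by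
  have : creB β γ j (sqOp f) = sqrtTwo⁻¹ • ((2 : ℂ) • (X j * sqOp f) - dunklB β γ j (sqOp f)) := rfl
  rw [this, dunklB_sqOp, dunklM_apply, map_sub, mul_sub]
  module

theorem creB_X_mul_sqOp (β : ℕ) (γ : ℝ) (j : Fin N) (f : Poly N) :
    creB β γ j (X j * sqOp f) = (-(2 * sqrtTwo⁻¹)) • sqOp (lagQ β (γ - 2⁻¹) j f) := by
  have : creB β γ j (X j * sqOp f) =
    sqrtTwo⁻¹ • ((2 : ℂ) • (X j * (X j * sqOp f)) - dunklB β γ j (X j * sqOp f)) := rfl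
  rw [this, dunklB_X_mul_sqOp, lagQ_apply, dunklM_X_mul_self, dunklM_apply, xD_apply,
    show (X j * (X j * sqOp f) : Poly N) = sqOp (X j * f) by rw [sqOp_mul, sqOp_X]; ring]
  simp only [map_add, map_sub, map_smul, mul_sub]
  module

theorem smul_creB_sq_sqOp (β : ℕ) (γ : ℝ) (j : Fin N) (f : Poly N) :
    ((2 : ℂ)⁻¹ • creB β γ j ^ 2) (sqOp f) = sqOp (lagY β (γ - 2⁻¹) j f) := by
  have e : ((2 : ℂ)⁻¹ • creB β γ j ^ 2) (sqOp f) =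
    (2 : ℂ)⁻¹ • creB β γ j (creB β γ j (sqOp f)) := rfl
  rw [e, creB_sqOp, map_smul, creB_X_mul_sqOp, smul_smul, smul_smul, ← lagY_eq]
  rw [show (2 : ℂ)⁻¹ * -(2 * sqrtTwo⁻¹) * -(2 * sqrtTwo⁻¹) = 2 * (sqrtTwo⁻¹ * sqrtTwo⁻¹) by ring,
    sqrtTwo_inv_sq, mul_inv_cancel₀ two_ne_zero, one_smul]

/-- The factor 1/2 absorbs the doubling of the transpositions, as s_jk and t_j t_k s_jk agree on
even polynomials. -/
theorem smul_hB_sqOp (β : ℕ) (γ : ℝ) (j : Fin N) (f : Poly N) :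
    ((2 : ℂ)⁻¹ • hB β γ j) (sqOp f) =
      sqOp (cherLike β (fun j => lagT β (γ - 2⁻¹) j) j f) := by
  have e : ((2 : ℂ)⁻¹ • hB β γ j) (sqOp f) = (2 : ℂ)⁻¹ • (creB β γ j (sqrtTwo⁻¹ •
      dunklB β γ j (sqOp f)) + (β : ℂ) • ∑ k with k < j,
        (sRefl j k (sqOp f) + ttsRefl j k (sqOp f))) := by
    simp [hB, annB, Finset.sum_add_distrib]
  have e2 : cherLike β (fun j => lagT β (γ - 2⁻¹) j) j f =
      lagT β (γ - 2⁻¹) j f + (β : ℂ) • ∑ k with k < j, permOp (Equiv.swap j k) f := by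
    simp [cherLike, jucysMurphy]
  rw [e, e2, dunklB_sqOp, smul_smul, map_smul, creB_X_mul_sqOp, lagT_apply, smul_smul]
  simp only [sRefl_sqOp, ttsRefl_sqOp, ← two_smul ℂ, ← Finset.smul_sum, ← map_sum]
  rw [show sqrtTwo⁻¹ * 2 * -(2 * sqrtTwo⁻¹) = -4 * (sqrtTwo⁻¹ * sqrtTwo⁻¹) by ring, sqrtTwo_inv_sq,
    map_add, map_neg, map_smul]
  module

theorem pow_intertwine (S : Op N) {A B : Op N} (h : ∀ f, S (A f) = B (S f)) (n : ℕ) (f : Poly N) :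
    S ((A ^ n) f) = (B ^ n) (S f) := by
  induction n generalizing f with
  | zero => rfl
  | succ n ih => rw [pow_succ, pow_succ, Module.End.mul_apply, Module.End.mul_apply, ih, h]

theorem sigmaB_eq (β : ℕ) (γ : ℝ) (f : Poly N) :
    sigmaB N β γ f = sqOp (substOne (fun j => lagY β (γ - 2⁻¹) j) f) := by
  induction f using MvPolynomial.induction_on' with
  | monomial b a =>
    rw [← mul_one a, ← smul_eq_mul, ← smul_monomial, map_smul, map_smul, map_smul, sigmaB,
      substOne_monomial, substOne_monomial, list_ofFn_prod_intertwine sqOp fun i f =>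
        pow_intertwine sqOp (fun f => (smul_creB_sq_sqOp β γ i f).symm) (b i) f, sqOp_one]
  | add p q hp hq => rw [map_add, map_add, map_add, hp, hq]

theorem raisingL_sqOp (β : ℕ) (γ : ℝ) (m : ℕ) (f : Poly N) :
    raisingL N β γ m (sqOp f) = sqOp (raising β m (fun j => lagY β (γ - 2⁻¹) j)
      (cherLike β fun j => lagT β (γ - 2⁻¹) j) f) :=
  (raising_intertwine β m sqOp (fun j f => (smul_creB_sq_sqOp β γ j f).symm)
    (fun j f => (smul_hB_sqOp β γ j f).symm) f).symm

theorem sigmaA_raisingJ (β m : ℕ) (f : Poly N) :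
    sigmaA N β (raisingJ N β m f) = raisingH N β m (sigmaA N β f) :=
  (dunklLike_A β).substOne_raisingJ m f

theorem sigmaB_raisingJ (β : ℕ) (γ : ℝ) (m : ℕ) (f : Poly N) :
    sigmaB N β γ (raisingJ N β m f) = raisingL N β γ m (sigmaB N β γ f) := by
  rw [sigmaB_eq, sigmaB_eq, raisingL_sqOp, (dunklLike_L β (γ - 2⁻¹)).substOne_raisingJ]

end Even

/-! ### Lower order deformations, triangularity of `substOne` and orthogonality -/

section Deformation

variable {N : ℕ}

/-- The polynomials of degree less than `n`. -/
def degLT (N n : ℕ) : Submodule ℂ (Poly N) := restrictSupport ℂ {b | b.degree < n}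

theorem degLT_mono {m n : ℕ} (h : m ≤ n) : degLT N m ≤ degLT N n :=
  restrictSupport_mono ℂ fun _ hb => lt_of_lt_of_le hb h

theorem degLT_zero {f : Poly N} (hf : f ∈ degLT N 0) : f = 0 := by
  ext b
  exact coeff_eq_zero_of_mem hf (Nat.not_lt_zero _)

theorem exists_mem_degLT (f : Poly N) : ∃ n, f ∈ degLT N n := by
  refine ⟨f.totalDegree + 1, fun b hb => Nat.lt_succ_of_le ?_⟩
  rw [Finsupp.degree_eq_sum, ← Finsupp.sum_fintype b (fun _ n => n) fun _ => rfl]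
  exact le_totalDegree hb

theorem Move.degree_le {b c : Fin N →₀ ℕ} (h : Move b c) : c.degree ≤ b.degree := by
  obtain ⟨j, k, h, hsum, hj, hk⟩ := h
  rw [Finsupp.degree_eq_sum, Finsupp.degree_eq_sum]
  rcases eq_or_ne j k with rfl | hjk
  · refine Finset.sum_le_sum fun i _ => ?_
    rcases eq_or_ne i j with rfl | hi
    · simpa using hj
    · exact (h i hi hi).le
  · rw [← Finset.add_sum_erase _ _ (Finset.mem_univ j), ← Finset.add_sum_erase _ (⇑b)
      (Finset.mem_univ j), ← Finset.add_sum_erase _ _ (Finset.mem_erase.2 ⟨hjk.symm,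
      Finset.mem_univ k⟩), ← Finset.add_sum_erase _ (⇑b) (Finset.mem_erase.2 ⟨hjk.symm,
      Finset.mem_univ k⟩), ← add_assoc, ← add_assoc]
    refine add_le_add hsum (Finset.sum_le_sum fun i hi => ?_)
    simp only [Finset.mem_erase, Finset.mem_univ, and_true] at hi
    exact (h i hi.2 hi.1).le

theorem moveStable_degree_lt (n : ℕ) : MoveStable {b : Fin N →₀ ℕ | b.degree < n} :=
  fun _ hb _ hc => lt_of_le_of_lt hc.degree_le hb

theorem X_mul_mem_degLT (j : Fin N) {n : ℕ} {f : Poly N} (hf : f ∈ degLT N n) :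
    X j * f ∈ degLT N (n + 1) := by
  refine map_mem_restrictSupport (mulX j) (fun b hb => ?_) hf
  have : mulX j (monomial b (1 : ℂ)) = monomial (Finsupp.single j 1 + b) 1 := by
    simp [mulX, X, monomial_mul]
  rw [this]
  refine monomial_mem ?_ _
  rw [Set.mem_ofPred_eq, map_add, Finsupp.degree_single, add_comm]
  exact Nat.succ_lt_succ hb

/-- Lower order deformations of the operators `α x_j`, `x_j D^A_j`. -/
structure Deformed (β : ℕ) (α : ℂ) (Y T : Fin N → Op N) : Prop extends DunklLike β Y T where
  ne_zero : α ≠ 0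
  sub_mem : ∀ j n f, f ∈ degLT N n → Y j f - α • (X j * f) ∈ degLT N n
  xD_sub_mem : ∀ j (S : Set (Fin N →₀ ℕ)), MoveStable S → ∀ f ∈ restrictSupport ℂ S,
    xD β j f - T j f ∈ restrictSupport ℂ S
  xD_sub_mem_degLT : ∀ j n f, f ∈ degLT N (n + 1) → xD β j f - T j f ∈ degLT N n

variable {β : ℕ} {α : ℂ} {Y T : Fin N → Op N}

theorem Deformed.substOne_monomial_sub_mem (h : Deformed β α Y T) (n : ℕ) (b : Fin N →₀ ℕ)
    (hb : b.degree = n) :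
    substOne Y (monomial b 1) - α ^ n • monomial b 1 ∈ degLT N n := by
  induction n generalizing b with
  | zero =>
    rw [Finsupp.degree_eq_zero_iff] at hb
    subst hb
    have : (monomial 0 1 : Poly N) = 1 := rfl
    rw [this, substOne_one, pow_zero, one_smul, sub_self]
    exact Submodule.zero_mem _
  | succ n ih =>
    obtain ⟨j, hj⟩ : ∃ j, b j ≠ 0 := by
      by_contra! h0
      have : b = 0 := Finsupp.ext h0
      rw [this, map_zero] at hb
      exact absurd hb (Nat.succ_ne_zero n).symm
    obtain ⟨c, rfl⟩ : ∃ c, b = Finsupp.single j 1 + c :=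
      ⟨b - Finsupp.single j 1, (add_tsub_cancel_of_le (by
        rw [Finsupp.single_le_iff]; exact Nat.one_le_iff_ne_zero.2 hj)).symm⟩
    have hc : c.degree = n := by
      rw [map_add, Finsupp.degree_single] at hb
      lia
    have e : (monomial (Finsupp.single j 1 + c) 1 : Poly N) = X j * monomial c 1 := by
      rw [X, monomial_mul, one_mul]
    rw [e, h.substOne_X_mul]
    set g : Poly N := monomial c 1 with hg
    have hgn : g ∈ degLT N (n + 1) := monomial_mem (Nat.lt_succ_of_le hc.le) _
    have h1 := ih c hc
    rw [← hg] at h1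
    have h2 : substOne Y g ∈ degLT N (n + 1) := by
      rw [← sub_add_cancel (substOne Y g) (α ^ n • g)]
      exact Submodule.add_mem _ (degLT_mono n.le_succ h1) (Submodule.smul_mem _ _ hgn)
    have h3 := Submodule.add_mem _ (h.sub_mem j _ _ h2) (Submodule.smul_mem _ α (X_mul_mem_degLT j h1))
    convert h3 using 1
    rw [mul_sub, mul_smul_comm, pow_succ]
    module

theorem Deformed.substOne_sub_mem (h : Deformed β α Y T) (n : ℕ) {f : Poly N}
    (hf : f ∈ degLT N (n + 1)) : substOne Y f - α ^ n • f ∈ degLT N n := by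
  refine map_mem_restrictSupport (substOne Y - α ^ n • (1 : Op N)) (fun b hb => ?_) hf
  show substOne Y (monomial b 1) - α ^ n • monomial b 1 ∈ degLT N n
  rcases (Nat.lt_succ_iff.1 hb).lt_or_eq with hlt | heq
  · have hbn : (monomial b 1 : Poly N) ∈ degLT N n := monomial_mem hlt _
    refine Submodule.sub_mem _ ?_ (Submodule.smul_mem _ _ hbn)
    rw [← sub_add_cancel (substOne Y _) (α ^ b.degree • monomial b 1)]
    exact Submodule.add_mem _ (degLT_mono hlt.le (h.substOne_monomial_sub_mem _ b rfl))
      (Submodule.smul_mem _ _ hbn)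
  · exact h.substOne_monomial_sub_mem n b heq

/-- In top degree n the map is multiplication by α^n ≠ 0, so the degree of an element of the kernel
can be lowered indefinitely. -/
theorem Deformed.eq_zero_of_substOne (h : Deformed β α Y T) {f : Poly N}
    (hf : substOne Y f = 0) : f = 0 := by
  obtain ⟨n, hn⟩ := exists_mem_degLT f
  induction n with
  | zero => exact degLT_zero hn
  | succ n ih =>
    have := h.substOne_sub_mem n hn
    rw [hf, zero_sub, Submodule.neg_mem_iff,
      Submodule.smul_mem_iff _ (pow_ne_zero _ h.ne_zero)] at this
    exact ih this

/-- The sum of the x_j D_j is the Euler operator plus transposition terms. Transporting this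
identity and subtracting it from the one at `substOne Y f` removes the transpositions. -/
theorem Deformed.euler_substOne (h : Deformed β α Y T) {d : ℕ} {f : Poly N}
    (hf : euler N f = (d : ℂ) • f) : euler N (substOne Y f) - (d : ℂ) • substOne Y f =
      ∑ j, (xD β j (substOne Y f) - T j (substOne Y f)) := by
  have e1 := congrArg (substOne Y) (sum_xD β (κ := fun i : Fin N => (i : ℕ)) Fin.val_injective f)
  have e2 := sum_xD β (κ := fun i : Fin N => (i : ℕ)) Fin.val_injective (substOne Y f)
  rw [← euler_apply] at e1 e2
  simp only [map_sum, map_add, map_smul, map_sub, h.substOne_xD, h.substOne_permOp, hf] at e1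
  rw [Finset.sum_sub_distrib, e1, e2]
  abel

/-- The operators Y_j raise the degree and so need not preserve S. Instead the homogeneous
components of the image g are found by descending degree: by `Deformed.euler_substOne`, (n - d)
times the component of degree n comes from components of higher degree through x_j D_j - T_j, which
preserves S. -/
theorem Deformed.substOne_monomial_mem (h : Deformed β α Y T) {S : Set (Fin N →₀ ℕ)}
    (hS : MoveStable S) {b : Fin N →₀ ℕ} (hb : b ∈ S) :
    substOne Y (monomial b 1) ∈ restrictSupport ℂ S := by
  set g := substOne Y (monomial b (1 : ℂ)) with hg
  set d := b.degree with hd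
  have hbase : g ∈ restrictSupport ℂ (S ∪ {c | c.degree < d}) := by
    rw [← sub_add_cancel g (α ^ d • monomial b 1)]
    exact Submodule.add_mem _ (restrictSupport_mono ℂ Set.subset_union_right
      (h.substOne_monomial_sub_mem d b rfl)) (Submodule.smul_mem _ _ (monomial_mem (Or.inl hb) _))
  have hE := h.euler_substOne (euler_eq_smul_iff.2 (monomial_mem (S := {c | c.degree = d})
    (b := b) rfl 1))
  rw [← hg] at hE
  -- One step of the descent: if all terms outside S have degree at most n, then none has degree n,
  -- since n - d ≠ 0.
  have step : ∀ n < d, g ∈ restrictSupport ℂ (S ∪ {c | c.degree < n + 1}) →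
      g ∈ restrictSupport ℂ (S ∪ {c | c.degree < n}) := by
    intro n hn hgn c hc
    have hM : euler N g - (d : ℂ) • g ∈ restrictSupport ℂ (S ∪ {c | c.degree < n}) := by
      rw [hE]
      refine Submodule.sum_mem _ fun j _ => ?_
      refine map_mem_restrictSupport (xD β j - T j) (fun a ha => ?_) hgn
      rcases ha with ha | ha
      · exact restrictSupport_mono ℂ Set.subset_union_left
          (h.xD_sub_mem j S hS _ (monomial_mem ha _))
      · exact restrictSupport_mono ℂ Set.subset_union_right
          (h.xD_sub_mem_degLT j n _ (monomial_mem ha _))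
    by_contra hcS
    have h0 := coeff_eq_zero_of_mem hM hcS
    rw [coeff_sub, coeff_euler, coeff_smul, smul_eq_mul, ← sub_mul] at h0
    have hc' : coeff c g ≠ 0 := mem_support_iff.1 hc
    have hcd : c.degree = d := by
      have := (mul_eq_zero.1 h0).resolve_right hc'
      exact_mod_cast sub_eq_zero.1 this
    rcases hgn hc with h1 | h1
    · exact hcS (Or.inl h1)
    · have : c.degree < n + 1 := h1
      lia
  have hall : ∀ n ≤ d, g ∈ restrictSupport ℂ (S ∪ {c | c.degree < d - n}) := by
    intro n
    induction n with
    | zero => exact fun _ => hbase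
    | succ n ih =>
      intro hn
      refine step _ (by lia) ?_
      rw [show d - (n + 1) + 1 = d - n by lia]
      exact ih (by lia)
  have := hall d le_rfl
  rw [Nat.sub_self] at this
  convert this using 2
  simp

theorem Deformed.substOne_mem (h : Deformed β α Y T) {S : Set (Fin N →₀ ℕ)}
    (hS : MoveStable S) {f : Poly N} (hf : f ∈ restrictSupport ℂ S) :
    substOne Y f ∈ restrictSupport ℂ S :=
  map_mem_restrictSupport _ (fun _ hb => h.substOne_monomial_mem hS hb) hf

theorem Deformed.substOne_mem_symPoly (h : Deformed β α Y T) {f : Poly N} (hf : f ∈ symPoly N) :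
    substOne Y f ∈ symPoly N := fun w => by rw [← h.substOne_permOp, hf w]

theorem Deformed.exists_substOne_eq (h : Deformed β α Y T) {lam : Fin N → ℕ} {r : Poly N}
    (hr : r ∈ symLT lam) : ∃ q ∈ symLT lam, substOne Y q = r := by
  have hmap : ∀ f ∈ symLT lam, substOne Y f ∈ symLT lam := fun f hf =>
    ⟨h.substOne_mem (moveStable_domLT lam) hf.1, h.substOne_mem_symPoly hf.2⟩
  have hinj : Function.Injective (LinearMap.restrict _ hmap) := by
    rw [injective_iff_map_eq_zero]
    rintro ⟨f, hf⟩ h0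
    exact Subtype.ext (h.eq_zero_of_substOne (congrArg Subtype.val h0))
  obtain ⟨⟨q, hq⟩, e⟩ := LinearMap.surjective_of_injective hinj ⟨r, hr⟩
  exact ⟨q, hq, congrArg Subtype.val e⟩

/-- The Jack polynomial is homogeneous of degree |λ|, so the terms of lower degree do not disturb
the coefficient at λ. -/
theorem Deformed.substOne_jack_sub_mem (h : Deformed β α Y T) {lam : Fin N → ℕ}
    (hlam : Antitone lam) {f : Poly N} (hf : IsJack β lam f) :
    substOne Y f - α ^ (∑ i, lam i) • mSym lam ∈ symLT lam := by
  have hdeg : (toExp lam).degree = ∑ i, lam i := Finsupp.degree_eq_sum _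
  refine mem_symLT (Submodule.sub_mem _ (h.substOne_mem (moveStable_domLE lam)
    (hf.mem_domLE hlam)) (Submodule.smul_mem _ _ (mSym_mem_domLE hlam)))
    (Submodule.sub_mem _ (h.substOne_mem_symPoly hf.mem_symPoly)
      (Submodule.smul_mem _ _ (mSym_mem_symPoly lam))) ?_
  have h1 := h.substOne_sub_mem (∑ i, lam i) (f := f) (fun b hb => by
    have : b.degree = ∑ i, lam i := mem_of_mem_support (euler_eq_smul_iff.1 hf.euler_eq) hb
    exact Nat.lt_succ_of_le this.le)
  have h2 := coeff_eq_zero_of_mem h1 (b := toExp lam) (by simp [hdeg])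
  rw [coeff_sub, coeff_smul, hf.coeff_self] at h2
  rw [coeff_sub, coeff_smul, coeff_mSym_self, h2]

/-- The analogue of `casimir`. -/
def casimirLike (β : ℕ) (T : Fin N → Op N) : Op N := ∑ j, cherLike β T j ^ 2

theorem casimirLike_apply (β : ℕ) (T : Fin N → Op N) (f : Poly N) :
    casimirLike β T f = ∑ j, cherLike β T j (cherLike β T j f) := by
  simp [casimirLike, pow_two]

theorem DunklLike.substOne_casimir (h : DunklLike β Y T) (f : Poly N) :
    substOne Y (casimir β f) = casimirLike β T (substOne Y f) := by
  rw [casimir_apply, casimirLike_apply, map_sum]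
  simp only [h.substOne_cher]

/-- A bilinear form for which the operators `T_j` and the transpositions are symmetric and which is
nondegenerate on the spaces `symLT lam`. -/
structure GoodForm (B : Poly N →ₗ[ℂ] Poly N →ₗ[ℂ] ℂ) (T : Fin N → Op N) : Prop where
  symm_T : ∀ j f g, B (T j f) g = B f (T j g)
  symm_swap : ∀ j k f g, B (permOp (Equiv.swap j k) f) g = B f (permOp (Equiv.swap j k) g)
  nondeg : ∀ lam, ∀ f ∈ symLT lam, (∀ g ∈ symLT lam, B f g = 0) → f = 0

variable {B : Poly N →ₗ[ℂ] Poly N →ₗ[ℂ] ℂ}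

theorem GoodForm.symm_cherLike (hB : GoodForm B T) (j : Fin N) (f g : Poly N) :
    B (cherLike β T j f) g = B f (cherLike β T j g) := by
  simp only [cherLike, LinearMap.add_apply, LinearMap.smul_apply, jucysMurphy_apply, map_add,
    map_smul, map_sum, LinearMap.sum_apply, hB.symm_T, hB.symm_swap]

theorem GoodForm.symm_casimirLike (hB : GoodForm B T) (f g : Poly N) :
    B (casimirLike β T f) g = B f (casimirLike β T g) := by
  simp only [casimirLike_apply, map_sum, LinearMap.sum_apply, hB.symm_cherLike]

/-- The orthogonal polynomials with leading term `m_lam`. -/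
structure IsOrth (B : Poly N →ₗ[ℂ] Poly N →ₗ[ℂ] ℂ) (lam : Fin N → ℕ) (p : Poly N) : Prop where
  sub_mem : p - mSym lam ∈ symLT lam
  orth : ∀ g ∈ symLT lam, B p g = 0

theorem GoodForm.unique (hB : GoodForm B T) {lam : Fin N → ℕ} {p q : Poly N} (hp : IsOrth B lam p)
    (hq : IsOrth B lam q) : p = q := by
  rw [← sub_eq_zero]
  refine hB.nondeg lam _ ?_ fun g hg => ?_
  · have := Submodule.sub_mem _ hp.sub_mem hq.sub_mem
    rwa [sub_sub_sub_cancel_right] at this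
  · rw [map_sub, LinearMap.sub_apply, hp.orth g hg, hq.orth g hg, sub_zero]

/-- An element below λ is the image of some (C - E) q, with C the Casimir and E the eigenvalue of λ.
Moving the transported operator to the other argument, where it meets its eigenvector, gives 0. No
separation of the eigenvalues of different partitions is needed. -/
theorem Deformed.isOrth (h : Deformed β α Y T) (hB : GoodForm B T) {lam : Fin N → ℕ}
    (hlam : Antitone lam) {f : Poly N} (hf : IsJack β lam f) :
    IsOrth B lam ((α ^ (∑ i, lam i))⁻¹ • substOne Y f) where
  sub_mem := by
    have := Submodule.smul_mem _ (α ^ (∑ i, lam i))⁻¹ (h.substOne_jack_sub_mem hlam hf)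
    rwa [smul_sub, inv_smul_smul₀ (pow_ne_zero _ h.ne_zero)] at this
  orth g hg := by
    obtain ⟨r, hr, rfl⟩ := h.exists_substOne_eq hg
    obtain ⟨q, -, rfl⟩ := exists_casimir_sub_eq β hr
    rw [map_smul, LinearMap.smul_apply, map_sub, map_smul, h.substOne_casimir, map_sub, map_smul,
      ← hB.symm_casimirLike, ← h.substOne_casimir, hf.casimir_eq, map_smul, map_smul,
      LinearMap.smul_apply, sub_self, smul_zero]

theorem sum_addOnes {m : ℕ} (hm : m ≤ N) (lam : Fin N → ℕ) :
    ∑ i, addOnes m lam i = ∑ i, lam i + m := by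
  simp only [addOnes]
  rw [Finset.sum_add_distrib]
  congr 1
  rw [← Finset.card_filter, Fin.card_filter_val_lt, min_eq_right hm]

theorem Deformed.raising_eq (h : Deformed β α Y T) (hB : GoodForm B T) {m : ℕ} (hmN : m ≤ N)
    {lam : Fin N → ℕ} (hlam : Antitone lam) (hm : ∀ i : Fin N, m ≤ (i : ℕ) → lam i = 0)
    {p q : Poly N} (hp : IsOrth B lam p) (hq : IsOrth B (addOnes m lam) q) :
    raising β m Y (cherLike β T) p = (α ^ m * raisingCoeff β m lam) • q := by
  obtain ⟨f, hf⟩ := exists_isJack β hlam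
  obtain ⟨g, hg⟩ := exists_isJack β (antitone_addOnes m hlam)
  rw [hB.unique hp (h.isOrth hB hlam hf), hB.unique hq (h.isOrth hB (antitone_addOnes m hlam) hg),
    map_smul, ← h.substOne_raisingJ, hf.raisingJ_eq hmN hlam hm hg, map_smul, smul_smul, smul_smul,
    sum_addOnes hmN, pow_add]
  congr 1
  have h1 := pow_ne_zero m h.ne_zero
  have h2 := pow_ne_zero (∑ i, lam i) h.ne_zero
  field_simp

end Deformation

/-! ### The Hermite and Laguerre deformations -/

section Instances

variable {N : ℕ}

theorem dunklA_mem_degLT (β : ℕ) (j : Fin N) {n : ℕ} {f : Poly N} (hf : f ∈ degLT N (n + 1)) :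
    dunklA β j f ∈ degLT N n := by
  refine dunklA_mem β j (fun b hb c _ hc => ?_) hf
  have : b.degree < n + 1 := hb
  show c.degree < n
  lia

theorem permOp_mem_degLT (w : Equiv.Perm (Fin N)) {n : ℕ} {f : Poly N} (hf : f ∈ degLT N n) :
    permOp w f ∈ degLT N n :=
  permOp_mem_of_stable w (moveStable_degree_lt n) hf

theorem deformed_A (β : ℕ) : Deformed β sqrtTwo (fun j : Fin N => creA β j)
    (fun j => creA β j * annA β j) where
  toDunklLike := dunklLike_A β
  ne_zero := sqrtTwo_ne_zero
  sub_mem j n f hf := by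
    have e : creA β j f - sqrtTwo • (X j * f) = (-sqrtTwo⁻¹) • dunklA β j f := by
      have : sqrtTwo⁻¹ * 2 = sqrtTwo := by
        rw [← sqrtTwo_sq, inv_mul_cancel_left₀ sqrtTwo_ne_zero]
      rw [creA_apply, smul_sub, smul_smul, this]
      module
    show creA β j f - sqrtTwo • (X j * f) ∈ degLT N n
    rw [e]
    exact Submodule.smul_mem _ _ (dunklA_mem_of_stable β j (moveStable_degree_lt n) hf)
  xD_sub_mem j S hS f hf := by
    have e : xD β j f - (creA β j * annA β j) f = (2 : ℂ)⁻¹ • dunklA β j (dunklA β j f) := by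
      rw [Module.End.mul_apply, annA_apply, map_smul, creA_apply, smul_smul, sqrtTwo_inv_sq, xD_apply]
      module
    rw [e]
    exact Submodule.smul_mem _ _ (dunklA_mem_of_stable β j hS (dunklA_mem_of_stable β j hS hf))
  xD_sub_mem_degLT j n f hf := by
    have e : xD β j f - (creA β j * annA β j) f = (2 : ℂ)⁻¹ • dunklA β j (dunklA β j f) := by
      rw [Module.End.mul_apply, annA_apply, map_smul, creA_apply, smul_smul, sqrtTwo_inv_sq, xD_apply]
      module
    rw [e]
    exact Submodule.smul_mem _ _ (dunklA_mem_of_stable β j (moveStable_degree_lt n)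
      (dunklA_mem_degLT β j hf))

/-- Every term on the right contains D_j f, so the difference lowers the degree. -/
theorem xD_sub_lagT (β : ℕ) (c : ℂ) (j : Fin N) (f : Poly N) :
    xD β j f - lagT β c j f = xD β j (dunklA β j f) + (1 + c) • dunklA β j f +
      (β : ℂ) • ∑ k with k ≠ j, permOp (Equiv.swap j k) (dunklA β j f) := by
  rw [lagT_apply, lagQ_apply, dunklM_apply, dunklA_X_mul_self, xD_apply, xD_apply]
  module

theorem lagY_sub (β : ℕ) (c : ℂ) (j : Fin N) (f : Poly N) :
    lagY β c j f - (1 : ℂ) • (X j * f) = dunklA β j (X j * (dunklA β j f - f)) - xD β j f +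
      c • (dunklA β j f - f) := by
  rw [lagY_apply, dunklM_apply, dunklM_apply, xD_apply]
  simp only [mul_sub, map_sub]
  module

theorem deformed_L (β : ℕ) (c : ℂ) : Deformed β 1 (fun j : Fin N => lagY β c j)
    (fun j => lagT β c j) where
  toDunklLike := dunklLike_L β c
  ne_zero := one_ne_zero
  sub_mem j n f hf := by
    have hD := dunklA_mem_of_stable β j (moveStable_degree_lt n) hf
    have hs := Submodule.sub_mem _ hD hf
    rw [lagY_sub]
    exact Submodule.add_mem _ (Submodule.sub_mem _ (dunklA_mem_degLT β j (X_mul_mem_degLT j hs))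
      (xD_mem_of_stable β j (moveStable_degree_lt n) hf)) (Submodule.smul_mem _ _ hs)
  xD_sub_mem j S hS f hf := by
    have hD := dunklA_mem_of_stable β j hS hf
    rw [xD_sub_lagT]
    exact Submodule.add_mem _ (Submodule.add_mem _ (xD_mem_of_stable β j hS hD)
      (Submodule.smul_mem _ _ hD)) (Submodule.smul_mem _ _ (Submodule.sum_mem _ fun k _ =>
        permOp_mem_of_stable _ hS hD))
  xD_sub_mem_degLT j n f hf := by
    have hD := dunklA_mem_degLT β j hf
    rw [xD_sub_lagT]
    exact Submodule.add_mem _ (Submodule.add_mem _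
      (xD_mem_of_stable β j (moveStable_degree_lt n) hD)
      (Submodule.smul_mem _ _ hD)) (Submodule.smul_mem _ _ (Submodule.sum_mem _ fun k _ =>
        permOp_mem_degLT _ hD))

end Instances

/-! ### Integration by parts for Dunkl operators -/

section Bracket

variable {N : ℕ}

/-- The pairs of distinct indices. -/
def pairs (N : ℕ) : Finset (Fin N × Fin N) := {p | p.1 ≠ p.2}

theorem mem_pairs {p : Fin N × Fin N} : p ∈ pairs N ↔ p.1 ≠ p.2 := by simp [pairs]

/-- The product of all differences of two variables. -/
def disc (N : ℕ) : Poly N := ∏ p ∈ pairs N, (X p.1 - X p.2)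

/-- `disc N` without the factor `x_j - x_k`. -/
def discRest (j k : Fin N) : Poly N := ∏ p ∈ (pairs N).erase (j, k), (X p.1 - X p.2)

theorem mul_discRest {j k : Fin N} (h : j ≠ k) : (X j - X k) * discRest j k = disc N := by
  have hm : (j, k) ∈ pairs N := mem_pairs.2 h
  rw [disc, discRest, ← Finset.mul_prod_erase _ _ hm]

theorem permOp_disc (w : Equiv.Perm (Fin N)) : permOp w (disc N) = disc N := by
  rw [permOp_apply, disc, map_prod]
  refine Finset.prod_equiv (w.prodCongr w) (fun p => ?_) fun p _ => ?_
  · simp [mem_pairs]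
  · simp

theorem discRest_symm {j k : Fin N} (h : j ≠ k) : discRest k j = -discRest j k := by
  apply mul_left_cancel₀ (X_sub_X_ne_zero h)
  linear_combination mul_discRest h - mul_discRest h.symm

theorem permOp_swap_discRest {j k : Fin N} (h : j ≠ k) :
    permOp (Equiv.swap j k) (discRest j k) = -discRest j k := by
  apply mul_left_cancel₀ (X_sub_X_ne_zero h)
  have := congrArg (permOp (Equiv.swap j k)) (mul_discRest h)
  rw [permOp_mul_apply, map_sub, permOp_X, permOp_X, permOp_disc, Equiv.swap_apply_left,
    Equiv.swap_apply_right, ← mul_discRest h] at this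
  linear_combination -this

theorem derivation_prod {R A ι : Type*} [CommRing R] [CommRing A] [Algebra R A] [DecidableEq ι]
    (D : Derivation R A A) (s : Finset ι) (f : ι → A) :
    D (∏ i ∈ s, f i) = ∑ i ∈ s, (∏ k ∈ s.erase i, f k) * D (f i) := by
  induction s using Finset.induction_on with
  | empty => simp
  | insert a s ha ih =>
    rw [Finset.prod_insert ha, D.leibniz, ih, Finset.sum_insert ha, Finset.erase_insert ha,
      smul_eq_mul, smul_eq_mul, Finset.mul_sum, add_comm]
    congr 1
    refine Finset.sum_congr rfl fun i hi => ?_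
    rw [Finset.erase_insert_of_ne (by rintro rfl; exact ha hi), Finset.prod_insert fun h =>
      ha (Finset.mem_of_mem_erase h), mul_assoc]

theorem pderiv_disc (j : Fin N) :
    pderiv j (disc N) = (2 : ℂ) • ∑ k with k ≠ j, discRest j k := by
  have e : ∀ p : Fin N × Fin N, (if p ∈ pairs N then discRest p.1 p.2 * pderiv j (X p.1 - X p.2)
      else 0 : Poly N) = (if j = p.1 then if p.2 ≠ j then discRest j p.2 else 0 else 0) -
        if j = p.2 then if p.1 ≠ j then discRest p.1 j else 0 else 0 := by
    rintro ⟨a, b⟩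
    rw [map_sub, pderiv_X, pderiv_X]
    simp only [mem_pairs, Pi.single_apply]
    grind
  have h0 : pderiv j (disc N) = ∑ p ∈ pairs N, discRest p.1 p.2 * pderiv j (X p.1 - X p.2) :=
    derivation_prod (pderiv j) _ _
  rw [h0, ← Finset.univ_inter (pairs N), ← Finset.sum_ite_mem, Finset.sum_congr rfl fun p _ => e p,
    Finset.sum_sub_distrib, Fintype.sum_prod_type, Fintype.sum_prod_type_right]
  simp only [Finset.sum_ite_irrel, Finset.sum_const_zero, Finset.sum_ite_eq, Finset.mem_univ,
    if_true, ← Finset.sum_filter]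
  rw [two_smul, sub_eq_add_neg, ← Finset.sum_neg_distrib]
  congr 1
  refine Finset.sum_congr rfl fun k hk => ?_
  rw [discRest_symm (Finset.mem_filter.1 hk).2.symm, neg_neg]

/-- Since β is an integer, the weight is up to sign the polynomial `disc N ^ β`, and integration by
parts becomes a polynomial identity. The derivative of the weight cancels the parts of the divided
differences that involve no transposition. -/
theorem dunklA_bracket (β : ℕ) (j : Fin N) (f g : Poly N) :
    disc N ^ β * (dunklA β j f * g + f * dunklA β j g) = pderiv j (disc N ^ β * (f * g)) -
      (β : ℂ) • ∑ k with k ≠ j, disc N ^ (β - 1) * (discRest j k *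
        (permOp (Equiv.swap j k) f * g + f * permOp (Equiv.swap j k) g)) := by
  -- For β = 0 the truncated exponent β - 1 is harmless, because the sum carries the factor β.
  rcases β with - | n
  · simp [dunklA_apply, Derivation.leibniz]
    ring
  rw [Derivation.leibniz, Derivation.leibniz, Derivation.leibniz_pow, pderiv_disc, dunklA_apply,
    dunklA_apply, Nat.add_sub_cancel]
  have e : ∀ k ∈ Finset.univ.filter (fun k => k ≠ j),
      disc N ^ n * (discRest j k * (permOp (Equiv.swap j k) f * g + f * permOp (Equiv.swap j k) g)) =
      disc N ^ n * (2 * (f * g)) * discRest j k -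
        disc N ^ (n + 1) * (divA j k f * g + f * divA j k g) := fun k hk => by
    have hk := (Finset.mem_filter.1 hk).2.symm
    rw [pow_succ]
    linear_combination -(disc N ^ n * (divA j k f * g + f * divA j k g)) * mul_discRest hk +
      disc N ^ n * discRest j k * (g * mul_divA hk f + f * mul_divA hk g)
  rw [Finset.sum_congr rfl e, Finset.sum_sub_distrib, ← Finset.mul_sum, ← Finset.mul_sum,
    Finset.sum_add_distrib, ← Finset.sum_mul, ← Finset.mul_sum]
  simp only [smul_eq_mul, smul_eq_C_mul, nsmul_eq_mul, map_ofNat, map_natCast]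
  ring

variable {G : Poly N →ₗ[ℂ] ℂ} {β : ℕ}

/-- The correction terms are antisymmetric under s_jk, through the factor `discRest j k`, so an
invariant functional kills them. -/
theorem apply_dunklA_bracket (hG : ∀ i j f, G (permOp (Equiv.swap i j) f) = G f) (j : Fin N)
    (f g : Poly N) : G (disc N ^ β * (dunklA β j f * g)) =
      G (pderiv j (disc N ^ β * (f * g))) - G (disc N ^ β * (f * dunklA β j g)) := by
  have h0 : ∀ k ∈ Finset.univ.filter (fun k => k ≠ j), G (disc N ^ (β - 1) * (discRest j k *
      (permOp (Equiv.swap j k) f * g + f * permOp (Equiv.swap j k) g))) = 0 := fun k hk => by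
    have hk := (Finset.mem_filter.1 hk).2.symm
    have hd : permOp (Equiv.swap j k) (disc N ^ (β - 1)) = disc N ^ (β - 1) := by
      have := permOp_disc (Equiv.swap j k)
      rw [permOp_apply] at this ⊢
      rw [map_pow, this]
    have := hG j k (disc N ^ (β - 1) * (discRest j k *
      (permOp (Equiv.swap j k) f * g + f * permOp (Equiv.swap j k) g)))
    rw [permOp_mul_apply, permOp_mul_apply, hd, permOp_swap_discRest hk, map_add, permOp_mul_apply,
      permOp_mul_apply, permOp_swap_swap, permOp_swap_swap, neg_mul, mul_neg, map_neg,
      add_comm (f * _)] at this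
    exact CharZero.eq_neg_self_iff.1 this.symm
  have := congrArg G (dunklA_bracket β j f g)
  rw [map_sub, map_smul, map_sum, Finset.sum_eq_zero h0, smul_zero, sub_zero, mul_add, map_add]
    at this
  rw [← this, add_sub_cancel_right]

/-- The bilinear form attached to a functional. -/
def discForm (β : ℕ) (G : Poly N →ₗ[ℂ] ℂ) : Poly N →ₗ[ℂ] Poly N →ₗ[ℂ] ℂ :=
  LinearMap.mk₂ ℂ (fun f g => G (disc N ^ β * (f * g)))
    (fun f f' g => by rw [add_mul, mul_add, map_add])
    (fun c f g => by rw [smul_mul_assoc, mul_smul_comm, map_smul])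
    (fun f g g' => by rw [mul_add, mul_add, map_add])
    (fun c f g => by rw [mul_smul_comm, mul_smul_comm, map_smul])

theorem discForm_apply (f g : Poly N) : discForm β G f g = G (disc N ^ β * (f * g)) := rfl

theorem discForm_comm (f g : Poly N) : discForm β G f g = discForm β G g f := by
  rw [discForm_apply, discForm_apply, mul_comm f]

theorem discForm_symm_swap (hG : ∀ i j f, G (permOp (Equiv.swap i j) f) = G f) (j k : Fin N)
    (f g : Poly N) : discForm β G (permOp (Equiv.swap j k) f) g =
      discForm β G f (permOp (Equiv.swap j k) g) := by
  have hd : permOp (Equiv.swap j k) (disc N ^ β) = disc N ^ β := by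
    have := permOp_disc (Equiv.swap j k)
    rw [permOp_apply] at this ⊢
    rw [map_pow, this]
  rw [discForm_apply, discForm_apply, ← hG j k, permOp_mul_apply, permOp_mul_apply, hd,
    permOp_swap_swap]

/-- Since ã†_j ã_j = x_j D_j - D_j²/2, integration by parts gives the manifestly symmetric form
B(D_j f, D_j g)/2. -/
theorem discForm_symm_A (hG : ∀ i j f, G (permOp (Equiv.swap i j) f) = G f)
    (hd : ∀ j f, G (pderiv j f) = 2 * G (X j * f)) (j : Fin N) (f g : Poly N) :
    discForm β G ((creA β j * annA β j) f) g = discForm β G f ((creA β j * annA β j) g) := by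
  have key : ∀ f g, discForm β G ((creA β j * annA β j) f) g =
      2⁻¹ * discForm β G (dunklA β j f) (dunklA β j g) := fun f g => by
    have e : (creA β j * annA β j) f =
        X j * dunklA β j f - (2 : ℂ)⁻¹ • dunklA β j (dunklA β j f) := by
      rw [Module.End.mul_apply, annA_apply, map_smul, creA_apply, smul_smul, sqrtTwo_inv_sq]
      module
    rw [e, map_sub, map_smul, LinearMap.sub_apply, LinearMap.smul_apply, discForm_apply,
      discForm_apply, discForm_apply, apply_dunklA_bracket hG, hd, smul_eq_mul, mul_left_comm (X j),
      mul_assoc (X j)]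
    ring
  rw [key, discForm_comm f, key, discForm_comm]

/-- Integration by parts gives the manifestly symmetric form B(x_j D_j f, D_j g). -/
theorem discForm_symm_L (hG : ∀ i j f, G (permOp (Equiv.swap i j) f) = G f) (c : ℂ)
    (hd : ∀ j f, G (X j * pderiv j f) + (c + 1) * G f = G (X j * f)) (j : Fin N) (f g : Poly N) :
    discForm β G (lagT β c j f) g = discForm β G f (lagT β c j g) := by
  have key : ∀ f g, discForm β G (lagT β c j f) g =
      discForm β G (X j * dunklA β j f) (dunklA β j g) := fun f g => by
    have e1 := apply_dunklA_bracket (β := β) hG j (X j * dunklA β j f) g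
    have e2 := hd j (disc N ^ β * (dunklA β j f * g))
    have e3 : G (pderiv j (disc N ^ β * (X j * dunklA β j f * g))) =
        G (X j * pderiv j (disc N ^ β * (dunklA β j f * g))) +
          G (disc N ^ β * (dunklA β j f * g)) := by
      rw [mul_assoc (X j), mul_left_comm _ (X j), Derivation.leibniz, pderiv_X_self, map_add,
        smul_eq_mul, smul_eq_mul, mul_one]
    rw [mul_left_comm (X j), ← mul_assoc (X j)] at e2
    rw [lagT_apply, lagQ_apply, dunklM_apply, map_neg, map_add, map_sub, map_smul,
      LinearMap.neg_apply, LinearMap.add_apply, LinearMap.sub_apply, LinearMap.smul_apply,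
      discForm_apply, discForm_apply, discForm_apply, discForm_apply, smul_eq_mul]
    linear_combination -e1 - e2 - e3
  have hc : discForm β G (X j * dunklA β j f) (dunklA β j g) =
      discForm β G (X j * dunklA β j g) (dunklA β j f) := by
    rw [discForm_apply, discForm_apply]
    ring_nf
  rw [key, hc, ← key, discForm_comm]

end Bracket

/-! ### Functionals given by the moments of a weight -/

section Moments

open MeasureTheory

variable {N : ℕ}

theorem evalReal_add (x : Fin N → ℝ) (f g : Poly N) :
    evalReal x (f + g) = evalReal x f + evalReal x g := map_add _ _ _

theorem evalReal_mul (x : Fin N → ℝ) (f g : Poly N) :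
    evalReal x (f * g) = evalReal x f * evalReal x g := map_mul _ _ _

theorem evalReal_smul (x : Fin N → ℝ) (c : ℂ) (f : Poly N) :
    evalReal x (c • f) = c * evalReal x f := smul_eval _ _ _

theorem evalReal_expand (x : Fin N → ℝ) (e : ℕ) (f : Poly N) :
    evalReal x (expand e f) = evalReal (fun i => x i ^ e) f := by
  exact eval_expand e _ f |>.trans (by simp [evalReal, Pi.pow_def])

/-- A weight on the real line all of whose moments in `x ^ e` exist. -/
def HasMoments (e : ℕ) (ρ : ℝ → ℝ) : Prop := ∀ n, Integrable fun x : ℝ => (x ^ e) ^ n * ρ x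

/-- The moments of a weight. -/
def moment (e : ℕ) (ρ : ℝ → ℝ) (n : ℕ) : ℝ := ∫ x : ℝ, (x ^ e) ^ n * ρ x

/-- The function integrated in `momentFun`. -/
def momentIntegrand (e : ℕ) (ρ : ℝ → ℝ) (f : Poly N) (x : Fin N → ℝ) : ℂ :=
  evalReal (fun i => x i ^ e) f * ((∏ i, ρ (x i) : ℝ) : ℂ)

variable {e : ℕ} {ρ : ℝ → ℝ}

theorem momentIntegrand_monomial (b : Fin N →₀ ℕ) (x : Fin N → ℝ) :
    momentIntegrand e ρ (monomial b 1) x =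
      ∏ i, (((x i ^ e) ^ b i * ρ (x i) : ℝ) : ℂ) := by
  rw [momentIntegrand, evalReal, eval_monomial, one_mul, Finsupp.prod_fintype _ _ fun _ =>
    pow_zero _, Complex.ofReal_prod, ← Finset.prod_mul_distrib]
  simp

theorem momentIntegrand_add (f g : Poly N) :
    momentIntegrand e ρ (f + g) = momentIntegrand e ρ f + momentIntegrand e ρ g := by
  funext x
  rw [Pi.add_apply, momentIntegrand, evalReal_add, add_mul]
  rfl

theorem momentIntegrand_smul (c : ℂ) (f : Poly N) :
    momentIntegrand e ρ (c • f) = c • momentIntegrand e ρ f := by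
  funext x
  rw [Pi.smul_apply, momentIntegrand, evalReal_smul, mul_assoc]
  rfl

theorem monomial_eq_smul (b : Fin N →₀ ℕ) (a : ℂ) :
    (monomial b a : Poly N) = a • monomial b 1 := by
  rw [smul_monomial, smul_eq_mul, mul_one]

theorem HasMoments.integrable (h : HasMoments e ρ) (f : Poly N) :
    Integrable (momentIntegrand e ρ f) := by
  induction f using MvPolynomial.induction_on' with
  | monomial b a =>
    rw [monomial_eq_smul, momentIntegrand_smul]
    refine Integrable.smul a ?_
    simp only [funext fun x => momentIntegrand_monomial (e := e) (ρ := ρ) b x]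
    exact Integrable.fintype_prod (f := fun i x => (((x ^ e) ^ b i * ρ x : ℝ) : ℂ))
      fun i => (h (b i)).ofReal
  | add p q hp hq =>
    rw [momentIntegrand_add]
    exact hp.add hq

/-- Integration of polynomials in `x_i ^ e` against a product weight. -/
def momentFun (N : ℕ) (h : HasMoments e ρ) : Poly N →ₗ[ℂ] ℂ where
  toFun f := ∫ x, momentIntegrand e ρ f x
  map_add' f g := by
    rw [momentIntegrand_add]
    exact integral_add (h.integrable f) (h.integrable g)
  map_smul' c f := by
    rw [momentIntegrand_smul]
    exact integral_smul c _

theorem momentFun_apply (h : HasMoments e ρ) (f : Poly N) :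
    momentFun N h f = ∫ x, momentIntegrand e ρ f x := rfl

theorem momentFun_monomial (h : HasMoments e ρ) (b : Fin N →₀ ℕ) :
    momentFun N h (monomial b 1) = ∏ i, (moment e ρ (b i) : ℂ) := by
  rw [momentFun_apply]
  simp only [momentIntegrand_monomial]
  rw [integral_fintype_prod_volume_eq_prod fun i (x : ℝ) => (((x ^ e) ^ b i * ρ x : ℝ) : ℂ)]
  exact Finset.prod_congr rfl fun i _ => integral_ofReal

theorem momentFun_permOp (h : HasMoments e ρ) (w : Equiv.Perm (Fin N)) (f : Poly N) :
    momentFun N h (permOp w f) = momentFun N h f := by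
  induction f using MvPolynomial.induction_on' with
  | add p q hp hq => rw [map_add, map_add, hp, hq, map_add]
  | monomial b a => ?_
  rw [monomial_eq_smul b a, map_smul, map_smul, map_smul]
  congr 1
  rw [permOp_monomial, momentFun_monomial, momentFun_monomial,
    ← Equiv.prod_comp w]
  refine Finset.prod_congr rfl fun i _ => ?_
  rw [Finsupp.mapDomain_apply w.injective]

theorem momentFun_monomial_eq (h : HasMoments e ρ) (j : Fin N) (b c : Fin N →₀ ℕ)
    (hb : ∀ i, i ≠ j → c i = b i) : momentFun N h (monomial c 1) =
      moment e ρ (c j) * ∏ i ∈ Finset.univ.erase j, (moment e ρ (b i) : ℂ) := by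
  rw [momentFun_monomial, ← Finset.mul_prod_erase _ _ (Finset.mem_univ j)]
  congr 1
  exact Finset.prod_congr rfl fun i hi => by rw [hb i (Finset.ne_of_mem_erase hi)]

theorem X_mul_monomial_one (j : Fin N) (b : Fin N →₀ ℕ) :
    (X j * monomial b 1 : Poly N) = monomial (b + Finsupp.single j 1) 1 := by
  rw [X, monomial_mul, one_mul, add_comm]

/-- In several variables the identity factors into one-variable moments, so only the recursion for a
single variable is needed. At n = 0 its left side is 0 whatever n - 1 means, and it says that the
first moment vanishes. -/
theorem momentFun_pderiv (h : HasMoments e ρ)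
    (hrec : ∀ n : ℕ, (n : ℝ) * moment e ρ (n - 1) = 2 * moment e ρ (n + 1)) (j : Fin N)
    (f : Poly N) : momentFun N h (pderiv j f) = 2 * momentFun N h (X j * f) := by
  induction f using MvPolynomial.induction_on' with
  | add p q hp hq => rw [map_add, map_add, hp, hq, mul_add, map_add, mul_add]
  | monomial b a => ?_
  rw [monomial_eq_smul b a, Derivation.map_smul, mul_smul_comm, map_smul, map_smul, smul_eq_mul,
    smul_eq_mul, mul_left_comm]
  congr 1
  rw [pderiv_monomial, one_mul, monomial_eq_smul, map_smul, X_mul_monomial_one,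
    momentFun_monomial_eq h j b, momentFun_monomial_eq h j b]
  · have : ((b j : ℂ) * moment e ρ (b j - 1) : ℂ) = 2 * moment e ρ (b j + 1) := by
      exact_mod_cast congrArg Complex.ofReal (hrec (b j))
    simp only [Finsupp.tsub_apply, Finsupp.add_apply, Finsupp.single_eq_same, smul_eq_mul]
    rw [← mul_assoc, this, mul_assoc]
  · intro i hi; simp [hi]
  · intro i hi; simp [hi]

theorem momentFun_X_mul_pderiv (h : HasMoments e ρ) {c : ℝ}
    (hrec : ∀ n : ℕ, (n + c) * moment e ρ n = moment e ρ (n + 1)) (j : Fin N)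
    (f : Poly N) : momentFun N h (X j * pderiv j f) + c * momentFun N h f =
      momentFun N h (X j * f) := by
  induction f using MvPolynomial.induction_on' with
  | add p q hp hq =>
    rw [map_add, map_add, mul_add, map_add, mul_add, mul_add, map_add, ← hp, ← hq]
    ring
  | monomial b a => ?_
  rw [monomial_eq_smul b a, Derivation.map_smul, mul_smul_comm, mul_smul_comm, map_smul, map_smul,
    map_smul, smul_eq_mul, smul_eq_mul, smul_eq_mul, mul_left_comm, ← mul_add]
  congr 1
  rw [X_mul_pderiv_monomial, ← Nat.cast_smul_eq_nsmul ℂ, map_smul, X_mul_monomial_one,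
    momentFun_monomial_eq h j b _ fun _ _ => rfl, momentFun_monomial_eq h j b]
  · have : ((b j + c) * moment e ρ (b j) : ℂ) = moment e ρ (b j + 1) := by
      exact_mod_cast congrArg Complex.ofReal (hrec (b j))
    simp only [Finsupp.add_apply, Finsupp.single_eq_same, smul_eq_mul]
    rw [← this]
    ring
  · intro i hi; simp [hi]

/-! ### The absolute value of the discriminant -/

/-- The sign of `disc N` at real points. -/
def discSign (N β : ℕ) : ℂ := ((-1) ^ β) ^ ({p : Fin N × Fin N | p.1 < p.2} : Finset _).card

theorem discSign_mul_self (N β : ℕ) : discSign N β * discSign N β = 1 := by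
  rw [discSign, ← mul_pow, ← mul_pow]; simp

/-- The factors of `disc N` for (j, k) and (k, j) multiply to -(x_j - x_k)²; collecting the signs
gives a constant independent of x. -/
theorem evalReal_disc_pow (β : ℕ) (x : Fin N → ℝ) : evalReal x (disc N ^ β) =
    discSign N β * (((∏ j, ∏ k ∈ Finset.Ioi j, |x j - x k| ^ β) ^ 2 : ℝ) : ℂ) := by
  have h1 : evalReal x (disc N ^ β) = ∏ p ∈ pairs N, ((x p.1 - x p.2 : ℝ) : ℂ) ^ β := by
    rw [evalReal, disc, ← Finset.prod_pow, map_prod]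
    simp
  have h2 : pairs N = ({p : Fin N × Fin N | p.1 < p.2} : Finset _) ∪
      ({p : Fin N × Fin N | p.2 < p.1} : Finset _) := by
    ext p
    simp [pairs, lt_or_lt_iff_ne]
  have h3 : ∏ p : Fin N × Fin N with p.2 < p.1, ((x p.1 - x p.2 : ℝ) : ℂ) ^ β =
      ∏ p : Fin N × Fin N with p.1 < p.2, ((x p.2 - x p.1 : ℝ) : ℂ) ^ β :=
    Finset.prod_equiv (Equiv.prodComm _ _) (by simp) (by simp)
  have h4 : (∏ j, ∏ k ∈ Finset.Ioi j, |x j - x k| ^ β) =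
      ∏ p : Fin N × Fin N with p.1 < p.2, |x p.1 - x p.2| ^ β := by
    rw [Finset.prod_filter, Fintype.prod_prod_type]
    refine Finset.prod_congr rfl fun j _ => ?_
    rw [← Finset.prod_filter]
    refine Finset.prod_congr ?_ fun _ _ => rfl
    ext k; simp
  rw [h1, h2, Finset.prod_union, h3, h4, ← Finset.prod_mul_distrib, ← Finset.prod_pow,
    Complex.ofReal_prod, discSign, ← Finset.prod_const, ← Finset.prod_mul_distrib]
  · refine Finset.prod_congr rfl fun p _ => ?_
    rw [← pow_mul, mul_comm β 2, pow_mul, sq_abs, ← mul_pow, Complex.ofReal_pow, ← mul_pow]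
    congr 1
    push_cast
    ring
  · rw [Finset.disjoint_filter]
    exact fun p _ h => h.not_gt

end Moments

/-! ### Positivity of the scalar products -/

section Positivity

open MeasureTheory

variable {N : ℕ} {e : ℕ} {ρ : ℝ → ℝ}

/-- Complex conjugation of the coefficients. -/
def conjPoly (f : Poly N) : Poly N := map (starRingEnd ℂ) f

theorem evalReal_conjPoly (x : Fin N → ℝ) (f : Poly N) :
    evalReal x (conjPoly f) = starRingEnd ℂ (evalReal x f) := by
  induction f using MvPolynomial.induction_on with
  | C a => simp [evalReal, conjPoly]
  | add p q hp hq =>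
    rw [evalReal_add, map_add, ← hp, ← hq, ← evalReal_add, conjPoly, map_add]
    rfl
  | mul_X p i hp =>
    rw [evalReal_mul, map_mul, ← hp, conjPoly, map_mul, evalReal_mul, map_X]
    simp [evalReal, conjPoly]

theorem conjPoly_mem_symLT {lam : Fin N → ℕ} {f : Poly N} (hf : f ∈ symLT lam) :
    conjPoly f ∈ symLT lam := by
  refine ⟨fun b hb => hf.1 (support_map_subset _ _ hb), fun w => ?_⟩
  rw [conjPoly, permOp_apply, ← map_rename, ← permOp_apply, hf.2 w]

theorem continuous_evalReal (f : Poly N) : Continuous fun x : Fin N → ℝ => evalReal x f :=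
  (continuous_eval f).comp (continuous_pi fun i => Complex.continuous_ofReal.comp (continuous_apply i))

theorem eq_zero_of_evalReal_ae {f : Poly N} (h : ∀ᵐ x : Fin N → ℝ, evalReal x f = 0) : f = 0 := by
  have h0 : (fun x : Fin N → ℝ => evalReal x f) = fun _ => 0 :=
    ((continuous_evalReal f).ae_eq_iff_eq volume continuous_const).1 h
  refine funext_set (fun _ => Set.range ((↑) : ℝ → ℂ)) (fun _ => Set.infinite_range_of_injective
    Complex.ofReal_injective) fun x hx => ?_
  choose y hy using fun i => hx i trivial
  obtain rfl : (fun i => (y i : ℂ)) = x := funext hy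
  rw [map_zero]
  exact congrFun h0 y

theorem disc_ne_zero : disc N ≠ 0 :=
  Finset.prod_ne_zero_iff.2 fun _ hp => X_sub_X_ne_zero (mem_pairs.1 hp)

/-- The functional whose form is the scalar product. -/
def scalarFun (N β : ℕ) (h : HasMoments e ρ) : Poly N →ₗ[ℂ] ℂ := discSign N β • momentFun N h

theorem discForm_scalarFun (β : ℕ) (h : HasMoments e ρ) (f g : Poly N) :
    discForm β (scalarFun N β h) f g = ∫ x : Fin N → ℝ,
      evalReal (fun i => x i ^ e) f * evalReal (fun i => x i ^ e) g *
        ((((∏ j, ∏ k ∈ Finset.Ioi j, |x j ^ e - x k ^ e| ^ β) ^ 2 * ∏ i, ρ (x i) : ℝ)) : ℂ) := by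
  rw [discForm_apply, scalarFun, LinearMap.smul_apply, momentFun_apply, ← integral_smul]
  congr 1
  funext x
  rw [momentIntegrand, evalReal_mul, evalReal_mul, evalReal_disc_pow, smul_eq_mul]
  push_cast
  linear_combination (((∏ j, ∏ k ∈ Finset.Ioi j, ((|x j ^ e - x k ^ e| : ℝ) : ℂ) ^ β) ^ 2) *
    (evalReal (fun i => x i ^ e) f * evalReal (fun i => x i ^ e) g) * ∏ i, (ρ (x i) : ℂ)) *
    discSign_mul_self N β

/-- The form is bilinear, so positivity is tested on f and its complex conjugate, where the
integrand is |f|² times the weight. Both have support in the same exponents, which makes the test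
available in `symLT`. -/
theorem eq_zero_of_discForm_conjPoly (β : ℕ) (h : HasMoments e ρ) (he : 0 < e) (hρ : ∀ x, 0 ≤ ρ x)
    (hρ0 : ∀ x, ρ x = 0 → x = 0) {f : Poly N}
    (hf : discForm β (scalarFun N β h) f (conjPoly f) = 0) : f = 0 := by
  set v : (Fin N → ℝ) → ℝ := fun x =>
    (∏ j, ∏ k ∈ Finset.Ioi j, |x j ^ e - x k ^ e| ^ β) ^ 2 * ∏ i, ρ (x i) with hv
  have hv0 : ∀ x, 0 ≤ v x := fun x => mul_nonneg (sq_nonneg _) (Finset.prod_nonneg fun i _ => hρ _)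
  have e1 : ∀ x : Fin N → ℝ, evalReal (fun i => x i ^ e) f *
      evalReal (fun i => x i ^ e) (conjPoly f) * ((v x : ℝ) : ℂ) =
      ((‖evalReal (fun i => x i ^ e) f‖ ^ 2 * v x : ℝ) : ℂ) := fun x => by
    rw [evalReal_conjPoly, Complex.mul_conj, Complex.normSq_eq_norm_sq]
    push_cast
    rfl
  have hint : Integrable fun x : Fin N → ℝ => ‖evalReal (fun i => x i ^ e) f‖ ^ 2 * v x := by
    have := (h.integrable (discSign N β • (disc N ^ β * (f * conjPoly f)))).re
    refine this.congr (Filter.Eventually.of_forall fun x => ?_)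
    have e2 : momentIntegrand e ρ (discSign N β • (disc N ^ β * (f * conjPoly f))) x =
        ((‖evalReal (fun i => x i ^ e) f‖ ^ 2 * v x : ℝ) : ℂ) := by
      rw [← e1, momentIntegrand, evalReal_smul, evalReal_mul, evalReal_mul, evalReal_disc_pow, hv]
      push_cast
      linear_combination (((∏ j, ∏ k ∈ Finset.Ioi j, ((|x j ^ e - x k ^ e| : ℝ) : ℂ) ^ β) ^ 2) *
        (evalReal (fun i => x i ^ e) f * evalReal (fun i => x i ^ e) (conjPoly f)) *
          ∏ i, (ρ (x i) : ℂ)) * discSign_mul_self N β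
    show RCLike.re (momentIntegrand e ρ _ x) = _
    rw [e2]
    exact Complex.ofReal_re _
  rw [discForm_scalarFun] at hf
  rw [integral_congr_ae (Filter.Eventually.of_forall e1), integral_complex_ofReal, Complex.ofReal_eq_zero,
    integral_eq_zero_iff_of_nonneg (fun x => mul_nonneg (sq_nonneg _) (hv0 x)) hint] at hf
  -- The factors `disc N ^ β` and the product of the variables absorb the points where the weight
  -- vanishes.
  have hz : expand e (f * disc N ^ β) * ∏ i, X i = 0 := by
    apply eq_zero_of_evalReal_ae
    filter_upwards [hf] with x hx
    rw [evalReal_mul, evalReal_expand, evalReal_mul, evalReal_disc_pow]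
    simp only [Pi.zero_apply, hv, mul_eq_zero, pow_eq_zero_iff two_ne_zero, norm_eq_zero] at hx
    rcases hx with hx | hx | hx
    · rw [hx, zero_mul, zero_mul]
    · rw [hx]; simp
    · obtain ⟨i, -, hi⟩ := Finset.prod_eq_zero_iff.1 hx
      have : evalReal x (∏ i, X i) = 0 := by
        rw [evalReal, map_prod]
        exact Finset.prod_eq_zero (Finset.mem_univ i) (by simp [hρ0 _ hi])
      rw [this, mul_zero]
  have hX : (∏ i, X i : Poly N) ≠ 0 := Finset.prod_ne_zero_iff.2 fun i _ => X_ne_zero i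
  have := (expand_eq_zero he).1 ((mul_eq_zero.1 hz).resolve_right hX)
  exact (mul_eq_zero.1 this).resolve_right (pow_ne_zero _ disc_ne_zero)

theorem scalarFun_permOp (β : ℕ) (h : HasMoments e ρ) (i j : Fin N) (f : Poly N) :
    scalarFun N β h (permOp (Equiv.swap i j) f) = scalarFun N β h f := by
  rw [scalarFun, LinearMap.smul_apply, LinearMap.smul_apply, momentFun_permOp]

theorem goodForm_A (β : ℕ) (h : HasMoments e ρ) (he : 0 < e) (hρ : ∀ x, 0 ≤ ρ x)
    (hρ0 : ∀ x, ρ x = 0 → x = 0)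
    (hrec : ∀ n : ℕ, (n : ℝ) * moment e ρ (n - 1) = 2 * moment e ρ (n + 1)) :
    GoodForm (discForm β (scalarFun N β h)) (fun j => creA β j * annA β j) where
  symm_T := discForm_symm_A (scalarFun_permOp β h) fun j f => by
    rw [scalarFun, LinearMap.smul_apply, LinearMap.smul_apply, momentFun_pderiv h hrec, smul_eq_mul,
      smul_eq_mul, mul_left_comm]
  symm_swap := discForm_symm_swap (scalarFun_permOp β h)
  nondeg lam f hf hg := eq_zero_of_discForm_conjPoly β h he hρ hρ0 (hg _ (conjPoly_mem_symLT hf))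

theorem goodForm_L (β : ℕ) (h : HasMoments e ρ) (he : 0 < e) (hρ : ∀ x, 0 ≤ ρ x)
    (hρ0 : ∀ x, ρ x = 0 → x = 0) {c : ℝ}
    (hrec : ∀ n : ℕ, (n + (c + 1)) * moment e ρ n = moment e ρ (n + 1)) :
    GoodForm (discForm β (scalarFun N β h)) (fun j => lagT β c j) where
  symm_T := discForm_symm_L (scalarFun_permOp β h) c fun j f => by
    rw [scalarFun, LinearMap.smul_apply, LinearMap.smul_apply, LinearMap.smul_apply,
      ← momentFun_X_mul_pderiv h hrec j f, smul_eq_mul, smul_eq_mul, smul_eq_mul]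
    push_cast
    ring
  symm_swap := discForm_symm_swap (scalarFun_permOp β h)
  nondeg lam f hf hg := eq_zero_of_discForm_conjPoly β h he hρ hρ0 (hg _ (conjPoly_mem_symLT hf))

end Positivity

/-! ### The Hermite and Laguerre weights -/

section Weights

open MeasureTheory

/-- The weight of the Hermite polynomials. -/
def hermiteWeight (x : ℝ) : ℝ := Real.exp (-x ^ 2 / 2) ^ 2

/-- The weight of the Laguerre polynomials. -/
def laguerreWeight (γ : ℝ) (x : ℝ) : ℝ := (|x| ^ γ * Real.exp (-x ^ 2 / 2)) ^ 2

theorem exp_half_sq (x : ℝ) : Real.exp (-x ^ 2 / 2) ^ 2 = Real.exp (-x ^ 2) := by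
  rw [← Real.exp_nat_mul]
  congr 1
  push_cast
  ring

theorem integrable_pow_mul_exp (n : ℕ) : Integrable fun x : ℝ => x ^ n * Real.exp (-x ^ 2) := by
  have := integrable_rpow_mul_exp_neg_mul_sq one_pos (s := n) (by
    have := n.cast_nonneg (α := ℝ); linarith)
  simpa using this

theorem hasMoments_hermiteWeight : HasMoments 1 hermiteWeight := fun n => by
  simpa only [hermiteWeight, exp_half_sq, pow_one] using integrable_pow_mul_exp n

/-- The integral over the line of the derivative of x^n exp(-x²) is 0. -/
theorem moment_hermiteWeight (n : ℕ) : (n : ℝ) * moment 1 hermiteWeight (n - 1) =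
    2 * moment 1 hermiteWeight (n + 1) := by
  simp only [moment, hermiteWeight, exp_half_sq, pow_one]
  have hd : ∀ x : ℝ, HasDerivAt (fun x : ℝ => x ^ n * Real.exp (-x ^ 2))
      ((n : ℝ) * (x ^ (n - 1) * Real.exp (-x ^ 2)) - 2 * (x ^ (n + 1) * Real.exp (-x ^ 2))) x := by
    intro x
    have h2 : HasDerivAt (fun x : ℝ => -x ^ 2) (-(2 * x)) x := by
      simpa using (hasDerivAt_pow 2 x).fun_neg
    refine ((hasDerivAt_pow n x).fun_mul h2.exp).congr_deriv ?_
    rw [pow_succ]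
    ring
  have h1 := (integrable_pow_mul_exp (n - 1)).const_mul (n : ℝ)
  have h2 := (integrable_pow_mul_exp (n + 1)).const_mul 2
  have := integral_eq_zero_of_hasDerivAt_of_integrable hd (h1.sub h2) (integrable_pow_mul_exp n)
  rw [integral_sub h1 h2, integral_const_mul, integral_const_mul, sub_eq_zero] at this
  exact this

theorem hermiteWeight_nonneg (x : ℝ) : 0 ≤ hermiteWeight x := sq_nonneg _

theorem hermiteWeight_ne_zero (x : ℝ) : hermiteWeight x ≠ 0 :=
  pow_ne_zero _ (Real.exp_pos _).ne'

theorem laguerreWeight_nonneg (γ x : ℝ) : 0 ≤ laguerreWeight γ x := sq_nonneg _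

theorem eq_zero_of_laguerreWeight {γ x : ℝ} (h : laguerreWeight γ x = 0) : x = 0 := by
  by_contra hx
  exact pow_ne_zero 2 (mul_ne_zero (Real.rpow_pos_of_pos (abs_pos.2 hx) _).ne'
    (Real.exp_pos _).ne') h

theorem laguerre_integrand {γ : ℝ} (hγ : -(1 / 2) < γ) (n : ℕ) (x : ℝ) :
    (x ^ 2) ^ n * laguerreWeight γ x =
      |x| ^ (2 * (n : ℝ) + 2 * γ) * Real.exp (-|x| ^ (2 : ℝ)) := by
  have h1 : |x| ^ (2 * (n : ℝ) + 2 * γ) = (x ^ 2) ^ n * |x| ^ (2 * γ) := by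
    -- At x = 0 the power law requires a non-zero total exponent, which is guaranteed only for n ≥
    -- 1.
    rcases Nat.eq_zero_or_pos n with rfl | hn
    · simp
    · have hn : (1 : ℝ) ≤ n := by exact_mod_cast hn
      rw [Real.rpow_add' (abs_nonneg x) (by linarith), ← sq_abs, ← pow_mul,
        ← Real.rpow_natCast]
      push_cast
      rfl
  have h2 : |x| ^ (2 * γ) = (|x| ^ γ) ^ 2 := by
    rw [mul_comm, ← Nat.cast_two, Real.rpow_mul_natCast (abs_nonneg x)]
  rw [h1, h2, laguerreWeight, mul_pow, exp_half_sq, Real.rpow_two, sq_abs, mul_assoc]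

theorem moment_laguerreWeight_eq {γ : ℝ} (hγ : -(1 / 2) < γ) (n : ℕ) :
    moment 2 (laguerreWeight γ) n = Real.Gamma (n + γ + 1 / 2) := by
  simp only [moment, laguerre_integrand hγ n]
  have hn := n.cast_nonneg (α := ℝ)
  rw [integral_comp_abs (f := fun x => x ^ (2 * (n : ℝ) + 2 * γ) * Real.exp (-x ^ (2 : ℝ))),
    integral_rpow_mul_exp_neg_rpow two_pos (by linarith), ← mul_assoc,
    mul_one_div_cancel two_ne_zero, one_mul]
  congr 1
  ring

theorem hasMoments_laguerreWeight {γ : ℝ} (hγ : -(1 / 2) < γ) :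
    HasMoments 2 (laguerreWeight γ) := fun n => by
  have hn := n.cast_nonneg (α := ℝ)
  -- The integral of a non-integrable function is 0 by convention, whereas here the value is a
  -- positive Gamma value; so integrability follows from the formula for the moment.
  by_contra h
  have h0 := integral_undef h
  have h1 := moment_laguerreWeight_eq hγ n
  rw [moment, h0] at h1
  exact (Real.Gamma_pos_of_pos (by linarith)).ne h1

theorem moment_laguerreWeight {γ : ℝ} (hγ : -(1 / 2) < γ) (n : ℕ) :
    (n + ((γ - 2⁻¹) + 1)) * moment 2 (laguerreWeight γ) n = moment 2 (laguerreWeight γ) (n + 1) := by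
  have hn := n.cast_nonneg (α := ℝ)
  rw [moment_laguerreWeight_eq hγ, moment_laguerreWeight_eq hγ,
    show (((n + 1 : ℕ) : ℝ) + γ + 1 / 2) = (n + γ + 1 / 2) + 1 by push_cast; ring,
    Real.Gamma_add_one (by linarith)]
  ring

variable {N : ℕ}

/-- The scalar product of the Hermite polynomials. -/
def formH (N β : ℕ) : Poly N →ₗ[ℂ] Poly N →ₗ[ℂ] ℂ :=
  discForm β (scalarFun N β hasMoments_hermiteWeight)

/-- The scalar product of the Laguerre polynomials, as polynomials in the squares. -/
def formL (N β : ℕ) {γ : ℝ} (hγ : -(1 / 2) < γ) : Poly N →ₗ[ℂ] Poly N →ₗ[ℂ] ℂ :=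
  discForm β (scalarFun N β (hasMoments_laguerreWeight hγ))

theorem formH_apply (β : ℕ) (f g : Poly N) : formH N β f g = innerH β f g := by
  rw [formH, discForm_scalarFun, innerH]
  simp only [pow_one, phiA, mul_pow, ← Finset.prod_pow (s := Finset.univ) (n := 2)
    (f := fun j => Real.exp _)]
  rfl

theorem formL_apply (β : ℕ) {γ : ℝ} (hγ : -(1 / 2) < γ) (f g : Poly N) :
    formL N β hγ f g = innerL β γ (sqOp f) (sqOp g) := by
  rw [formL, discForm_scalarFun, innerL]
  have e : ∀ (x : Fin N → ℝ) (f : Poly N), evalReal x (sqOp f) = evalReal (fun i => x i ^ 2) f :=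
    fun x f => evalReal_expand x 2 f
  congr 1
  funext x
  rw [e, e, phiB, mul_pow]
  simp only [laguerreWeight, Finset.prod_pow]

theorem goodForm_formH (β : ℕ) : GoodForm (formH N β) (fun j => creA β j * annA β j) :=
  goodForm_A β _ one_pos hermiteWeight_nonneg (fun x h => absurd h (hermiteWeight_ne_zero x))
    moment_hermiteWeight

theorem goodForm_formL (β : ℕ) {γ : ℝ} (hγ : -(1 / 2) < γ) :
    GoodForm (formL N β hγ) (fun j => lagT β (γ - 2⁻¹) j) := by
  have := goodForm_L (N := N) β (hasMoments_laguerreWeight hγ) two_pos (laguerreWeight_nonneg γ)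
    (fun x h => eq_zero_of_laguerreWeight h) (moment_laguerreWeight hγ)
  push_cast at this
  exact this

end Weights

/-! ### Rodrigues formulas by removing columns -/

section Rodrigues

variable {N : ℕ}

theorem part_of_pos (lam : Fin N → ℕ) {j : ℕ} (hj : 1 ≤ j) (hN : j ≤ N) :
    part lam j = lam ⟨j - 1, by lia⟩ := by
  rw [part, dif_pos]

theorem part_of_lt (lam : Fin N → ℕ) {j : ℕ} (hN : N < j) : part lam j = 0 := by
  rw [part, dif_neg (by lia)]

theorem part_addOnes_of_le {m : ℕ} (hm : m ≤ N) (lam : Fin N → ℕ) {j : ℕ} (hj : 1 ≤ j)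
    (hjm : j ≤ m) : part (addOnes m lam) j = part lam j + 1 := by
  rw [part_of_pos _ hj (hjm.trans hm), part_of_pos _ hj (hjm.trans hm), addOnes,
    if_pos (by show j - 1 < m; lia)]

theorem part_of_length_lt {m : ℕ} {lam : Fin N → ℕ}
    (hlam : ∀ i : Fin N, m ≤ (i : ℕ) → lam i = 0) {j : ℕ} (hj : m < j) : part lam j = 0 := by
  rcases Nat.lt_or_ge N j with h | h
  · exact part_of_lt lam h
  · rw [part_of_pos lam (by lia) h, hlam _ (by show m ≤ j - 1; lia)]

theorem addOnes_eq_zero {m : ℕ} {lam : Fin N → ℕ} (hlam : ∀ i : Fin N, m ≤ (i : ℕ) → lam i = 0)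
    (i : Fin N) (hi : m ≤ (i : ℕ)) : addOnes m lam i = 0 := by
  rw [addOnes, if_neg (by lia), hlam i hi]

theorem reverse_range_prod_succ (f : ℕ → Op N) (n : ℕ) :
    (((List.range (n + 1)).map f).reverse).prod = f n * (((List.range n).map f).reverse).prod := by
  rw [List.range_succ, List.map_append, List.reverse_append, List.prod_append]
  simp

theorem reverse_range_prod_eq (f : ℕ → Op N) {m n : ℕ} (hmn : m ≤ n) (h : ∀ i, m ≤ i → f i = 1) :
    (((List.range n).map f).reverse).prod = (((List.range m).map f).reverse).prod := by
  induction n, hmn using Nat.le_induction with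
  | base => rfl
  | succ n hn ih => rw [reverse_range_prod_succ, h n hn, one_mul, ih]

/-- A new column of height m changes only the difference λ_m - λ_{m+1}, and the factors with larger
index are trivial, so the new operator stands on the far left. -/
theorem iterated_addOnes (B : ℕ → Op N) {m : ℕ} (hm : 1 ≤ m) (hmN : m ≤ N) {lam : Fin N → ℕ}
    (hlam : ∀ i : Fin N, m ≤ (i : ℕ) → lam i = 0) :
    iterated B (addOnes m lam) = B m * iterated B lam := by
  obtain ⟨n, rfl⟩ : ∃ n, m = n + 1 := ⟨m - 1, by lia⟩
  rw [iterated, iterated, reverse_range_prod_eq _ hmN, reverse_range_prod_eq _ hmN,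
    reverse_range_prod_succ, reverse_range_prod_succ, ← mul_assoc, ← pow_succ',
    part_addOnes_of_le hmN lam (by lia) le_rfl,
    part_of_length_lt (addOnes_eq_zero hlam) (by lia : n + 1 < n + 2),
    part_of_length_lt hlam (by lia : n + 1 < n + 2)]
  · congr 3
    refine List.map_congr_left fun i hi => ?_
    have hi := List.mem_range.1 hi
    rw [part_addOnes_of_le hmN lam (by lia) (by lia), part_addOnes_of_le hmN lam (by lia) (by lia),
      Nat.add_sub_add_right]
  · intro i hi
    rw [part_of_length_lt hlam (by lia), Nat.zero_sub, pow_zero]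
  · intro i hi
    rw [part_of_length_lt (addOnes_eq_zero hlam) (by lia), Nat.zero_sub, pow_zero]

theorem conjPart_addOnes_one {m : ℕ} (hm : m ≤ N) {lam : Fin N → ℕ}
    (hlam : ∀ i : Fin N, m ≤ (i : ℕ) → lam i = 0) : conjPart (addOnes m lam) 1 = m := by
  have : (Finset.univ.filter fun i : Fin N => 1 ≤ addOnes m lam i) =
      Finset.univ.filter fun i : Fin N => (i : ℕ) < m := by
    refine Finset.filter_congr fun i _ => ?_
    have := hlam i
    rw [addOnes]
    split_ifs <;> lia
  rw [conjPart, this, Fin.card_filter_val_lt, min_eq_right hm]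

theorem conjPart_addOnes_succ {m : ℕ} {lam : Fin N → ℕ}
    (hlam : ∀ i : Fin N, m ≤ (i : ℕ) → lam i = 0) {j : ℕ} (hj : 1 ≤ j) :
    conjPart (addOnes m lam) (j + 1) = conjPart lam j := by
  rw [conjPart, conjPart]
  congr 1
  refine Finset.filter_congr fun i _ => ?_
  have := hlam i
  rw [addOnes]
  split_ifs <;> lia

/-- The new column, of height m, becomes the first one and contributes the factors of
`raisingCoeff`; the old boxes move one column to the right with unchanged factors. -/
theorem hookProdInv_addOnes (β : ℕ) {m : ℕ} (hm : m ≤ N) {lam : Fin N → ℕ}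
    (hlam : ∀ i : Fin N, m ≤ (i : ℕ) → lam i = 0) :
    hookProdInv β (addOnes m lam) = (raisingCoeff β m lam)⁻¹ * hookProdInv β lam := by
  have hsub : Finset.Icc 1 m ⊆ Finset.Icc 1 N := Finset.Icc_subset_Icc le_rfl hm
  have hout : ∀ (μ : Fin N → ℕ), (∀ i : Fin N, m ≤ (i : ℕ) → μ i = 0) →
      hookProdInv β μ = ∏ i ∈ Finset.Icc 1 m, ∏ j ∈ Finset.Icc 1 (part μ i),
        ((part μ i : ℂ) - (j : ℂ) + (β : ℂ) * ((conjPart μ j : ℂ) - (i : ℂ) + 1))⁻¹ := by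
    intro μ hμ
    refine (Finset.prod_subset hsub fun i hi hi' => ?_).symm
    rw [Finset.mem_Icc] at hi hi'
    rw [part_of_length_lt hμ (by lia)]
    simp
  rw [hout _ (addOnes_eq_zero hlam), hout _ hlam, raisingCoeff, ← Finset.prod_inv_distrib,
    ← Finset.prod_mul_distrib]
  refine Finset.prod_congr rfl fun i hi => ?_
  rw [Finset.mem_Icc] at hi
  rw [part_addOnes_of_le hm lam hi.1 hi.2, ← Finset.mul_prod_Ioc_eq_prod_Icc (by lia)]
  congr 1
  · rw [conjPart_addOnes_one hm hlam]
    push_cast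
    congr 1
    ring
  · refine (Finset.prod_nbij' (· + 1) (· - 1) ?_ ?_ ?_ ?_ fun j hj => ?_).symm
    · intro j hj; simp only [Finset.mem_Icc, Finset.mem_Ioc] at hj ⊢; lia
    · intro j hj; simp only [Finset.mem_Icc, Finset.mem_Ioc] at hj ⊢; lia
    · intro j _; exact Nat.add_sub_cancel j 1
    · intro j hj; simp only [Finset.mem_Ioc] at hj; lia
    rw [conjPart_addOnes_succ hlam (Finset.mem_Icc.1 hj).1]
    push_cast
    congr 1
    ring

/-- Since j ≤ m, each factor is a natural number that is at least β. -/
theorem raisingCoeff_ne_zero {β : ℕ} (hβ : 0 < β) (m : ℕ) (lam : Fin N → ℕ) :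
    raisingCoeff β m lam ≠ 0 := by
  refine Finset.prod_ne_zero_iff.2 fun j hj => ?_
  have hj := (Finset.mem_Icc.1 hj).2
  have : ((part lam j : ℂ) + (β : ℂ) * ((m : ℂ) - (j : ℂ) + 1)) =
      ((part lam j + β * (m - j + 1) : ℕ) : ℂ) := by
    push_cast [Nat.cast_sub hj]
    rfl
  rw [this, Nat.cast_ne_zero]
  positivity

/-- Removal of the first column; m is the number of non-zero parts. -/
theorem exists_eq_addOnes {lam : Fin N → ℕ} (hlam : Antitone lam) (h0 : lam ≠ 0) :
    ∃ m μ, 1 ≤ m ∧ m ≤ N ∧ Antitone μ ∧ (∀ i : Fin N, m ≤ (i : ℕ) → μ i = 0) ∧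
      lam = addOnes m μ := by
  set A : Finset (Fin N) := {i | lam i ≠ 0} with hA
  have hAf := eq_filter_of_lower (A := A) fun i j hij hj => by
    rw [hA, Finset.mem_filter] at hj ⊢
    have := hlam hij
    exact ⟨Finset.mem_univ _, by lia⟩
  have hiff : ∀ i : Fin N, lam i ≠ 0 ↔ (i : ℕ) < A.card := fun i => by
    have := Finset.ext_iff.1 hAf i
    simpa [hA] using this
  refine ⟨A.card, fun i => lam i - 1, ?_, ?_, ?_, ?_, ?_⟩
  · obtain ⟨i, hi⟩ := Function.ne_iff.1 h0
    exact Nat.lt_of_le_of_lt (Nat.zero_le _) ((hiff i).1 hi)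
  · exact (Finset.card_le_univ A).trans (by simp)
  · exact fun i j hij => Nat.sub_le_sub_right (hlam hij) 1
  · intro i hi
    have := hiff i
    show lam i - 1 = 0
    lia
  · funext i
    have := hiff i
    rw [addOnes]
    split_ifs <;> lia

/-- Induction on |λ|: the raising relation for the partition without its first column is solved for
P(λ). The two families differ only in α, which is √2 for Hermite and 1 for Laguerre. -/
theorem rodrigues {β : ℕ} (hβ : 0 < β) {α : ℂ} (hα : α ≠ 0) (B : ℕ → Op N)
    (P : (Fin N → ℕ) → Poly N) (h0 : P 0 = 1)
    (hP : ∀ m ≤ N, ∀ lam : Fin N → ℕ, Antitone lam → (∀ i : Fin N, m ≤ (i : ℕ) → lam i = 0) →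
      B m (P lam) = (α ^ m * raisingCoeff β m lam) • P (addOnes m lam))
    (lam : Fin N → ℕ) (hlam : Antitone lam) :
    P lam = ((α ^ (∑ i, lam i))⁻¹ * hookProdInv β lam) • iterated B lam 1 := by
  induction hn : ∑ i, lam i using Nat.strong_induction_on generalizing lam with
  | _ n ih =>
    subst hn
    rcases eq_or_ne lam 0 with rfl | hne
    · have hp : ∀ j, part (0 : Fin N → ℕ) j = 0 := fun j => by
        rw [part]; split_ifs <;> rfl
      simp [h0, hookProdInv, iterated, hp]
    obtain ⟨m, μ, hm, hmN, hμ, hμ0, rfl⟩ := exists_eq_addOnes hlam hne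
    have hsum := sum_addOnes hmN μ
    have hrec := hP m hmN μ hμ hμ0
    rw [ih (∑ i, μ i) (by lia) μ hμ rfl, map_smul, ← Module.End.mul_apply,
      ← iterated_addOnes B hm hmN hμ0] at hrec
    have hc := raisingCoeff_ne_zero hβ m μ
    have hαm := pow_ne_zero m hα
    rw [hookProdInv_addOnes β hmN hμ0, hsum, pow_add, mul_inv,
      ← inv_smul_smul₀ (mul_ne_zero hαm hc) (P (addOnes m μ)), ← hrec, smul_smul]
    congr 1
    rw [mul_inv]
    ring

end Rodrigues

/-! ### The Hermite and Laguerre polynomials -/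

section Main

variable {N : ℕ}

theorem isOrth_iff_span {B : Poly N →ₗ[ℂ] Poly N →ₗ[ℂ] ℂ} {lam : Fin N → ℕ} (hlam : Antitone lam)
    {p : Poly N} : IsOrth B lam p ↔ p - mSym lam ∈
      Submodule.span ℂ {q | ∃ μ : Fin N → ℕ, Antitone μ ∧ DomLT μ lam ∧ q = mSym μ} ∧
    ∀ μ : Fin N → ℕ, Antitone μ → DomLT μ lam → B p (mSym μ) = 0 := by
  rw [← symLT_eq_span hlam]
  constructor
  · rintro ⟨h1, h2⟩
    refine ⟨h1, fun μ hμ hd => h2 _ ?_⟩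
    rw [symLT_eq_span hlam]
    exact Submodule.subset_span ⟨μ, hμ, hd, rfl⟩
  · rintro ⟨h1, h2⟩
    refine ⟨h1, fun g hg => ?_⟩
    have : symLT lam ≤ LinearMap.ker (B p) := by
      rw [symLT_eq_span hlam, Submodule.span_le]
      rintro _ ⟨μ, hμ, hd, rfl⟩
      exact h2 μ hμ hd
    exact this hg

theorem isHermite_iff (β : ℕ) {lam : Fin N → ℕ} (hlam : Antitone lam) {p : Poly N} :
    IsHermite β lam p ↔ IsOrth (formH N β) lam p := by
  simp only [isOrth_iff_span hlam, formH_apply]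
  rfl

theorem span_mSymSq (lam : Fin N → ℕ) :
    Submodule.span ℂ {q | ∃ μ : Fin N → ℕ, Antitone μ ∧ DomLT μ lam ∧ q = mSymSq μ} =
      (Submodule.span ℂ {q | ∃ μ : Fin N → ℕ, Antitone μ ∧ DomLT μ lam ∧ q = mSym μ}).map sqOp := by
  rw [Submodule.map_span]
  congr 1
  ext q
  constructor
  · rintro ⟨μ, hμ, hd, rfl⟩
    exact ⟨_, ⟨μ, hμ, hd, rfl⟩, rfl⟩
  · rintro ⟨_, ⟨μ, hμ, hd, rfl⟩, rfl⟩
    exact ⟨μ, hμ, hd, rfl⟩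

/-- All the data in the definition are polynomials in the squares, so the problem pulls back along
x_j ↦ z_j² to orthogonality for `formL`. -/
theorem isLaguerre_iff (β : ℕ) {γ : ℝ} (hγ : -(1 / 2) < γ) {lam : Fin N → ℕ} (hlam : Antitone lam)
    {p : Poly N} : IsLaguerre β γ lam p ↔ ∃ q, IsOrth (formL N β hγ) lam q ∧ sqOp q = p := by
  simp only [isOrth_iff_span hlam, formL_apply, sqOp_mSym]
  rw [IsLaguerre, span_mSymSq]
  constructor
  · rintro ⟨⟨r, hr, e⟩, h⟩
    have hp : sqOp (r + mSym lam) = p := by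
      rw [map_add, e, sqOp_mSym, sub_add_cancel]
    refine ⟨r + mSym lam, ⟨by rwa [add_sub_cancel_right], ?_⟩, hp⟩
    rwa [hp]
  · rintro ⟨q, ⟨h1, h2⟩, rfl⟩
    refine ⟨?_, h2⟩
    rw [← sqOp_mSym, ← map_sub]
    exact Submodule.mem_map_of_mem h1

theorem existsUnique_isHermite (β : ℕ) {lam : Fin N → ℕ} (hlam : Antitone lam) :
    ∃! p, IsHermite β lam p := by
  obtain ⟨f, hf⟩ := exists_isJack β hlam
  have h := (deformed_A β).isOrth (goodForm_formH β) hlam hf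
  refine ⟨_, (isHermite_iff β hlam).2 h, fun q hq => ?_⟩
  exact (goodForm_formH β).unique ((isHermite_iff β hlam).1 hq) h

theorem existsUnique_isLaguerre (β : ℕ) {γ : ℝ} (hγ : -(1 / 2) < γ) {lam : Fin N → ℕ}
    (hlam : Antitone lam) : ∃! p, IsLaguerre β γ lam p := by
  obtain ⟨f, hf⟩ := exists_isJack β hlam
  have h := (deformed_L β (γ - 2⁻¹)).isOrth (goodForm_formL β hγ) hlam hf
  refine ⟨_, (isLaguerre_iff β hγ hlam).2 ⟨_, h, rfl⟩, fun p hp => ?_⟩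
  obtain ⟨q, hq, rfl⟩ := (isLaguerre_iff β hγ hlam).1 hp
  rw [(goodForm_formL β hγ).unique hq h]

theorem isOrth_hermite (β : ℕ) {lam : Fin N → ℕ} (hlam : Antitone lam) :
    IsOrth (formH N β) lam (hermite β lam) :=
  (isHermite_iff β hlam).1 (Classical.epsilon_spec (existsUnique_isHermite β hlam).exists)

theorem isOrth_laguerre (β : ℕ) {γ : ℝ} (hγ : -(1 / 2) < γ) {lam : Fin N → ℕ}
    (hlam : Antitone lam) : ∃ q, IsOrth (formL N β hγ) lam q ∧ sqOp q = laguerre β γ lam :=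
  (isLaguerre_iff β hγ hlam).1 (Classical.epsilon_spec (existsUnique_isLaguerre β hγ hlam).exists)

/-- Nothing lies strictly below the empty partition, since a sum of squares cannot be negative. -/
theorem isOrth_zero_one (B : Poly N →ₗ[ℂ] Poly N →ₗ[ℂ] ℂ) : IsOrth B 0 1 where
  sub_mem := by
    have : (mSym 0 : Poly N) = 1 := by
      have h : (Finset.univ.image fun w : Equiv.Perm (Fin N) => (0 : Fin N → ℕ) ∘ w) = {0} := by
        rw [Finset.eq_singleton_iff_unique_mem]
        refine ⟨Finset.mem_image.2 ⟨1, Finset.mem_univ _, rfl⟩, fun a ha => ?_⟩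
        obtain ⟨w, -, rfl⟩ := Finset.mem_image.1 ha
        rfl
      rw [mSym, h]
      simp
    rw [this, sub_self]
    exact Submodule.zero_mem _
  orth g hg := by
    have : g = 0 := by
      ext b
      exact coeff_eq_zero_of_mem hg.1 fun h => by simpa using h.2
    rw [this, map_zero]

theorem hermite_zero (β : ℕ) : hermite β (0 : Fin N → ℕ) = 1 :=
  (goodForm_formH β).unique (isOrth_hermite β antitone_const) (isOrth_zero_one _)

theorem laguerre_zero (β : ℕ) {γ : ℝ} (hγ : -(1 / 2) < γ) :
    laguerre β γ (0 : Fin N → ℕ) = 1 := by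
  obtain ⟨q, hq, e⟩ := isOrth_laguerre (N := N) β hγ (lam := 0) antitone_const
  rw [← e, (goodForm_formL β hγ).unique hq (isOrth_zero_one _), sqOp_one]

theorem raisingH_hermite (β : ℕ) {m : ℕ} (hmN : m ≤ N) {lam : Fin N → ℕ} (hlam : Antitone lam)
    (hm : ∀ i : Fin N, m ≤ (i : ℕ) → lam i = 0) :
    raisingH N β m (hermite β lam) =
      (sqrtTwo ^ m * raisingCoeff β m lam) • hermite β (addOnes m lam) :=
  (deformed_A β).raising_eq (goodForm_formH β) hmN hlam hm (isOrth_hermite β hlam)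
    (isOrth_hermite β (antitone_addOnes m hlam))

theorem raisingL_laguerre (β : ℕ) {γ : ℝ} (hγ : -(1 / 2) < γ) {m : ℕ} (hmN : m ≤ N)
    {lam : Fin N → ℕ} (hlam : Antitone lam) (hm : ∀ i : Fin N, m ≤ (i : ℕ) → lam i = 0) :
    raisingL N β γ m (laguerre β γ lam) =
      raisingCoeff β m lam • laguerre β γ (addOnes m lam) := by
  obtain ⟨p, hp, ep⟩ := isOrth_laguerre β hγ hlam
  obtain ⟨q, hq, eq⟩ := isOrth_laguerre β hγ (antitone_addOnes m hlam)
  rw [← ep, ← eq, raisingL_sqOp,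
    (deformed_L β (γ - 2⁻¹)).raising_eq (goodForm_formL β hγ) hmN hlam hm hp hq, one_pow, one_mul,
    map_smul]

end Main

end CalogeroPoly

end

theorem mainTheorem5 (N β : ℕ) (γ : ℝ) (hγ : -(1 / 2) < γ) :
    -- the defining properties determine the two families of polynomials
    (∀ lam : Fin N → ℕ, Antitone lam →
      (∃! p, CalogeroPoly.IsHermite β lam p) ∧ ∃! p, CalogeroPoly.IsLaguerre β γ lam p) ∧
    -- the operators are the transports of the Kirillov–Noumi operators
    (∀ m ≤ N, ∀ f : CalogeroPoly.Poly N,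
      CalogeroPoly.sigmaA N β (CalogeroPoly.raisingJ N β m f) =
          CalogeroPoly.raisingH N β m (CalogeroPoly.sigmaA N β f) ∧
        CalogeroPoly.sigmaB N β γ (CalogeroPoly.raisingJ N β m f) =
          CalogeroPoly.raisingL N β γ m (CalogeroPoly.sigmaB N β γ f)) ∧
    -- raising property, for partitions with at most `m` parts
    (∀ m ≤ N, ∀ lam : Fin N → ℕ, Antitone lam → (∀ i : Fin N, m ≤ (i : ℕ) → lam i = 0) →
      CalogeroPoly.raisingH N β m (CalogeroPoly.hermite β lam) =
          (CalogeroPoly.sqrtTwo ^ m * CalogeroPoly.raisingCoeff β m lam) •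
            CalogeroPoly.hermite β (CalogeroPoly.addOnes m lam) ∧
        CalogeroPoly.raisingL N β γ m (CalogeroPoly.laguerre β γ lam) =
          CalogeroPoly.raisingCoeff β m lam •
            CalogeroPoly.laguerre β γ (CalogeroPoly.addOnes m lam)) ∧
    -- Rodrigues-type formulas
    (0 < β → ∀ lam : Fin N → ℕ, Antitone lam →
      CalogeroPoly.hermite β lam =
          ((CalogeroPoly.sqrtTwo ^ (∑ i, lam i))⁻¹ * CalogeroPoly.hookProdInv β lam) •
            CalogeroPoly.iterated (fun m => CalogeroPoly.raisingH N β m) lam 1 ∧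
        CalogeroPoly.laguerre β γ lam =
          CalogeroPoly.hookProdInv β lam •
            CalogeroPoly.iterated (fun m => CalogeroPoly.raisingL N β γ m) lam 1) := by
  open CalogeroPoly in
  refine ⟨fun lam hlam => ⟨existsUnique_isHermite β hlam, existsUnique_isLaguerre β hγ hlam⟩,
    fun m _ f => ⟨sigmaA_raisingJ β m f, sigmaB_raisingJ β γ m f⟩,
    fun m hmN lam hlam hm => ⟨raisingH_hermite β hmN hlam hm, raisingL_laguerre β hγ hmN hlam hm⟩,
    fun hβ lam hlam => ⟨rodrigues hβ sqrtTwo_ne_zero _ (hermite β) (hermite_zero β)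
      (fun m hmN μ hμ hm => raisingH_hermite β hmN hμ hm) lam hlam, ?_⟩⟩
  simpa only [one_pow, inv_one, one_mul] using CalogeroPoly.rodrigues hβ one_ne_zero
    (fun m => CalogeroPoly.raisingL N β γ m) (CalogeroPoly.laguerre β γ)
    (CalogeroPoly.laguerre_zero β hγ) (fun m hmN μ hμ hm => by
      rw [CalogeroPoly.raisingL_laguerre β hγ hmN hμ hm, one_pow, one_mul]) lam hlam
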